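/- Setting. Let $\Gamma(t)\subset\mathbb R^3$, $t\in I$ ($I\subseteq\mathbb R$ open), be a smoothly evolving closed (compact, without boundary), embedded, oriented surface with unit normal $\boldsymbol n$. It is described by a material parametrization $\boldsymbol X_{\mathfrak m}$ and by an arbitrary observer parametrization $\boldsymbol X$ with the same images and the same normal velocity, $\partial_t\boldsymbol X\cdot\boldsymbol n=\partial_t\boldsymbol X_{\mathfrak m}\cdot\boldsymbol n$. Let $\boldsymbol u=\partial_t\boldsymbol X_{\mathfrak m}$ be the material velocity and $\boldsymbol v=\boldsymbol u-\partial_t\boldsymbol X$ the relative velocity; for fields on the surface $\partial_t$ is taken at fixed observer coordinates, and $\dot f=\partial_t f+\nabla_{\boldsymbol v}f$ is the material derivative (componentwise for vector fields). Write $P=\mathrm{Id}-\boldsymbol n\otimes\boldsymbol n$. With arbitrary smooth extensions of the fields to $\mathbb R^3$, put $\nabla_\Gamma f=P\nabla f$, $\nabla_P\boldsymbol w=P(\nabla\boldsymbol w)P$, $\operatorname{div}_P\boldsymbol w=\operatorname{tr}\nabla_P\boldsymbol w$, $\Delta_\Gamma f=\operatorname{div}_P\nabla_\Gamma f$, and,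 for tensor fields with Cartesian components $\sigma^{AB}$, $(\operatorname{div}_C\boldsymbol\sigma)^A=\sum_B(\nabla_\Gamma\sigma^{AB})^B$. Let $\mathcal B=-\nabla_P\boldsymbol n$, $\mathcal H=\operatorname{tr}\mathcal B$, $\boldsymbol\sigma(\boldsymbol u)=\frac12(\nabla_P\boldsymbol u+(\nabla_P\boldsymbol u)^T)$; tensor norms are Frobenius norms. Let $\rho,\tilde\sigma,\epsilon,m>0$ and $\eta,\gamma\ge0$ be constants, $W(s)=\frac14(s^2-1)^2$, and let $\kappa,\mathcal H_0:\mathbb R\to\mathbb R$ be smooth (for instance the cubic interpolations $f(s)=\frac{f_1+f_2}{2}+\frac{f_1-f_2}{4}s(3-s^2)$). Let $(\boldsymbol u,p,\phi,\mu)$ be a smooth solution on $\Gamma(t)$, $t\in I$, of $$\partial_t\phi+\nabla_{\boldsymbol v}\phi=m\,\Delta_\Gamma\mu,$$ $$\mu=\tilde\sigma\Big(-\epsilon\Delta_\Gamma\phi+\tfrac1\epsilon W'(\phi)\Big)+\tfrac12\kappa'(\phi)(\mathcal H-\mathcal H_0(\phi))^2-\kappa(\phi)\mathcal H_0'(\phi)(\mathcal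 H-\mathcal H_0(\phi)),$$ $$\rho(\partial_t\boldsymbol u+\nabla_{\boldsymbol v}\boldsymbol u)=-\nabla_\Gamma p-p\mathcal H\boldsymbol n+2\eta\operatorname{div}_C\boldsymbol\sigma(\boldsymbol u)-\gamma\boldsymbol u+\boldsymbol b_T+\boldsymbol b_N,$$ $$\operatorname{div}_P\boldsymbol u=0,$$ where $\boldsymbol b_T=\mu\nabla_\Gamma\phi$ and $$\boldsymbol b_N=-\Big(\Delta_\Gamma\big(\kappa(\phi)(\mathcal H-\mathcal H_0(\phi))\big)+\kappa(\phi)(\mathcal H-\mathcal H_0(\phi))\big(\|\mathcal B\|^2-\tfrac12\mathcal H(\mathcal H-\mathcal H_0(\phi))\big)\Big)\boldsymbol n+\tilde\sigma\Big(\tfrac\epsilon2\|\nabla_\Gamma\phi\|^2+\tfrac1\epsilon W(\phi)\Big)\mathcal H\boldsymbol n-\tilde\sigma\epsilon\,(\nabla_\Gamma\phi\cdot\mathcal B\nabla_\Gamma\phi)\,\boldsymbol n.$$ Define the energies $$\mathcal F_K=\int_{\Gamma(t)}\tfrac\rho2\|\boldsymbol u\|^2,\qquad \mathcal F=\int_{\Gamma(t)}\tilde\sigma\Big(\tfrac\epsilon2\|\nabla_\Gamma\phi\|^2+\tfrac1\epsilon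 W(\phi)\Big)+\int_{\Gamma(t)}\tfrac12\kappa(\phi)(\mathcal H-\mathcal H_0(\phi))^2$$ and the dissipation potential $$\mathcal D=\int_{\Gamma(t)}\eta\|\boldsymbol\sigma(\boldsymbol u)\|^2+\int_{\Gamma(t)}\tfrac\gamma2\|\boldsymbol u\|^2+\tfrac1{2m}|\dot\phi|^2_{H^{-1}},$$ where $|f|^2_{H^{-1}}=\int_{\Gamma(t)}\|\nabla_\Gamma\psi\|^2$ for any smooth $\psi$ with $\Delta_\Gamma\psi=f$ on $\Gamma(t)$. Claim. For every $t\in I$ the total energy is differentiable at $t$ and $$\frac{d}{dt}\big(\mathcal F_K+\mathcal F\big)=-2\mathcal D\le 0 .$$ -/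

import Mathlib

open Set MeasureTheory
open scoped ContDiff Manifold RealInnerProductSpace

noncomputable section

namespace TwoPhaseSurface

/-- The embedding space `ℝ³`. -/
abbrev E3 := EuclideanSpace ℝ (Fin 3)

/-- The Cartesian basis of `ℝ³`. -/
abbrev eb (i : Fin 3) : E3 := EuclideanSpace.single i 1

/-! ### Surface calculus

A field on a surface `Γ ⊆ ℝ³` is represented by an arbitrary extension to `ℝ³` which is smooth at
the points of `Γ`. The same is done with the unit normal `n`. All operators below, evaluated at
points of `Γ`, depend only on the restrictions of the fields and of `n` to `Γ`. -/

/-- `I - ν ⊗ ν`, the projection to the plane orthogonal to the unit vector `ν`. -/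
def tangProj (ν : E3) : E3 →L[ℝ] E3 :=
  ContinuousLinearMap.id ℝ E3 - (innerSL ℝ ν).smulRight ν

/-- Trace of a tensor. -/
def tr (A : E3 →L[ℝ] E3) : ℝ := LinearMap.trace ℝ E3 (A : E3 →ₗ[ℝ] E3)

/-- Squared Frobenius norm of a tensor. -/
def frobSq (A : E3 →L[ℝ] E3) : ℝ := ∑ i, ‖A (eb i)‖ ^ 2

/-- Surface gradient `P ∇f` of a scalar field. -/
def gradS (n : E3 → E3) (f : E3 → ℝ) (x : E3) : E3 := tangProj (n x) (gradient f x)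

/-- Componentwise surface gradient `(∇v) P` of a vector field. -/
def gradC (n : E3 → E3) (v : E3 → E3) (x : E3) : E3 →L[ℝ] E3 :=
  (fderiv ℝ v x).comp (tangProj (n x))

/-- Tangential surface gradient `P (∇v) P` of a vector field. -/
def gradP (n : E3 → E3) (v : E3 → E3) (x : E3) : E3 →L[ℝ] E3 :=
  (tangProj (n x)).comp (gradC n v x)

/-- Tangential divergence `tr (P (∇v) P)` of a (not necessarily tangential) vector field. -/
def divP (n : E3 → E3) (v : E3 → E3) (x : E3) : ℝ := tr (gradP n v x)

/-- Componentwise divergence of a right-tangential tensor field: the vector with Cartesian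
components `∑_B (e_B, ∇_Γ σ^{AB})`. -/
def divC (n : E3 → E3) (σ : E3 → E3 →L[ℝ] E3) (x : E3) : E3 :=
  ∑ i, (fderiv ℝ σ x (tangProj (n x) (eb i))) (eb i)

/-- Laplace–Beltrami operator, `div_P ∇_P f`. -/
def lapS (n : E3 → E3) (f : E3 → ℝ) (x : E3) : ℝ := divP n (gradS n f) x

/-- Shape operator `B = -∇_P n`. -/
def shapeOp (n : E3 → E3) (x : E3) : E3 →L[ℝ] E3 := -gradP n n x

/-- Mean curvature `H = tr B` (equal to `-2` on the unit sphere with outward normal). -/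
def meanCurv (n : E3 → E3) (x : E3) : ℝ := tr (shapeOp n x)

/-- Rate of deformation tensor `½ (∇_P u + (∇_P u)ᵀ)`. -/
def rateOfDef (n : E3 → E3) (u : E3 → E3) (x : E3) : E3 →L[ℝ] E3 :=
  (1 / 2 : ℝ) • (gradP n u x + ContinuousLinearMap.adjoint (gradP n u x))

/-- Integral over a surface with respect to the area measure. -/
def surfInt (Γ : Set E3) (f : E3 → ℝ) : ℝ := ∫ x in Γ, f x ∂(μHE[2] : Measure E3)

/-- Squared `H⁻¹` seminorm of a field `f` on `Γ`: the Dirichlet energy of a solution `ψ` of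
`Δ_Γ ψ = f`. All solutions have the same Dirichlet energy, so that the infimum ranges over a
one-point set as soon as `f` has a potential. -/
def hMinusOneSq (Γ : Set E3) (n : E3 → E3) (f : E3 → ℝ) : ℝ :=
  sInf {a | ∃ ψ : E3 → ℝ, (∀ x ∈ Γ, ContDiffAt ℝ ∞ ψ x) ∧ (∀ x ∈ Γ, lapS n ψ x = f x) ∧
    a = surfInt Γ fun x => ‖gradS n ψ x‖ ^ 2}

/-! ### Evolving closed surfaces -/

section Evolving

variable {M : Type*} [TopologicalSpace M] [ChartedSpace (EuclideanSpace ℝ (Fin 2)) M]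

/-- `X` parametrizes, for the times in `I`, a smoothly evolving embedded surface in `ℝ³` over the
two-dimensional manifold `M` (compact in the theorem, so that the surfaces are closed). -/
structure IsParametrization (I : Set ℝ) (X : ℝ → M → E3) : Prop where
  smooth : ContMDiffOn (𝓘(ℝ, ℝ).prod (𝓡 2)) 𝓘(ℝ, E3) ∞ (fun q : ℝ × M => X q.1 q.2)
    (I ×ˢ univ)
  injective : ∀ t ∈ I, Function.Injective (X t)
  immersion : ∀ t ∈ I, ∀ y, Function.Injective (mfderiv (𝓡 2) 𝓘(ℝ, E3) (X t) y)

/-- A time dependent field on the surfaces `Γ t`, `t ∈ I`, is smooth: it is given by an extension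
which is smooth in time and space at all points of these surfaces. -/
def SmoothField {F : Type*} [NormedAddCommGroup F] [NormedSpace ℝ F]
    (I : Set ℝ) (Γ : ℝ → Set E3) (f : ℝ → E3 → F) : Prop :=
  ∀ t ∈ I, ∀ x ∈ Γ t, ContDiffAt ℝ ∞ (fun q : ℝ × E3 => f q.1 q.2) (t, x)

/-- `n` is a smooth unit normal field of the surfaces parametrized by `X`, i.e. an orientation. -/
structure IsUnitNormal (I : Set ℝ) (X : ℝ → M → E3) (n : ℝ → E3 → E3) : Prop where
  smooth : SmoothField I (fun t => range (X t)) n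
  norm_eq_one : ∀ t ∈ I, ∀ y, ‖n t (X t y)‖ = 1
  orthogonal : ∀ t ∈ I, ∀ y, ∀ v : TangentSpace (𝓡 2) y,
    ⟪n t (X t y), (mfderiv (𝓡 2) 𝓘(ℝ, E3) (X t) y v : E3)⟫ = 0

/-- Velocity `∂ₜX` of the observer with coordinates `y`. -/
def obsVel (X : ℝ → M → E3) (t : ℝ) (y : M) : E3 := deriv (fun s => X s y) t

/-- Relative material velocity `u - ∂ₜX`. -/
def relVel (X : ℝ → M → E3) (u : ℝ → E3 → E3) (t : ℝ) (y : M) : E3 :=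
  u t (X t y) - obsVel X t y

/-- Material derivative `∂ₜφ + (∇_Γ φ, V)` of a scalar field; `∂ₜ` is taken at fixed observer
coordinates and `V` is the relative material velocity. -/
def matDeriv (X : ℝ → M → E3) (n : ℝ → E3 → E3) (u : ℝ → E3 → E3) (φ : ℝ → E3 → ℝ)
    (t : ℝ) (y : M) : ℝ :=
  deriv (fun s => φ s (X s y)) t + ⟪gradS (n t) (φ t) (X t y), relVel X u t y⟫

/-- Material acceleration `∂ₜu + (∇_C u) V`. -/
def matAccel (X : ℝ → M → E3) (n : ℝ → E3 → E3) (u : ℝ → E3 → E3) (t : ℝ) (y : M) : E3 :=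
  deriv (fun s => u s (X s y)) t + gradC (n t) (u t) (X t y) (relVel X u t y)

end Evolving

/-! ### The model -/

/-- Material parameters. The bending stiffness `κ` and the spontaneous curvature `H₀` are
arbitrary smooth functions of the phase field; this includes the cubic interpolations
`(f₁ + f₂) / 2 + (f₁ - f₂) / 4 * s * (3 - s ^ 2)` between values `f₁` at `s = 1` and `f₂` at
`s = -1`. -/
structure Params where
  /-- surface density -/
  ρ : ℝ
  /-- viscosity -/
  η : ℝ
  /-- friction coefficient -/
  γ : ℝ
  /-- mobility -/
  m : ℝ
  /-- rescaled line tension -/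
  σ : ℝ
  /-- interface width -/
  ε : ℝ
  /-- bending stiffness -/
  κ : ℝ → ℝ
  /-- spontaneous curvature -/
  H₀ : ℝ → ℝ
  ρ_pos : 0 < ρ
  η_nonneg : 0 ≤ η
  γ_nonneg : 0 ≤ γ
  m_pos : 0 < m
  σ_pos : 0 < σ
  ε_pos : 0 < ε
  κ_smooth : ContDiff ℝ ∞ κ
  H₀_smooth : ContDiff ℝ ∞ H₀

/-- Double-well potential `W`. -/
def doubleWell (s : ℝ) : ℝ := 1 / 4 * (s ^ 2 - 1) ^ 2

namespace Params

variable (c : Params)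

/-- Kinetic energy. -/
def kinetic (Γ : Set E3) (u : E3 → E3) : ℝ := surfInt Γ fun x => c.ρ / 2 * ‖u x‖ ^ 2

/-- Density of the Ginzburg–Landau energy. -/
def glDensity (n : E3 → E3) (φ : E3 → ℝ) (x : E3) : ℝ :=
  c.σ * (c.ε / 2 * ‖gradS n φ x‖ ^ 2 + 1 / c.ε * doubleWell (φ x))

/-- Ginzburg–Landau energy. -/
def ginzburgLandau (Γ : Set E3) (n : E3 → E3) (φ : E3 → ℝ) : ℝ := surfInt Γ (c.glDensity n φ)

/-- Helfrich bending energy. -/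
def helfrich (Γ : Set E3) (n : E3 → E3) (φ : E3 → ℝ) : ℝ :=
  surfInt Γ fun x => 1 / 2 * c.κ (φ x) * (meanCurv n x - c.H₀ (φ x)) ^ 2

/-- Potential energy. -/
def potential (Γ : Set E3) (n : E3 → E3) (φ : E3 → ℝ) : ℝ :=
  c.helfrich Γ n φ + c.ginzburgLandau Γ n φ

/-- Viscous dissipation potential. -/
def dissViscous (Γ : Set E3) (n : E3 → E3) (u : E3 → E3) : ℝ :=
  surfInt Γ fun x => c.η * frobSq (rateOfDef n u x)

/-- Friction dissipation potential. -/
def dissFriction (Γ : Set E3) (u : E3 → E3) : ℝ := surfInt Γ fun x => c.γ / 2 * ‖u x‖ ^ 2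

/-- Immobility potential of the phase field with rate `φdot`. -/
def dissPhase (Γ : Set E3) (n : E3 → E3) (φdot : E3 → ℝ) : ℝ :=
  1 / (2 * c.m) * hMinusOneSq Γ n φdot

/-- Dissipation potential. -/
def dissipation (Γ : Set E3) (n : E3 → E3) (u : E3 → E3) (φdot : E3 → ℝ) : ℝ :=
  c.dissViscous Γ n u + c.dissFriction Γ u + c.dissPhase Γ n φdot

/-- The field `κ(φ) (H - H₀(φ))`. -/
def bendingMoment (n : E3 → E3) (φ : E3 → ℝ) (x : E3) : ℝ :=
  c.κ (φ x) * (meanCurv n x - c.H₀ (φ x))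

/-- Right-hand side of the equation for the chemical potential. -/
def chemPot (n : E3 → E3) (φ : E3 → ℝ) (x : E3) : ℝ :=
  c.σ * (-c.ε * lapS n φ x + 1 / c.ε * deriv doubleWell (φ x))
    + 1 / 2 * deriv c.κ (φ x) * (meanCurv n x - c.H₀ (φ x)) ^ 2
    - c.κ (φ x) * deriv c.H₀ (φ x) * (meanCurv n x - c.H₀ (φ x))

/-- Tangential bending force `b_T = μ ∇_Γ φ`. -/
def forceT (n : E3 → E3) (φ μ : E3 → ℝ) (x : E3) : E3 := μ x • gradS n φ x

/-- Normal bending force `b_N`. -/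
def forceN (n : E3 → E3) (φ : E3 → ℝ) (x : E3) : E3 :=
  -(lapS n (c.bendingMoment n φ) x
      + c.κ (φ x) * (meanCurv n x - c.H₀ (φ x))
        * (frobSq (shapeOp n x) - 1 / 2 * meanCurv n x * (meanCurv n x - c.H₀ (φ x)))) • n x
    + (c.σ * (c.ε / 2 * ‖gradS n φ x‖ ^ 2 + 1 / c.ε * doubleWell (φ x)) * meanCurv n x) • n x
    - (c.σ * c.ε * ⟪gradS n φ x, shapeOp n x (gradS n φ x)⟫) • n x

/-- Smooth solutions `(u, p, φ, μ)` of the two-phase fluid deformable surface model on the time set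
`I`. `Xm` is the material parametrization and `X` an arbitrary observer parametrization of the same
evolving surface; `n` is the unit normal. -/
structure IsSmoothSolution {M : Type*} [TopologicalSpace M]
    [ChartedSpace (EuclideanSpace ℝ (Fin 2)) M] (I : Set ℝ) (Xm X : ℝ → M → E3)
    (n u : ℝ → E3 → E3) (p φ μ : ℝ → E3 → ℝ) : Prop where
  material : IsParametrization I Xm
  observer : IsParametrization I X
  same_surface : ∀ t ∈ I, range (Xm t) = range (X t)
  normal : IsUnitNormal I X n
  smooth_u : SmoothField I (fun t => range (X t)) u
  smooth_p : SmoothField I (fun t => range (X t)) p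
  smooth_φ : SmoothField I (fun t => range (X t)) φ
  smooth_μ : SmoothField I (fun t => range (X t)) μ
  /-- `u` is the material velocity. -/
  velocity : ∀ t ∈ I, ∀ y, u t (Xm t y) = deriv (fun s => Xm s y) t
  /-- Observer and material move with the same normal velocity. -/
  normal_velocity : ∀ t ∈ I, ∀ y,
    ⟪obsVel X t y, n t (X t y)⟫ = ⟪u t (X t y), n t (X t y)⟫
  phase : ∀ t ∈ I, ∀ y, matDeriv X n u φ t y = c.m * lapS (n t) (μ t) (X t y)
  chemical : ∀ t ∈ I, ∀ x ∈ range (X t), μ t x = c.chemPot (n t) (φ t) x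
  momentum : ∀ t ∈ I, ∀ y, c.ρ • matAccel X n u t y =
    -gradS (n t) (p t) (X t y) - (p t (X t y) * meanCurv (n t) (X t y)) • n t (X t y)
      + (2 * c.η) • divC (n t) (rateOfDef (n t) (u t)) (X t y) - c.γ • u t (X t y)
      + forceT (n t) (φ t) (μ t) (X t y) + c.forceN (n t) (φ t) (X t y)
  inextensible : ∀ t ∈ I, ∀ x ∈ range (X t), divP (n t) (u t) x = 0

end Params

end TwoPhaseSurface

end

open Set MeasureTheory
open scoped ContDiff Manifold RealInnerProductSpace

noncomputable section

namespace TwoPhaseSurface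

open Filter Topology
open scoped NNReal ENNReal

/-! ### Linear algebra in `ℝ³` -/

/-! The identity is proved pointwise, up to surface divergences. Since div_P u = 0, the area element
of the material parametrization is constant in time (`norm_areaVec_eq`). The energy at nearby times
is therefore an integral against one fixed measure on the parameter manifold, and its derivative is
the integral of the material derivative of the energy density (`hasDerivAt_surfInt`). The material
derivative depends on the evolving surface and on u only, because the relative velocity is
tangential, so the observer plays no role.

The core is `isDivergence_energy`: the material derivative of the energy density plus 2η‖σ(u)‖² +
γ‖u‖² + m‖∇μ‖² equals div_P W + H⟨W, n⟩ for an explicit smooth field W. Such an expression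
integrates to zero on a closed surface (`surfInt_divergence`).

Three ingredients produce W. The momentum equation turns the kinetic term into the power of the
forces. The evolution of the surface gradient gives the variation of the Ginzburg–Landau term, where
-⟨∇φ, ∇u ∇φ⟩ is the power of the Korteweg stress (`inner_gradS_fderiv`). The evolution of H, which
is -div_P(Dn) plus a contraction of ∇n with ∇u, combines with the Codazzi identity into
`bending_variation`. The normal forces then cancel against these variations. The chemical potential
collects all factors of the material derivative Dφ, and the phase equation turns μ Dφ into -m‖∇μ‖²
plus a divergence. What is left is the gradient of the potential energy density e along u together
with e H⟨u, n⟩, which is the divergence of e u.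

Finally mμ is a potential for Dφ, and by Green's formula all potentials have the same Dirichlet
energy. So the H⁻¹ term in 2D is m∫‖∇μ‖², which identifies the dissipation.

Surface integrals are taken with respect to Hausdorff measure, so the area formula is proved first,
in the form needed here: an injective immersion is locally bi-Lipschitz close to its derivative. All
fields are extensions to ℝ³; terms involving normal derivatives of the extensions occur throughout
and must cancel. -/

/-- The parameter plane. -/
abbrev E2 := EuclideanSpace ℝ (Fin 2)

/-- The Cartesian basis of the parameter plane. -/
abbrev fb (i : Fin 2) : E2 := EuclideanSpace.single i 1

theorem inner_eq_sum (a b : E3) : ⟪a, b⟫ = a 0 * b 0 + a 1 * b 1 + a 2 * b 2 := by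
  simp [PiLp.inner_apply, Fin.sum_univ_three, mul_comm]

/-- The cross product as a bilinear map. -/
def crossLin : E3 →ₗ[ℝ] E3 →ₗ[ℝ] E3 :=
  LinearMap.mk₂ ℝ
    (fun a b => !₂[a 1 * b 2 - a 2 * b 1, a 2 * b 0 - a 0 * b 2, a 0 * b 1 - a 1 * b 0])
    (by intro a b c; ext i; fin_cases i <;> simp <;> ring)
    (by intro r a b; ext i; fin_cases i <;> simp <;> ring)
    (by intro a b c; ext i; fin_cases i <;> simp <;> ring)
    (by intro r a b; ext i; fin_cases i <;> simp <;> ring)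

/-- The cross product as a continuous bilinear map. -/
def cross : E3 →L[ℝ] E3 →L[ℝ] E3 := LinearMap.toContinuousBilinearMap crossLin

@[simp] theorem cross_apply_zero (a b : E3) : cross a b 0 = a 1 * b 2 - a 2 * b 1 := rfl
@[simp] theorem cross_apply_one (a b : E3) : cross a b 1 = a 2 * b 0 - a 0 * b 2 := rfl
@[simp] theorem cross_apply_two (a b : E3) : cross a b 2 = a 0 * b 1 - a 1 * b 0 := rfl

theorem cross_anticomm (a b : E3) : cross a b = -cross b a := by
  ext i; fin_cases i <;> simp <;> ring

theorem inner_cross_rotate (a b c : E3) : ⟪a, cross b c⟫ = ⟪b, cross c a⟫ := by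
  simp only [inner_eq_sum, cross_apply_zero, cross_apply_one, cross_apply_two]; ring

theorem inner_cross_cross (a b : E3) :
    ⟪cross a b, cross a b⟫ = ⟪a, a⟫ * ⟪b, b⟫ - ⟪a, b⟫ * ⟪a, b⟫ := by
  simp only [inner_eq_sum, cross_apply_zero, cross_apply_one, cross_apply_two]; ring

theorem vec_eq_sum (v : E3) : v = v 0 • eb 0 + v 1 • eb 1 + v 2 • eb 2 := by
  ext i; fin_cases i <;> simp

theorem inner_eb (v : E3) (i : Fin 3) : ⟪v, eb i⟫ = v i := by
  rw [inner_eq_sum]; fin_cases i <;> simp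

theorem sum_inner_eb_mul (v w : E3) : ∑ i, ⟪v, eb i⟫ * ⟪w, eb i⟫ = ⟪v, w⟫ := by
  simp only [inner_eb, Fin.sum_univ_three]; rw [inner_eq_sum]

theorem tr_eq_sum (A : E3 →L[ℝ] E3) : tr A = ∑ i, ⟪A (eb i), eb i⟫ := by
  unfold tr
  rw [LinearMap.trace_eq_sum_inner _ (EuclideanSpace.basisFun (Fin 3) ℝ)]
  simp [real_inner_comm, eb]

theorem tr_add (A B : E3 →L[ℝ] E3) : tr (A + B) = tr A + tr B := by
  simp [tr_eq_sum, inner_add_left, Finset.sum_add_distrib]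

theorem tr_neg (A : E3 →L[ℝ] E3) : tr (-A) = -tr A := by simp [tr_eq_sum]

theorem tr_smul (r : ℝ) (A : E3 →L[ℝ] E3) : tr (r • A) = r * tr A := by
  simp [tr_eq_sum, inner_smul_left, Finset.mul_sum]

theorem tr_sub (A B : E3 →L[ℝ] E3) : tr (A - B) = tr A - tr B := by
  simp [tr_eq_sum, inner_sub_left, Finset.sum_sub_distrib]

theorem tr_comp_comm (A B : E3 →L[ℝ] E3) : tr (A.comp B) = tr (B.comp A) := by
  unfold tr
  exact LinearMap.trace_mul_comm ℝ (A : E3 →ₗ[ℝ] E3) (B : E3 →ₗ[ℝ] E3)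

theorem tr_smulRight (l : E3 →L[ℝ] ℝ) (w : E3) : tr (l.smulRight w) = l w := by
  conv_rhs => rw [vec_eq_sum w]
  simp [tr_eq_sum, Fin.sum_univ_three, inner_smul_left, mul_comm, inner_eb]

theorem tr_adjoint (A : E3 →L[ℝ] E3) : tr (ContinuousLinearMap.adjoint A) = tr A := by
  simp [tr_eq_sum, ContinuousLinearMap.adjoint_inner_left, real_inner_comm]

theorem frobSq_eq_tr (A : E3 →L[ℝ] E3) :
    frobSq A = tr ((ContinuousLinearMap.adjoint A).comp A) := by
  simp [tr_eq_sum, frobSq, ContinuousLinearMap.adjoint_inner_left]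

theorem tangProj_apply (ν v : E3) : tangProj ν v = v - ⟪ν, v⟫ • ν := by
  simp [tangProj]

theorem inner_tangProj_comm (ν v w : E3) : ⟪tangProj ν v, w⟫ = ⟪v, tangProj ν w⟫ := by
  simp only [tangProj_apply, inner_sub_left, inner_sub_right, inner_smul_left, inner_smul_right,
    RCLike.conj_to_real, real_inner_comm]
  ring

theorem tr_comp_tangProj (ν : E3) (L : E3 →L[ℝ] E3) :
    tr (L.comp (tangProj ν)) = tr L - ⟪ν, L ν⟫ := by
  have : L.comp (tangProj ν) = L - (innerSL ℝ ν).smulRight (L ν) := by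
    ext1 v; simp [tangProj_apply]
  rw [this, tr_sub, tr_smulRight]; simp

section Unit

variable {ν : E3} (hν : ‖ν‖ = 1)
include hν

theorem inner_self_unit : ⟪ν, ν⟫ = 1 := by simp [hν]

theorem inner_tangProj_self (v : E3) : ⟪ν, tangProj ν v⟫ = 0 := by
  simp [tangProj_apply, inner_sub_right, inner_smul_right, hν]

theorem tangProj_self : tangProj ν ν = 0 := by
  simp [tangProj_apply, hν]

theorem tangProj_idem (v : E3) : tangProj ν (tangProj ν v) = tangProj ν v := by
  rw [tangProj_apply ν (tangProj ν v), inner_tangProj_self hν]; simp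

/-- Cyclicity of the trace and P² = P make the left projection redundant, so surface divergences
only need the componentwise gradient. -/
theorem tr_tangProj_comp_comp (L : E3 →L[ℝ] E3) :
    tr ((tangProj ν).comp (L.comp (tangProj ν))) = tr (L.comp (tangProj ν)) := by
  rw [tr_comp_comm]
  congr 1
  ext1 v; simp [tangProj_idem hν]

end Unit

theorem tangProj_eq_of_orthogonal {ν v : E3} (h : ⟪ν, v⟫ = 0) : tangProj ν v = v := by
  simp [tangProj_apply, h]

/-- A vector orthogonal to two vectors `a`, `b` that are orthogonal to `ν`. -/
theorem cross_eq_smul_of_orthogonal {ν a b : E3} (hν : ‖ν‖ = 1) (ha : ⟪ν, a⟫ = 0)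
    (hb : ⟪ν, b⟫ = 0) : cross a b = ⟪ν, cross a b⟫ • ν := by
  have h1 : ν 0 * ν 0 + ν 1 * ν 1 + ν 2 * ν 2 = 1 := by
    rw [← inner_eq_sum, inner_self_unit hν]
  rw [inner_eq_sum] at ha hb
  ext i
  fin_cases i <;>
    simp only [Fin.zero_eta, Fin.mk_one, Fin.reduceFinMk, inner_eq_sum, cross_apply_zero,
      cross_apply_one, cross_apply_two, PiLp.smul_apply, smul_eq_mul]
  -- With c = a × b, the multipliers come from c‖ν‖² - ⟨ν, c⟩ν = -ν × (ν × c) and ν × (a × b) = ⟨ν,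
  -- b⟩a - ⟨ν, a⟩b.
  · linear_combination (-(a 1 * b 2 - a 2 * b 1)) * h1 + (ν 1 * b 2 - ν 2 * b 1) * ha -
      (ν 1 * a 2 - ν 2 * a 1) * hb
  · linear_combination (-(a 2 * b 0 - a 0 * b 2)) * h1 + (ν 2 * b 0 - ν 0 * b 2) * ha -
      (ν 2 * a 0 - ν 0 * a 2) * hb
  · linear_combination (-(a 0 * b 1 - a 1 * b 0)) * h1 + (ν 0 * b 1 - ν 1 * b 0) * ha -
      (ν 0 * a 1 - ν 1 * a 0) * hb

theorem apply_coord (L : E3 →L[ℝ] E3) (v : E3) (i : Fin 3) :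
    L v i = v 0 * L (eb 0) i + v 1 * L (eb 1) i + v 2 * L (eb 2) i := by
  conv_lhs => rw [vec_eq_sum v]
  simp

/-- First variation of the area element. -/
theorem inner_cross_variation (L : E3 →L[ℝ] E3) (a b : E3) :
    ⟪cross a b, cross (L a) b + cross a (L b)⟫
      = ⟪cross a b, cross a b⟫ * tr L - ⟪cross a b, L (cross a b)⟫ := by
  simp only [tr_eq_sum, inner_eb, Fin.sum_univ_three]
  simp only [inner_eq_sum, apply_coord L a,
    apply_coord L b, apply_coord L (cross a b), PiLp.add_apply, cross_apply_zero, cross_apply_one,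
    cross_apply_two]
  ring

/-- First variation of the signed area element. -/
theorem inner_normal_cross_variation {ν a b : E3} (hν : ‖ν‖ = 1) (ha : ⟪ν, a⟫ = 0)
    (hb : ⟪ν, b⟫ = 0) (h0 : cross a b ≠ 0) (L : E3 →L[ℝ] E3) :
    ⟪ν, cross (L a) b + cross a (L b)⟫
      = ⟪ν, cross a b⟫ * tr ((tangProj ν).comp (L.comp (tangProj ν))) := by
  have hc := cross_eq_smul_of_orthogonal hν ha hb
  have hl : ⟪ν, cross a b⟫ ≠ 0 := by
    intro h; rw [h, zero_smul] at hc; exact h0 hc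
  rw [tr_tangProj_comp_comp hν, tr_comp_tangProj]
  have h := inner_cross_variation L a b
  -- With a × b = lν the unsigned identity is l times the signed one, and l ≠ 0.
  rw [hc] at h
  generalize ⟪ν, cross a b⟫ = l at *
  simp only [inner_smul_left, inner_smul_right, map_smul, RCLike.conj_to_real,
    inner_self_unit hν] at h
  apply mul_left_cancel₀ hl
  linear_combination h

/-! ### The area element of a linear map -/

/-- The vectorial area element of a linear map from the plane to the space. -/
def areaVec (A : E2 →L[ℝ] E3) : E3 := cross (A (fb 0)) (A (fb 1))

/-- Both squares are the Gram determinant of the two columns, by Lagrange's identity for the cross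
product. -/
theorem normDet_eq_norm_areaVec (A : E2 →L[ℝ] E3) :
    (A : E2 →ₗ[ℝ] E3).normDet = ‖areaVec A‖ := by
  rw [← sq_eq_sq₀ (LinearMap.normDet_nonneg _) (norm_nonneg _)]
  have h := LinearMap.normDet_sq_eq_det_gram (A : E2 →ₗ[ℝ] E3) (EuclideanSpace.basisFun (Fin 2) ℝ)
  rw [Matrix.det_fin_two] at h
  rw [← real_inner_self_eq_norm_sq, areaVec, inner_cross_cross]
  simpa [Matrix.gram, real_inner_comm] using h

theorem areaVec_ne_zero {A : E2 →L[ℝ] E3} (hA : Function.Injective A) : areaVec A ≠ 0 := by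
  rw [← norm_ne_zero_iff, ← normDet_eq_norm_areaVec]
  exact ((LinearMap.normDet_ne_zero_tfae (A : E2 →ₗ[ℝ] E3)).out 0 4).mpr hA

theorem continuous_areaVec : Continuous areaVec := by
  unfold areaVec; fun_prop

/-- An injective linear map from the plane covers the plane orthogonal to a normal of its range. -/
theorem exists_apply_eq_of_orthogonal {A : E2 →L[ℝ] E3} (hA : Function.Injective A) {ν : E3}
    (hν : ‖ν‖ = 1) (hort : ∀ v, ⟪ν, A v⟫ = 0) {w : E3} (hw : ⟪ν, w⟫ = 0) : ∃ v, A v = w := by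
  have hle : (A : E2 →ₗ[ℝ] E3).range ≤ (ℝ ∙ ν)ᗮ := by
    rintro _ ⟨v, rfl⟩
    rw [Submodule.mem_orthogonal_singleton_iff_inner_right]
    exact hort v
  have hν0 : ν ≠ 0 := by rintro rfl; simp at hν
  have h3 : Module.finrank ℝ E3 = 2 + 1 := by simp
  have : Fact (Module.finrank ℝ E3 = 2 + 1) := ⟨h3⟩
  have h1 : Module.finrank ℝ (ℝ ∙ ν)ᗮ = 2 := Submodule.finrank_orthogonal_span_singleton hν0
  have h2 : Module.finrank ℝ (A : E2 →ₗ[ℝ] E3).range = 2 := by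
    rw [LinearMap.finrank_range_of_inj hA]; simp
  have := Submodule.eq_of_le_of_finrank_eq hle (by rw [h1, h2])
  have hm : w ∈ (A : E2 →ₗ[ℝ] E3).range := by
    rw [this, Submodule.mem_orthogonal_singleton_iff_inner_right]; exact hw
  exact hm

/-! ### The area formula for injective immersions of planar domains -/

/-- The estimate forces `g` to be constant on the fibres of `h` in `S`, so on `S` it factors through
`h` by a `k`-Lipschitz map. No injectivity is needed. Used with a map and its derivative, in both
orders. -/
theorem euclideanHausdorffMeasure_image_le_of_edist_le {α Y Z : Type*} [EMetricSpace Y]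
    [MeasurableSpace Y] [BorelSpace Y] [EMetricSpace Z] [MeasurableSpace Z] [BorelSpace Z]
    (g : α → Y) (h : α → Z) (S : Set α) (k : ℝ≥0) (d : ℕ)
    (hk : ∀ x ∈ S, ∀ y ∈ S, edist (g x) (g y) ≤ k * edist (h x) (h y)) :
    μHE[d] (g '' S) ≤ (k : ℝ≥0∞) ^ d * μHE[d] (h '' S) := by
  rcases S.eq_empty_or_nonempty with rfl | ⟨x₀, -⟩
  · simp
  have : Nonempty α := ⟨x₀⟩
  have hinv : ∀ x ∈ S, Function.invFunOn h S (h x) ∈ S ∧ h (Function.invFunOn h S (h x)) = h x :=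
    fun x hx => ⟨Function.invFunOn_mem ⟨x, hx, rfl⟩, Function.invFunOn_eq ⟨x, hx, rfl⟩⟩
  have hlip : LipschitzOnWith k (g ∘ Function.invFunOn h S) (h '' S) := by
    rintro _ ⟨x, hx, rfl⟩ _ ⟨y, hy, rfl⟩
    have := hk _ (hinv x hx).1 _ (hinv y hy).1
    rwa [(hinv x hx).2, (hinv y hy).2] at this
  have himg : (g ∘ Function.invFunOn h S) '' (h '' S) = g '' S := by
    rw [image_image]
    refine image_congr fun x hx => ?_
    have := hk _ (hinv x hx).1 _ hx
    rw [(hinv x hx).2, edist_self, mul_zero, nonpos_iff_eq_zero, edist_eq_zero] at this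
    exact this
  have := hlip.hausdorffMeasure_image_le (d := d) (Nat.cast_nonneg d)
  rw [himg, ENNReal.rpow_natCast] at this
  simp only [Measure.euclideanHausdorffMeasure_def, Measure.smul_apply]
  simp only [ENNReal.smul_def, smul_eq_mul]
  rw [mul_left_comm]
  gcongr

theorem volume_image_linear (A : E2 →L[ℝ] E3) (S : Set E2) :
    μHE[2] (A '' S) = ENNReal.ofReal ‖areaVec A‖ * volume S := by
  have := (A : E2 →ₗ[ℝ] E3).euclideanHausdorffMeasure_image_eq_normDet_mul_volume S
  rw [normDet_eq_norm_areaVec] at this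
  simpa using this

/-- Near x₀ the map distorts distances by at most a factor k compared with its derivative A there,
which costs k² in area. Replacing the area factor of A by the varying one costs one more k. -/
theorem exists_nhds_image_comparable {f : E2 → E3} {x₀ : E2} (hf : ContDiffAt ℝ 1 f x₀)
    (himm : Function.Injective (fderiv ℝ f x₀)) {k : ℝ≥0} (hk : 1 < k) :
    ∃ V : Set E2, IsOpen V ∧ x₀ ∈ V ∧ ∀ S ⊆ V, MeasurableSet S →
      μHE[2] (f '' S) ≤ (k : ℝ≥0∞) ^ 3 * ∫⁻ x in S, ENNReal.ofReal ‖areaVec (fderiv ℝ f x)‖ ∧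
      ∫⁻ x in S, ENNReal.ofReal ‖areaVec (fderiv ℝ f x)‖ ≤ (k : ℝ≥0∞) ^ 3 * μHE[2] (f '' S) := by
  set A := fderiv ℝ f x₀ with hA
  obtain ⟨K, hK0, hK⟩ := (A : E2 →ₗ[ℝ] E3).exists_antilipschitzWith
    (LinearMap.ker_eq_bot.mpr himm)
  have hk0 : 0 < k := lt_trans one_pos hk
  have hk1 : (0 : ℝ) < 1 - 1 / k := by
    rw [sub_pos, div_lt_one (by exact_mod_cast hk0)]; exact_mod_cast hk
  -- The error c‖x - y‖ is at most cK‖A(x - y)‖ = (1 - 1/k)‖A(x - y)‖. This gives the lower bound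
  -- 1/k for ‖f x - f y‖ / ‖A(x - y)‖, and the upper bound 2 - 1/k ≤ k.
  obtain ⟨c, hc0, hcK⟩ : ∃ c : ℝ≥0, 0 < c ∧ (c : ℝ) * K = 1 - 1 / k :=
    ⟨⟨(1 - 1 / k) / K, (div_pos hk1 (by exact_mod_cast hK0)).le⟩,
      div_pos hk1 (by exact_mod_cast hK0), by
        show (1 - 1 / (k : ℝ)) / K * K = _
        field_simp⟩
  obtain ⟨s, hs, happ⟩ := (hf.hasStrictFDerivAt one_ne_zero).approximates_deriv_on_nhds
    (c := c) (Or.inr hc0)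
  have hJ0 : 0 < ‖areaVec A‖ := norm_pos_iff.mpr (areaVec_ne_zero himm)
  have hcont : ContinuousAt (fun x => ‖areaVec (fderiv ℝ f x)‖) x₀ :=
    (continuous_areaVec.continuousAt.comp
      ((hf.fderiv_right (m := 0) (by norm_num)).continuousAt)).norm
  have hkr : (1 : ℝ) < k := by exact_mod_cast hk
  have ev1 : ∀ᶠ x in 𝓝 x₀, ‖areaVec (fderiv ℝ f x)‖ < k * ‖areaVec A‖ :=
    hcont.eventually_lt continuousAt_const (by
      show ‖areaVec A‖ < _; exact lt_mul_of_one_lt_left hJ0 hkr)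
  have ev2 : ∀ᶠ x in 𝓝 x₀, ‖areaVec A‖ < k * ‖areaVec (fderiv ℝ f x)‖ :=
    continuousAt_const.eventually_lt (continuousAt_const.mul hcont) (by
      show _ < k * ‖areaVec A‖; exact lt_mul_of_one_lt_left hJ0 hkr)
  obtain ⟨V, hV, hVo, hxV⟩ := mem_nhds_iff.mp (ev1.and (ev2.and hs))
  refine ⟨V, hVo, hxV, fun S hSV hSm => ?_⟩
  have hest : ∀ x ∈ S, ∀ y ∈ S, ‖f x - f y - A (x - y)‖ ≤ (1 - 1 / k) * ‖A x - A y‖ := by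
    intro x hx y hy
    refine (happ x (hV (hSV hx)).2.2 y (hV (hSV hy)).2.2).trans ?_
    have := hK.le_mul_dist x y
    rw [dist_eq_norm, dist_eq_norm] at this
    rw [← hcK, mul_assoc]
    exact mul_le_mul_of_nonneg_left this c.coe_nonneg
  have hk2 : (1 - 1 / (k : ℝ)) ≤ k - 1 := by
    rw [sub_le_sub_iff, ← sub_nonneg]
    have : (k : ℝ) + 1 / k - (1 + 1) = (k - 1) ^ 2 / k := by field_simp; ring
    have h2 : (0 : ℝ) ≤ (k - 1) ^ 2 / k := by positivity
    linarith
  have le1 : ∀ x ∈ S, ∀ y ∈ S, edist (f x) (f y) ≤ k * edist (A x) (A y) := by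
    intro x hx y hy
    rw [edist_nndist, edist_nndist]
    norm_cast
    rw [← NNReal.coe_le_coe, NNReal.coe_mul, coe_nndist, coe_nndist, dist_eq_norm, dist_eq_norm]
    have h1 := hest x hx y hy
    have h2 := norm_sub_norm_le (f x - f y) (A (x - y))
    rw [map_sub] at h1 h2
    have h3 := mul_le_mul_of_nonneg_right hk2 (norm_nonneg (A x - A y))
    linarith
  have le2 : ∀ x ∈ S, ∀ y ∈ S, edist (A x) (A y) ≤ k * edist (f x) (f y) := by
    intro x hx y hy
    rw [edist_nndist, edist_nndist]
    norm_cast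
    rw [← NNReal.coe_le_coe, NNReal.coe_mul, coe_nndist, coe_nndist, dist_eq_norm, dist_eq_norm]
    have h1 := hest x hx y hy
    have h2 := norm_sub_norm_le (A (x - y)) (f x - f y)
    rw [norm_sub_rev (A (x - y)), map_sub] at h2
    rw [map_sub] at h1
    have h4 : 1 / k * ‖A x - A y‖ ≤ ‖f x - f y‖ := by linarith
    rwa [one_div, inv_mul_le_iff₀ (by positivity)] at h4
  have hm1 := euclideanHausdorffMeasure_image_le_of_edist_le f A S k 2 le1
  have hm2 := euclideanHausdorffMeasure_image_le_of_edist_le A f S k 2 le2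
  rw [volume_image_linear] at hm1 hm2
  have hi1 : ENNReal.ofReal ‖areaVec A‖ * volume S
      ≤ k * ∫⁻ x in S, ENNReal.ofReal ‖areaVec (fderiv ℝ f x)‖ := by
    rw [← lintegral_const_mul' _ _ ENNReal.coe_ne_top, ← setLIntegral_const]
    refine setLIntegral_mono' hSm fun x hx => ?_
    rw [← ENNReal.ofReal_coe_nnreal, ← ENNReal.ofReal_mul k.coe_nonneg]
    exact ENNReal.ofReal_le_ofReal (hV (hSV hx)).2.1.le
  have hi2 : ∫⁻ x in S, ENNReal.ofReal ‖areaVec (fderiv ℝ f x)‖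
      ≤ k * (ENNReal.ofReal ‖areaVec A‖ * volume S) := by
    rw [← mul_assoc, ← setLIntegral_const]
    refine setLIntegral_mono' hSm fun x hx => ?_
    rw [← ENNReal.ofReal_coe_nnreal, ← ENNReal.ofReal_mul k.coe_nonneg]
    exact ENNReal.ofReal_le_ofReal (hV (hSV hx)).1.le
  constructor
  · calc _ ≤ _ := hm1
      _ ≤ (k : ℝ≥0∞) ^ 2 * (k * ∫⁻ x in S, ENNReal.ofReal ‖areaVec (fderiv ℝ f x)‖) := by gcongr
      _ = _ := by ring
  · calc _ ≤ _ := hi2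
      _ ≤ k * ((k : ℝ≥0∞) ^ 2 * μHE[2] (f '' S)) := by gcongr
      _ = _ := by ring

theorem ennreal_le_of_forall_one_lt {a b : ℝ≥0∞} (h : ∀ k : ℝ≥0, 1 < k → a ≤ (k : ℝ≥0∞) ^ 3 * b) :
    a ≤ b := by
  have ht : Tendsto (fun k : ℝ≥0 => ((k : ℝ≥0∞) ^ 3) * b) (𝓝[>] 1)
      (𝓝 (((1 : ℝ≥0) : ℝ≥0∞) ^ 3 * b)) := by
    refine ENNReal.Tendsto.mul_const ?_ (by simp)
    refine Tendsto.mono_left ?_ nhdsWithin_le_nhds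
    exact ((ENNReal.continuous_pow 3).comp ENNReal.continuous_coe).tendsto 1
  simp only [ENNReal.coe_one, one_pow, one_mul] at ht
  exact ge_of_tendsto ht (eventually_nhdsWithin_of_forall fun k hk => h k hk)

/-- The area formula for an injective immersion of a planar domain. -/
theorem area_formula {f : E2 → E3} {U : Set E2} (hU : IsOpen U) (hf : ContDiffOn ℝ 1 f U)
    (hinj : InjOn f U) (himm : ∀ x ∈ U, Function.Injective (fderiv ℝ f x)) {S : Set E2}
    (hS : MeasurableSet S) (hSU : S ⊆ U) :
    μHE[2] (f '' S) = ∫⁻ x in S, ENNReal.ofReal ‖areaVec (fderiv ℝ f x)‖ := by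
  have key : ∀ k : ℝ≥0, 1 < k →
      μHE[2] (f '' S) ≤ (k : ℝ≥0∞) ^ 3 * ∫⁻ x in S, ENNReal.ofReal ‖areaVec (fderiv ℝ f x)‖ ∧
      ∫⁻ x in S, ENNReal.ofReal ‖areaVec (fderiv ℝ f x)‖ ≤ (k : ℝ≥0∞) ^ 3 * μHE[2] (f '' S) := by
    intro k hk
    have hloc := fun x : U => exists_nhds_image_comparable
      (hf.contDiffAt (hU.mem_nhds x.2)) (himm x x.2) hk
    choose V hVo hxV hV using hloc
    obtain ⟨T, hTc, hT⟩ := TopologicalSpace.isOpen_iUnion_countable V hVo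
    rcases U.eq_empty_or_nonempty with rfl | ⟨x₁, hx₁⟩
    · simp [subset_empty_iff.mp hSU]
    have hTne : T.Nonempty := by
      have : x₁ ∈ ⋃ i ∈ T, V i := by rw [hT]; exact mem_iUnion.mpr ⟨⟨x₁, hx₁⟩, hxV _⟩
      obtain ⟨i, hi, -⟩ := mem_iUnion₂.mp this
      exact ⟨i, hi⟩
    obtain ⟨e, he⟩ := hTc.exists_eq_range hTne
    -- A countable subcover by good neighbourhoods is made disjoint; injectivity keeps the images
    -- disjoint, so the local comparison can be summed.
    set D : ℕ → Set E2 := fun i => S ∩ disjointed (fun j => V (e j)) i with hD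
    have hDV : ∀ i, D i ⊆ V (e i) := fun i => inter_subset_right.trans (disjointed_subset _ i)
    have hDm : ∀ i, MeasurableSet (D i) := fun i =>
      hS.inter (MeasurableSet.disjointed (fun j => (hVo (e j)).measurableSet) i)
    have hDd : Pairwise (Function.onFun Disjoint D) := fun i j hij =>
      (disjoint_disjointed (fun j => V (e j)) hij).mono inter_subset_right inter_subset_right
    have hSD : S = ⋃ i, D i := by
      rw [← inter_iUnion, iUnion_disjointed, eq_comm, inter_eq_left]
      intro x hx
      have : x ∈ ⋃ i ∈ T, V i := by rw [hT]; exact mem_iUnion.mpr ⟨⟨x, hSU hx⟩, hxV _⟩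
      rw [he, biUnion_range] at this
      exact this
    have hDU : ∀ i, D i ⊆ U := fun i => inter_subset_left.trans hSU
    have himgm : ∀ i, MeasurableSet (f '' D i) := fun i =>
      (hDm i).image_of_continuousOn_injOn (hf.continuousOn.mono (hDU i)) (hinj.mono (hDU i))
    have himgd : Pairwise (Function.onFun Disjoint fun i => f '' D i) := fun i j hij =>
      (hDd hij).image hinj (hDU i) (hDU j)
    have h1 : μHE[2] (f '' S) = ∑' i, μHE[2] (f '' D i) := by
      rw [hSD, image_iUnion, measure_iUnion himgd himgm]
    have h2 : ∫⁻ x in S, ENNReal.ofReal ‖areaVec (fderiv ℝ f x)‖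
        = ∑' i, ∫⁻ x in D i, ENNReal.ofReal ‖areaVec (fderiv ℝ f x)‖ := by
      conv_lhs => rw [hSD]
      rw [lintegral_iUnion hDm hDd]
    rw [h1, h2, ← ENNReal.tsum_mul_left, ← ENNReal.tsum_mul_left]
    exact ⟨ENNReal.tsum_le_tsum fun i => (hV _ _ (hDV i) (hDm i)).1,
      ENNReal.tsum_le_tsum fun i => (hV _ _ (hDV i) (hDm i)).2⟩
  exact le_antisymm (ennreal_le_of_forall_one_lt fun k hk => (key k hk).1)
    (ennreal_le_of_forall_one_lt fun k hk => (key k hk).2)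

/-! ### Surface patches -/

/-- `f` parametrizes over the planar domain `U` a relatively open part of `Γ`. -/
structure IsSurfacePatch (Γ : Set E3) (f : E2 → E3) (U : Set E2) : Prop where
  isOpen : IsOpen U
  contDiffOn : ContDiffOn ℝ ∞ f U
  injOn : InjOn f U
  immersion : ∀ z ∈ U, Function.Injective (fderiv ℝ f z)
  image_eq : ∀ W ⊆ U, IsOpen W → ∃ O, IsOpen O ∧ f '' W = Γ ∩ O

namespace IsSurfacePatch

variable {Γ : Set E3} {f : E2 → E3} {U : Set E2}

theorem mono (h : IsSurfacePatch Γ f U) {V : Set E2} (hV : IsOpen V) (hVU : V ⊆ U) :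
    IsSurfacePatch Γ f V where
  isOpen := hV
  contDiffOn := h.contDiffOn.mono hVU
  injOn := h.injOn.mono hVU
  immersion z hz := h.immersion z (hVU hz)
  image_eq W hW := h.image_eq W (hW.trans hVU)

theorem mem (h : IsSurfacePatch Γ f U) {z : E2} (hz : z ∈ U) : f z ∈ Γ := by
  obtain ⟨O, -, hO⟩ := h.image_eq U Subset.rfl h.isOpen
  have : f z ∈ Γ ∩ O := hO ▸ mem_image_of_mem f hz
  exact this.1

theorem contDiffAt (h : IsSurfacePatch Γ f U) {z : E2} (hz : z ∈ U) : ContDiffAt ℝ ∞ f z :=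
  h.contDiffOn.contDiffAt (h.isOpen.mem_nhds hz)

theorem differentiableAt (h : IsSurfacePatch Γ f U) {z : E2} (hz : z ∈ U) :
    DifferentiableAt ℝ f z :=
  (h.contDiffAt hz).differentiableAt (by simp)

/-- A vector normal to a patch is normal to the surface up to second order. -/
theorem isLittleO_inner (h : IsSurfacePatch Γ f U) {z₀ : E2} (hz : z₀ ∈ U) {ν : E3}
    (hν : ∀ v, ⟪ν, fderiv ℝ f z₀ v⟫ = 0) :
    (fun p => ⟪ν, p - f z₀⟫) =o[𝓝[Γ] (f z₀)] fun p => p - f z₀ := by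
  set A := fderiv ℝ f z₀ with hA
  obtain ⟨K, hK0, hK⟩ := (A : E2 →ₗ[ℝ] E3).exists_antilipschitzWith
    (LinearMap.ker_eq_bot.mpr (h.immersion z₀ hz))
  have hK0' : (0 : ℝ) < K := by exact_mod_cast hK0
  rw [Asymptotics.isLittleO_iff]
  intro ε hε
  -- The first bound allows the linearization error to be absorbed, giving ‖z - z₀‖ ≤ 2K‖f z - f
  -- z₀‖; the second makes the resulting quotient at most ε.
  set c : ℝ := min (1 / (2 * K)) (ε / (2 * K * (‖ν‖ + 1))) with hc
  have hc0 : 0 < c := by positivity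
  have hc1 : c ≤ 1 / (2 * K) := min_le_left _ _
  have hc2 : c ≤ ε / (2 * K * (‖ν‖ + 1)) := min_le_right _ _
  have hd := (h.differentiableAt hz).hasFDerivAt.isLittleO.def hc0
  obtain ⟨V, hV, hVo, hzV⟩ := mem_nhds_iff.mp (hd.and (h.isOpen.mem_nhds hz))
  obtain ⟨O, hO, hfO⟩ := h.image_eq V (fun z hz => (hV hz).2) hVo
  have hxO : f z₀ ∈ Γ ∩ O := hfO ▸ mem_image_of_mem f hzV
  filter_upwards [inter_mem_nhdsWithin Γ (hO.mem_nhds hxO.2)] with p hp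
  rw [← hfO] at hp
  obtain ⟨z, hzV', rfl⟩ := hp
  have h1 : ‖f z - f z₀ - A (z - z₀)‖ ≤ c * ‖z - z₀‖ := (hV hzV').1
  have h2 : ‖z - z₀‖ ≤ K * ‖A (z - z₀)‖ := by
    have := hK.le_mul_dist z z₀
    rw [dist_eq_norm, dist_eq_norm] at this
    rw [map_sub]; exact this
  have h3 := norm_sub_norm_le (A (z - z₀)) (f z - f z₀)
  rw [norm_sub_rev (A (z - z₀))] at h3
  have h4 : ‖z - z₀‖ ≤ 2 * K * ‖f z - f z₀‖ := by
    have h5 : c * ‖z - z₀‖ ≤ 1 / (2 * K) * ‖z - z₀‖ := by gcongr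
    have h6 : K * (1 / (2 * K) * ‖z - z₀‖) = ‖z - z₀‖ / 2 := by field_simp
    have h7 : K * ‖A (z - z₀)‖ ≤ K * (‖f z - f z₀‖ + 1 / (2 * K) * ‖z - z₀‖) := by
      gcongr; linarith
    rw [mul_add, h6] at h7
    linarith
  have h8 : ⟪ν, f z - f z₀⟫ = ⟪ν, f z - f z₀ - A (z - z₀)⟫ := by
    rw [inner_sub_right _ _ (A (z - z₀)), hν, sub_zero]
  rw [h8]
  calc ‖⟪ν, f z - f z₀ - A (z - z₀)⟫‖ ≤ ‖ν‖ * ‖f z - f z₀ - A (z - z₀)‖ := norm_inner_le_norm _ _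
    _ ≤ (‖ν‖ + 1) * (c * (2 * K * ‖f z - f z₀‖)) := by
      gcongr
      · linarith
      · exact h1.trans (by gcongr)
    _ ≤ (‖ν‖ + 1) * (ε / (2 * K * (‖ν‖ + 1)) * (2 * K * ‖f z - f z₀‖)) := by gcongr
    _ = ε * ‖f z - f z₀‖ := by field_simp

/-- Vectors normal to a patch are orthogonal to the derivative of every map into the surface. -/
theorem inner_fderiv_eq_zero (h : IsSurfacePatch Γ f U) {z₀ : E2} (hz : z₀ ∈ U) {ν : E3}
    (hν : ∀ v, ⟪ν, fderiv ℝ f z₀ v⟫ = 0) {F : Type*} [NormedAddCommGroup F] [NormedSpace ℝ F]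
    {g : F → E3} {w₀ : F} (hg : DifferentiableAt ℝ g w₀) (hgΓ : ∀ᶠ w in 𝓝 w₀, g w ∈ Γ)
    (hg0 : g w₀ = f z₀) (v : F) : ⟪ν, fderiv ℝ g w₀ v⟫ = 0 := by
  have hgt : Tendsto g (𝓝 w₀) (𝓝[Γ] (f z₀)) :=
    tendsto_nhdsWithin_iff.mpr ⟨hg0 ▸ hg.continuousAt, hgΓ⟩
  have h1 := (h.isLittleO_inner hz hν).comp_tendsto hgt
  have h2 : (fun w => ⟪ν, g w - f z₀⟫) =o[𝓝 w₀] fun w => w - w₀ := by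
    refine h1.trans_isBigO ?_
    have := hg.hasFDerivAt.isBigO_sub
    rwa [hg0] at this
  have h3 : HasFDerivAt (fun w => ⟪ν, g w⟫) (0 : F →L[ℝ] ℝ) w₀ := by
    refine .of_isLittleO ?_
    refine h2.congr_left fun w => ?_
    simp [inner_sub_right, hg0]
  have h4 : HasFDerivAt (fun w => ⟪ν, g w⟫) ((innerSL ℝ ν).comp (fderiv ℝ g w₀)) w₀ :=
    (innerSL ℝ ν).hasFDerivAt.comp w₀ hg.hasFDerivAt
  have := congrArg (fun L => L v) (h4.unique h3)
  simpa using this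

end IsSurfacePatch

/-! ### Coordinate charts of an evolving surface as patches -/

section Charts

variable {M : Type*} [TopologicalSpace M] [ChartedSpace (EuclideanSpace ℝ (Fin 2)) M]

/-- A time dependent parametrization in the chart around a point. -/
def chartMap (X : ℝ → M → E3) (y₀ : M) (s : ℝ) (z : E2) : E3 :=
  X s ((extChartAt (𝓡 2) y₀).symm z)

namespace IsParametrization

variable {I : Set ℝ} {X : ℝ → M → E3}

theorem contDiffOn_chartMap [IsManifold (𝓡 2) ∞ M] (h : IsParametrization I X) (y₀ : M) :
    ContDiffOn ℝ ∞ (fun q : ℝ × E2 => chartMap X y₀ q.1 q.2)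
      (I ×ˢ (extChartAt (𝓡 2) y₀).target) := by
  rw [← contMDiffOn_iff_contDiffOn]
  have h1 : ContMDiffOn 𝓘(ℝ, ℝ × E2) (𝓘(ℝ, ℝ).prod (𝓡 2)) ∞
      (fun q : ℝ × E2 => (q.1, (extChartAt (𝓡 2) y₀).symm q.2))
      (I ×ˢ (extChartAt (𝓡 2) y₀).target) := by
    refine ContMDiffOn.prodMk contDiff_fst.contMDiff.contMDiffOn ?_
    exact (contMDiffOn_extChartAt_symm y₀).comp contDiff_snd.contMDiff.contMDiffOn
      (fun q hq => hq.2)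
  exact h.smooth.comp h1 (fun q hq => ⟨hq.1, mem_univ _⟩)

theorem contDiffAt_chartMap [IsManifold (𝓡 2) ∞ M] (h : IsParametrization I X) (hI : IsOpen I)
    (y₀ : M) {t : ℝ} (ht : t ∈ I) {z : E2} (hz : z ∈ (extChartAt (𝓡 2) y₀).target) :
    ContDiffAt ℝ ∞ (fun q : ℝ × E2 => chartMap X y₀ q.1 q.2) (t, z) :=
  (h.contDiffOn_chartMap y₀).contDiffAt
    ((hI.prod (isOpen_extChartAt_target y₀)).mem_nhds ⟨ht, hz⟩)

theorem continuous [IsManifold (𝓡 2) ∞ M] (h : IsParametrization I X) {t : ℝ} (ht : t ∈ I) :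
    Continuous (X t) :=
  h.smooth.continuousOn.comp_continuous (f := fun y : M => (t, y)) (by fun_prop)
    (fun y => ⟨ht, mem_univ _⟩)

theorem isClosedEmbedding [T2Space M] [CompactSpace M] [IsManifold (𝓡 2) ∞ M]
    (h : IsParametrization I X) {t : ℝ} (ht : t ∈ I) : IsClosedEmbedding (X t) :=
  (h.continuous ht).isClosedEmbedding (h.injective t ht)

theorem mdifferentiableAt [IsManifold (𝓡 2) ∞ M] (h : IsParametrization I X) (hI : IsOpen I)
    {t : ℝ} (ht : t ∈ I) (y : M) : MDifferentiableAt (𝓡 2) 𝓘(ℝ, E3) (X t) y := by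
  have h1 : ContMDiffAt (𝓘(ℝ, ℝ).prod (𝓡 2)) 𝓘(ℝ, E3) ∞ (fun q : ℝ × M => X q.1 q.2) (t, y) :=
    h.smooth.contMDiffAt ((hI.prod isOpen_univ).mem_nhds ⟨ht, mem_univ _⟩)
  have h2 : ContMDiffAt (𝓡 2) (𝓘(ℝ, ℝ).prod (𝓡 2)) ∞ (fun y : M => (t, y)) y :=
    contMDiffAt_const.prodMk contMDiffAt_id
  exact (ContMDiffAt.comp y h1 h2).mdifferentiableAt (by simp)

/-- The inverse chart has invertible derivative, so immersivity and orthogonality pass between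
manifold derivatives and Fréchet derivatives on the plane. -/
theorem fderiv_chartMap [IsManifold (𝓡 2) ∞ M] (h : IsParametrization I X) (hI : IsOpen I)
    {t : ℝ} (ht : t ∈ I) (y₀ : M) {z : E2} (hz : z ∈ (extChartAt (𝓡 2) y₀).target) :
    ∃ L : E2 ≃L[ℝ] TangentSpace (𝓡 2) ((extChartAt (𝓡 2) y₀).symm z), ∀ v,
      fderiv ℝ (chartMap X y₀ t) z v =
        mfderiv (𝓡 2) 𝓘(ℝ, E3) (X t) ((extChartAt (𝓡 2) y₀).symm z) (L v) := by
  obtain ⟨L, hL⟩ := isInvertible_mfderivWithin_extChartAt_symm (I := 𝓡 2) hz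
  refine ⟨L, fun v => ?_⟩
  have h1 : MDifferentiableAt 𝓘(ℝ, E2) (𝓡 2) (extChartAt (𝓡 2) y₀).symm z := by
    have := mdifferentiableWithinAt_extChartAt_symm (I := 𝓡 2) hz
    simpa [mdifferentiableWithinAt_univ] using this
  have h2 := mfderiv_comp z (h.mdifferentiableAt hI ht ((extChartAt (𝓡 2) y₀).symm z)) h1
  have h3 : fderiv ℝ (chartMap X y₀ t) z
      = mfderiv 𝓘(ℝ, E2) 𝓘(ℝ, E3) (X t ∘ (extChartAt (𝓡 2) y₀).symm) z := by
    rw [mfderiv_eq_fderiv]; rfl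
  rw [h3, h2]
  have h4 : mfderiv 𝓘(ℝ, E2) (𝓡 2) (extChartAt (𝓡 2) y₀).symm z
      = mfderivWithin 𝓘(ℝ, E2) (𝓡 2) (extChartAt (𝓡 2) y₀).symm (range (𝓡 2)) z := by
    rw [ModelWithCorners.range_eq_univ, mfderivWithin_univ]
  rw [h4, ← hL]; rfl

/-- Relative openness of the images is where compactness of `M` enters: an injective continuous map
from a compact space is an embedding. -/
theorem isSurfacePatch [T2Space M] [CompactSpace M] [IsManifold (𝓡 2) ∞ M]
    (h : IsParametrization I X) (hI : IsOpen I) {t : ℝ} (ht : t ∈ I) (y₀ : M) :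
    IsSurfacePatch (range (X t)) (chartMap X y₀ t) (extChartAt (𝓡 2) y₀).target where
  isOpen := isOpen_extChartAt_target y₀
  contDiffOn := (h.contDiffOn_chartMap y₀).comp (f := fun z : E2 => (t, z))
    (by fun_prop) (fun z hz => ⟨ht, hz⟩)
  injOn := fun z hz w hw hzw =>
    (extChartAt (𝓡 2) y₀).symm.injOn hz hw (h.injective t ht hzw)
  immersion z hz := by
    obtain ⟨L, hL⟩ := h.fderiv_chartMap hI ht y₀ hz
    intro v w hvw
    rw [hL, hL] at hvw
    exact L.injective (h.immersion t ht _ hvw)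
  image_eq W hW hWo := by
    have hopen : IsOpen ((extChartAt (𝓡 2) y₀).symm '' W) := by
      rw [(extChartAt (𝓡 2) y₀).symm.image_eq_target_inter_inv_preimage hW]
      exact (continuousOn_extChartAt y₀).isOpen_inter_preimage (isOpen_extChartAt_source y₀) hWo
    obtain ⟨O, hO, hOe⟩ := (h.isClosedEmbedding ht).isInducing.isOpen_iff.mp hopen
    refine ⟨O, hO, ?_⟩
    have : chartMap X y₀ t '' W = X t '' ((extChartAt (𝓡 2) y₀).symm '' W) := by
      rw [image_image]; rfl
    rw [this, ← hOe, image_preimage_eq_range_inter]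

end IsParametrization
end Charts

/-! ### Closed surfaces with a unit normal -/

/-- `Γ` is a smooth closed surface with unit normal `n`. -/
structure IsClosedSurface (Γ : Set E3) (n : E3 → E3) : Prop where
  isCompact : IsCompact Γ
  smooth : ∀ x ∈ Γ, ContDiffAt ℝ ∞ n x
  norm_eq_one : ∀ x ∈ Γ, ‖n x‖ = 1
  exists_patch : ∀ x ∈ Γ, ∃ f U z, IsSurfacePatch Γ f U ∧ z ∈ U ∧ f z = x ∧
    ∀ v, ⟪n x, fderiv ℝ f z v⟫ = 0

namespace IsClosedSurface

variable {Γ : Set E3} {n : E3 → E3} (h : IsClosedSurface Γ n)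
include h

/-- A single patch through the point controls every differentiable map into the surface. Hence the
normal prescribed on one patch per point is normal to all patches. -/
theorem inner_fderiv_eq_zero {F : Type*} [NormedAddCommGroup F] [NormedSpace ℝ F]
    {g : F → E3} {w : F} (hg : DifferentiableAt ℝ g w) (hgΓ : ∀ᶠ w in 𝓝 w, g w ∈ Γ) (v : F) :
    ⟪n (g w), fderiv ℝ g w v⟫ = 0 := by
  obtain ⟨f, U, z, hp, hz, hfz, hν⟩ := h.exists_patch (g w) hgΓ.self_of_nhds
  exact hp.inner_fderiv_eq_zero hz hν hg hgΓ hfz.symm v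

theorem inner_patch_eq_zero {f : E2 → E3} {U : Set E2} (hp : IsSurfacePatch Γ f U) {z : E2}
    (hz : z ∈ U) (v : E2) : ⟪n (f z), fderiv ℝ f z v⟫ = 0 :=
  h.inner_fderiv_eq_zero (hp.differentiableAt hz)
    (eventually_of_mem (hp.isOpen.mem_nhds hz) fun _ => hp.mem) v

/-- Fields which agree on the surface have the same tangential derivatives. -/
theorem fderiv_congr {G : Type*} [NormedAddCommGroup G] [NormedSpace ℝ G] {F₁ F₂ : E3 → G} {x : E3}
    (hx : x ∈ Γ) (h₁ : DifferentiableAt ℝ F₁ x) (h₂ : DifferentiableAt ℝ F₂ x)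
    (heq : ∀ y ∈ Γ, F₁ y = F₂ y) {w : E3} (hw : ⟪n x, w⟫ = 0) :
    fderiv ℝ F₁ x w = fderiv ℝ F₂ x w := by
  obtain ⟨f, U, z, hp, hz, rfl, hν⟩ := h.exists_patch x hx
  obtain ⟨v, rfl⟩ := exists_apply_eq_of_orthogonal (hp.immersion z hz) (h.norm_eq_one _ hx) hν hw
  have hd := (hp.differentiableAt hz).hasFDerivAt
  have e1 := h₁.hasFDerivAt.comp z hd
  have e2 := h₂.hasFDerivAt.comp z hd
  have he : F₁ ∘ f =ᶠ[𝓝 z] F₂ ∘ f :=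
    eventually_of_mem (hp.isOpen.mem_nhds hz) fun y hy => heq _ (hp.mem hy)
  have := congrArg (fun L => L v) (e1.unique (e2.congr_of_eventuallyEq he))
  simpa using this

/-- This is how constraints that hold only on the surface, such as ‖n‖ = 1 or ⟨n, ∇φ⟩ = 0, are
differentiated despite the arbitrary extensions. -/
theorem fderiv_eq_zero {G : Type*} [NormedAddCommGroup G] [NormedSpace ℝ G] {F : E3 → G} {x : E3}
    (hx : x ∈ Γ) (hF : DifferentiableAt ℝ F x) {c : G} (heq : ∀ y ∈ Γ, F y = c) {w : E3}
    (hw : ⟪n x, w⟫ = 0) : fderiv ℝ F x w = 0 := by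
  rw [h.fderiv_congr (F₂ := fun _ => c) hx hF (differentiableAt_const c) heq hw]
  simp

theorem differentiableAt {x : E3} (hx : x ∈ Γ) : DifferentiableAt ℝ n x :=
  (h.smooth x hx).differentiableAt (by simp)

theorem inner_fderiv_normal {x : E3} (hx : x ∈ Γ) {w : E3} (hw : ⟪n x, w⟫ = 0) :
    ⟪n x, fderiv ℝ n x w⟫ = 0 := by
  have hd := h.differentiableAt hx
  have := h.fderiv_eq_zero (F := fun y => ⟪n y, n y⟫) hx (hd.inner ℝ hd) (c := 1)
    (fun y hy => inner_self_unit (h.norm_eq_one y hy)) hw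
  rw [fderiv_inner_apply ℝ hd hd, real_inner_comm (n x)] at this
  linarith

/-- The second fundamental form is symmetric. -/
theorem fderiv_normal_symm {x : E3} (hx : x ∈ Γ) {v w : E3} (hv : ⟪n x, v⟫ = 0)
    (hw : ⟪n x, w⟫ = 0) : ⟪fderiv ℝ n x v, w⟫ = ⟪fderiv ℝ n x w, v⟫ := by
  obtain ⟨f, U, z, hp, hz, rfl, hν⟩ := h.exists_patch x hx
  obtain ⟨a, rfl⟩ := exists_apply_eq_of_orthogonal (hp.immersion z hz) (h.norm_eq_one _ hx) hν hv
  obtain ⟨b, rfl⟩ := exists_apply_eq_of_orthogonal (hp.immersion z hz) (h.norm_eq_one _ hx) hν hw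
  have hd := (hp.differentiableAt hz).hasFDerivAt
  have hn : HasFDerivAt (n ∘ f) ((fderiv ℝ n (f z)).comp (fderiv ℝ f z)) z :=
    (h.differentiableAt hx).hasFDerivAt.comp z hd
  have hf2 : DifferentiableAt ℝ (fderiv ℝ f) z :=
    ((hp.contDiffAt hz).fderiv_right (m := 1) (by norm_cast)).differentiableAt (by simp)
  -- Differentiating ⟨n, ∂_d f⟩ = 0 along c moves the derivative from the normal to f, where second
  -- derivatives are symmetric.
  have key : ∀ c d : E2, ⟪fderiv ℝ n (f z) (fderiv ℝ f z c), fderiv ℝ f z d⟫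
      = -⟪n (f z), fderiv ℝ (fderiv ℝ f) z c d⟫ := by
    intro c d
    have h1 : HasFDerivAt (fun y => fderiv ℝ f y d) ((fderiv ℝ (fderiv ℝ f) z).flip d) z := by
      simpa using hf2.hasFDerivAt.clm_apply (hasFDerivAt_const d z)
    have h2 := hn.inner ℝ h1
    have h3 : (fun y => ⟪(n ∘ f) y, fderiv ℝ f y d⟫) =ᶠ[𝓝 z] fun _ => (0 : ℝ) :=
      eventually_of_mem (hp.isOpen.mem_nhds hz) fun y hy => h.inner_patch_eq_zero hp hy d
    have h4 := congrArg (fun L => L c)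
      (h2.unique ((hasFDerivAt_const (0 : ℝ) z).congr_of_eventuallyEq h3))
    simp at h4
    linarith
  have hs : fderiv ℝ (fderiv ℝ f) z a b = fderiv ℝ (fderiv ℝ f) z b a :=
    ((hp.contDiffAt hz).isSymmSndFDerivAt
      (by rw [minSmoothness_of_isRCLikeNormedField]; norm_cast)).eq a b
  rw [key, key, hs]

end IsClosedSurface

/-! ### Smoothness of differential expressions in space-time fields -/

/-- Smoothness of a time dependent field at a point of space-time. -/
def SmoothAt {G : Type*} [NormedAddCommGroup G] [NormedSpace ℝ G] (F : ℝ → E3 → G) (t : ℝ)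
    (x : E3) : Prop :=
  ContDiffAt ℝ ∞ (fun q : ℝ × E3 => F q.1 q.2) (t, x)

/-- The adjoint as a linear map. -/
def adjointLin : (E3 →L[ℝ] E3) →ₗ[ℝ] (E3 →L[ℝ] E3) where
  toFun A := ContinuousLinearMap.adjoint A
  map_add' A B := map_add _ A B
  map_smul' c A := by simp

/-- The Riesz representation as a linear map. -/
def rieszLin : (E3 →L[ℝ] ℝ) →ₗ[ℝ] E3 where
  toFun l := (InnerProductSpace.toDual ℝ E3).symm l
  map_add' l m := map_add _ l m
  map_smul' c l := by simp

section SmoothAt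

variable {G : Type*} [NormedAddCommGroup G] [NormedSpace ℝ G] {t : ℝ} {x : E3}

theorem SmoothAt.contDiffAt {F : ℝ → E3 → G} (h : SmoothAt F t x) : ContDiffAt ℝ ∞ (F t) x :=
  ContDiffAt.comp (f := fun y : E3 => (t, y)) x h (by fun_prop)

theorem SmoothAt.differentiableAt {F : ℝ → E3 → G} (h : SmoothAt F t x) :
    DifferentiableAt ℝ (F t) x :=
  h.contDiffAt.differentiableAt (by simp)

theorem _root_.ContDiffAt.smoothAt {F : E3 → G} (h : ContDiffAt ℝ ∞ F x) (t : ℝ) :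
    SmoothAt (fun _ => F) t x :=
  ContDiffAt.comp (f := fun q : ℝ × E3 => q.2) (t, x) h (by fun_prop)

/-- The spatial derivative remains smooth jointly in time and space; every operator of the model
inherits smoothness from this one. -/
theorem SmoothAt.fderiv {F : ℝ → E3 → G} (h : SmoothAt F t x) :
    SmoothAt (fun s => fderiv ℝ (F s)) t x := by
  refine ContDiffAt.fderiv (f := fun q : ℝ × E3 => F q.1) (g := fun q : ℝ × E3 => q.2) (n := ∞)
    ?_ (by fun_prop) (by norm_cast)
  exact ContDiffAt.comp (f := fun r : (ℝ × E3) × E3 => (r.1.1, r.2)) ((t, x), x) h (by fun_prop)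

theorem SmoothAt.smul {f : ℝ → E3 → ℝ} {F : ℝ → E3 → G} (hf : SmoothAt f t x)
    (hF : SmoothAt F t x) : SmoothAt (fun s y => f s y • F s y) t x :=
  ContDiffAt.smul hf hF

theorem SmoothAt.mul {f g : ℝ → E3 → ℝ} (hf : SmoothAt f t x)
    (hg : SmoothAt g t x) : SmoothAt (fun s y => f s y * g s y) t x :=
  ContDiffAt.mul hf hg

theorem SmoothAt.add {F₁ F₂ : ℝ → E3 → G} (h₁ : SmoothAt F₁ t x)
    (h₂ : SmoothAt F₂ t x) : SmoothAt (fun s y => F₁ s y + F₂ s y) t x :=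
  ContDiffAt.add h₁ h₂

theorem SmoothAt.sub {F₁ F₂ : ℝ → E3 → G} (h₁ : SmoothAt F₁ t x)
    (h₂ : SmoothAt F₂ t x) : SmoothAt (fun s y => F₁ s y - F₂ s y) t x :=
  ContDiffAt.sub h₁ h₂

theorem SmoothAt.neg {F : ℝ → E3 → G} (h : SmoothAt F t x) : SmoothAt (fun s y => -F s y) t x :=
  ContDiffAt.neg h

theorem SmoothAt.const_mul {f : ℝ → E3 → ℝ} (h : SmoothAt f t x) (c : ℝ) :
    SmoothAt (fun s y => c * f s y) t x :=
  ContDiffAt.mul contDiffAt_const h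

theorem SmoothAt.inner {F₁ F₂ : ℝ → E3 → E3} (h₁ : SmoothAt F₁ t x)
    (h₂ : SmoothAt F₂ t x) : SmoothAt (fun s y => ⟪F₁ s y, F₂ s y⟫) t x :=
  ContDiffAt.inner ℝ h₁ h₂

theorem SmoothAt.norm_sq {F : ℝ → E3 → E3} (h : SmoothAt F t x) :
    SmoothAt (fun s y => ‖F s y‖ ^ 2) t x :=
  ContDiffAt.norm_sq ℝ h

theorem SmoothAt.comp_real {f : ℝ → E3 → ℝ} (hf : SmoothAt f t x) {g : ℝ → ℝ}
    (hg : ContDiff ℝ ∞ g) : SmoothAt (fun s y => g (f s y)) t x :=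
  ContDiffAt.comp (t, x) hg.contDiffAt hf

theorem SmoothAt.tangProj {n : ℝ → E3 → E3} (h : SmoothAt n t x) :
    SmoothAt (fun s y => tangProj (n s y)) t x := by
  refine ContDiffAt.sub contDiffAt_const ?_
  exact ContDiffAt.smulRight (ContDiffAt.continuousLinearMap_comp (innerSL ℝ) h) h

theorem SmoothAt.clm_apply {A : ℝ → E3 → E3 →L[ℝ] G} {w : ℝ → E3 → E3} (hA : SmoothAt A t x)
    (hw : SmoothAt w t x) : SmoothAt (fun s y => A s y (w s y)) t x :=
  ContDiffAt.clm_apply hA hw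

theorem SmoothAt.clm_comp {A : ℝ → E3 → E3 →L[ℝ] G} {B : ℝ → E3 → E3 →L[ℝ] E3}
    (hA : SmoothAt A t x) (hB : SmoothAt B t x) :
    SmoothAt (fun s y => (A s y).comp (B s y)) t x :=
  ContDiffAt.clm_comp hA hB

theorem SmoothAt.tr {A : ℝ → E3 → E3 →L[ℝ] E3} (hA : SmoothAt A t x) :
    SmoothAt (fun s y => tr (A s y)) t x := by
  simp only [tr_eq_sum]
  exact ContDiffAt.sum fun i _ => ContDiffAt.inner ℝ
    (ContDiffAt.clm_apply hA contDiffAt_const) contDiffAt_const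

theorem SmoothAt.frobSq {A : ℝ → E3 → E3 →L[ℝ] E3} (hA : SmoothAt A t x) :
    SmoothAt (fun s y => frobSq (A s y)) t x :=
  ContDiffAt.sum fun _ _ => ContDiffAt.norm_sq ℝ (ContDiffAt.clm_apply hA contDiffAt_const)

theorem SmoothAt.adjoint {A : ℝ → E3 → E3 →L[ℝ] E3} (hA : SmoothAt A t x) :
    SmoothAt (fun s y => ContinuousLinearMap.adjoint (A s y)) t x :=
  ContDiffAt.continuousLinearMap_comp (LinearMap.toContinuousLinearMap adjointLin) hA

variable {n : ℝ → E3 → E3} (hn : SmoothAt n t x)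
include hn

theorem SmoothAt.gradS {f : ℝ → E3 → ℝ} (hf : SmoothAt f t x) :
    SmoothAt (fun s => gradS (n s) (f s)) t x := by
  refine hn.tangProj.clm_apply ?_
  exact ContDiffAt.continuousLinearMap_comp (LinearMap.toContinuousLinearMap rieszLin) hf.fderiv

theorem SmoothAt.gradC {W : ℝ → E3 → E3} (hW : SmoothAt W t x) :
    SmoothAt (fun s => gradC (n s) (W s)) t x :=
  hW.fderiv.clm_comp hn.tangProj

theorem SmoothAt.gradP {W : ℝ → E3 → E3} (hW : SmoothAt W t x) :
    SmoothAt (fun s => gradP (n s) (W s)) t x :=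
  hn.tangProj.clm_comp (hn.gradC hW)

theorem SmoothAt.divP {W : ℝ → E3 → E3} (hW : SmoothAt W t x) :
    SmoothAt (fun s => divP (n s) (W s)) t x :=
  (hn.gradP hW).tr

theorem SmoothAt.shapeOp : SmoothAt (fun s => shapeOp (n s)) t x :=
  (hn.gradP hn).neg

theorem SmoothAt.meanCurv : SmoothAt (fun s => meanCurv (n s)) t x :=
  hn.shapeOp.tr

theorem SmoothAt.rateOfDef {u : ℝ → E3 → E3} (hu : SmoothAt u t x) :
    SmoothAt (fun s => rateOfDef (n s) (u s)) t x :=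
  ContDiffAt.const_smul _ ((hn.gradP hu).add (hn.gradP hu).adjoint)

end SmoothAt

/-! ### Integration over surfaces -/

namespace IsSurfacePatch

variable {Γ : Set E3} {f : E2 → E3} {U : Set E2}

theorem continuousOn_norm_areaVec (h : IsSurfacePatch Γ f U) :
    ContinuousOn (fun z => ‖areaVec (fderiv ℝ f z)‖) U := by
  intro z hz
  refine ContinuousAt.continuousWithinAt ?_
  exact (continuous_areaVec.continuousAt.comp
    ((h.contDiffAt hz).fderiv_right (m := 0) (by norm_cast)).continuousAt).norm

theorem euclideanHausdorffMeasure_image (h : IsSurfacePatch Γ f U) {S : Set E2}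
    (hS : MeasurableSet S) (hSU : S ⊆ U) :
    μHE[2] (f '' S) = ∫⁻ x in S, ENNReal.ofReal ‖areaVec (fderiv ℝ f x)‖ :=
  area_formula h.isOpen (h.contDiffOn.of_le (by norm_cast)) h.injOn h.immersion hS hSU

theorem aemeasurable (h : IsSurfacePatch Γ f U) : AEMeasurable f (volume.restrict U) :=
  h.contDiffOn.continuousOn.aemeasurable h.isOpen.measurableSet

theorem aemeasurable_norm_areaVec (h : IsSurfacePatch Γ f U) :
    AEMeasurable (fun z => ‖areaVec (fderiv ℝ f z)‖) (volume.restrict U) :=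
  h.continuousOn_norm_areaVec.aemeasurable h.isOpen.measurableSet

theorem measurableSet_image (h : IsSurfacePatch Γ f U) : MeasurableSet (f '' U) :=
  h.isOpen.measurableSet.image_of_continuousOn_injOn h.contDiffOn.continuousOn h.injOn

/-- The area formula on all measurable preimages identifies the surface measure with a weighted
planar measure, so integrals can be pulled back to coordinates. -/
theorem restrict_image_eq_map (h : IsSurfacePatch Γ f U) :
    (μHE[2] : Measure E3).restrict (f '' U) =
      ((volume.restrict U).withDensity
        fun z => ENNReal.ofReal ‖areaVec (fderiv ℝ f z)‖).map f := by
  ext S hS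
  have hUm := h.isOpen.measurableSet
  have hae : AEMeasurable f ((volume.restrict U).withDensity
      fun z => ENNReal.ofReal ‖areaVec (fderiv ℝ f z)‖) :=
    h.aemeasurable.mono_ac (withDensity_absolutelyContinuous _ _)
  have hn : NullMeasurableSet (f ⁻¹' S) (volume.restrict U) := h.aemeasurable.nullMeasurable hS
  have hm : MeasurableSet (f ⁻¹' S ∩ U) := by
    obtain ⟨g, hg, hge⟩ := (continuousOn_iff_continuous_domRestrict.mp
      h.contDiffOn.continuousOn).measurable hS
    rw [inter_comm, ← Subtype.image_preimage_coe]
    exact hUm.subtype_image ⟨g, hg, hge⟩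
  rw [Measure.restrict_apply hS, Measure.map_apply_of_aemeasurable hae hS, withDensity_apply',
    Measure.restrict_restrict₀ hn, ← h.euclideanHausdorffMeasure_image hm inter_subset_right,
    inter_comm (f ⁻¹' S), image_inter_preimage, inter_comm]

theorem setIntegral_image (h : IsSurfacePatch Γ f U) {F : E3 → ℝ} (hF : ContinuousOn F (f '' U)) :
    ∫ x in f '' U, F x ∂μHE[2] = ∫ z in U, ‖areaVec (fderiv ℝ f z)‖ * F (f z) := by
  have hae : AEMeasurable f ((volume.restrict U).withDensity
      fun z => ENNReal.ofReal ‖areaVec (fderiv ℝ f z)‖) :=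
    h.aemeasurable.mono_ac (withDensity_absolutelyContinuous _ _)
  have hFm := hF.aestronglyMeasurable (μ := (μHE[2] : Measure E3)) h.measurableSet_image
  rw [h.restrict_image_eq_map] at hFm ⊢
  rw [integral_map hae hFm, integral_withDensity_eq_integral_toReal_smul₀]
  · simp
  · exact h.aemeasurable_norm_areaVec.ennreal_ofReal
  · exact ae_of_all _ fun _ => ENNReal.ofReal_lt_top

end IsSurfacePatch

namespace IsClosedSurface

variable {Γ : Set E3} {n : E3 → E3} (h : IsClosedSurface Γ n)
include h

theorem measure_lt_top : μHE[2] Γ < ⊤ := by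
  refine h.isCompact.measure_lt_top_of_nhdsWithin fun x hx => ?_
  obtain ⟨f, U, z, hp, hz, rfl, -⟩ := h.exists_patch x hx
  obtain ⟨V, hV, hVo, hzV⟩ := mem_nhds_iff.mp
    ((((hp.continuousOn_norm_areaVec.continuousAt (hp.isOpen.mem_nhds hz)).eventually_lt
      continuousAt_const (lt_add_one _))).and
      (Filter.Eventually.and (hp.isOpen.mem_nhds hz : ∀ᶠ y in 𝓝 z, y ∈ U)
        (Metric.ball_mem_nhds z one_pos : ∀ᶠ y in 𝓝 z, y ∈ Metric.ball z 1)))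
  obtain ⟨O, hO, hOe⟩ := hp.image_eq V (fun y hy => (hV hy).2.1) hVo
  have hxO : f z ∈ Γ ∩ O := hOe ▸ mem_image_of_mem f hzV
  refine ⟨Γ ∩ O, inter_mem_nhdsWithin Γ (hO.mem_nhds hxO.2), ?_⟩
  rw [← hOe, hp.euclideanHausdorffMeasure_image hVo.measurableSet fun y hy => (hV hy).2.1]
  calc ∫⁻ x in V, ENNReal.ofReal ‖areaVec (fderiv ℝ f x)‖
      ≤ ∫⁻ _ in V, ENNReal.ofReal (‖areaVec (fderiv ℝ f z)‖ + 1) :=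
        setLIntegral_mono' hVo.measurableSet fun y hy =>
          ENNReal.ofReal_le_ofReal (hV hy).1.le
    _ = ENNReal.ofReal (‖areaVec (fderiv ℝ f z)‖ + 1) * volume V := setLIntegral_const _ _
    _ < ⊤ := ENNReal.mul_lt_top ENNReal.ofReal_lt_top
        ((measure_mono fun y hy => (hV hy).2.2).trans_lt measure_ball_lt_top)

theorem integrableOn {F : E3 → ℝ} (hF : ContinuousOn F Γ) : IntegrableOn F Γ μHE[2] := by
  have : IsFiniteMeasure ((μHE[2] : Measure E3).restrict Γ) := ⟨by
    simpa using h.measure_lt_top⟩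
  have h1 := hF.integrableOn_compact (μ := (μHE[2] : Measure E3).restrict Γ) h.isCompact
  rwa [IntegrableOn, Measure.restrict_restrict h.isCompact.measurableSet, inter_self] at h1

theorem surfInt_add {F G : E3 → ℝ} (hF : ContinuousOn F Γ) (hG : ContinuousOn G Γ) :
    surfInt Γ (fun x => F x + G x) = surfInt Γ F + surfInt Γ G :=
  integral_add (h.integrableOn hF) (h.integrableOn hG)

theorem surfInt_congr {F G : E3 → ℝ} (hFG : ∀ x ∈ Γ, F x = G x) : surfInt Γ F = surfInt Γ G :=
  setIntegral_congr_fun h.isCompact.measurableSet hFG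

end IsClosedSurface

/-! ### The divergence theorem -/

theorem meanCurv_eq_neg_divP (n : E3 → E3) (x : E3) : meanCurv n x = -divP n n x := by
  simp [meanCurv, shapeOp, divP, tr_neg]

theorem divP_eq_of_unit {n : E3 → E3} {x : E3} (hn : ‖n x‖ = 1) (W : E3 → E3) :
    divP n W x = tr ((fderiv ℝ W x).comp (tangProj (n x))) := by
  simp only [divP, gradP, gradC]
  exact tr_tangProj_comp_comp hn _

/-- Integrand of the divergence theorem on closed surfaces. -/
def divergence (n : E3 → E3) (W : E3 → E3) (x : E3) : ℝ :=
  divP n W x + meanCurv n x * ⟪W x, n x⟫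

theorem integral_fderiv_eq_zero {g : E2 → ℝ} (hg : ContDiff ℝ 1 g) (hc : HasCompactSupport g)
    (v : E2) : ∫ z, fderiv ℝ g z v = 0 := by
  have h1 : Integrable (fun z => fderiv ℝ g z v) :=
    Continuous.integrable_of_hasCompactSupport
      ((hg.continuous_fderiv (by simp)).clm_apply continuous_const)
      (hc.fderiv_apply ℝ v)
  have h2 := integral_mul_fderiv_eq_neg_fderiv_mul_of_integrable (μ := (volume : Measure E2))
    (f := fun _ : E2 => (1 : ℝ)) (g := g) (v := v) (by simp) (by simpa using h1)
    (by simpa using hg.continuous.integrable_of_hasCompactSupport hc)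
    (fun x _ => differentiableAt_const _) (fun x _ => hg.differentiable (by simp) x)
  simpa using h2

/-- A function vanishing outside a compact subset of U extends by zero to a compactly supported C¹
function on the plane, whose derivatives integrate to zero. -/
theorem setIntegral_fderiv_eq_zero {g : E2 → ℝ} {U K : Set E2} (hU : IsOpen U)
    (hg : ContDiffOn ℝ 1 g U) (hK : IsCompact K) (hKU : K ⊆ U) (h0 : ∀ z ∈ U, z ∉ K → g z = 0)
    (v : E2) :
    IntegrableOn (fun z => fderiv ℝ g z v) U ∧ ∫ z in U, fderiv ℝ g z v = 0 := by
  set G : E2 → ℝ := U.indicator g with hG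
  have hG0 : ∀ z ∉ K, G z = 0 := fun z hz => by
    by_cases hzU : z ∈ U
    · rw [hG, indicator_of_mem hzU, h0 z hzU hz]
    · rw [hG, indicator_of_notMem hzU]
  have hGg : ∀ z ∈ U, G =ᶠ[𝓝 z] g := fun z hz =>
    eventually_of_mem (hU.mem_nhds hz) fun y hy => indicator_of_mem hy g
  have hGs : ContDiff ℝ 1 G := by
    rw [contDiff_iff_contDiffAt]
    intro z
    by_cases hz : z ∈ U
    · exact (hg.contDiffAt (hU.mem_nhds hz)).congr_of_eventuallyEq (hGg z hz)
    · have : G =ᶠ[𝓝 z] fun _ => 0 :=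
        eventually_of_mem (hK.isClosed.isOpen_compl.mem_nhds fun hzK => hz (hKU hzK)) hG0
      exact contDiffAt_const.congr_of_eventuallyEq this
  have hGc : HasCompactSupport G := HasCompactSupport.intro hK hG0
  have hint : Integrable (fun z => fderiv ℝ G z v) :=
    Continuous.integrable_of_hasCompactSupport
      ((hGs.continuous_fderiv (by simp)).clm_apply continuous_const) (hGc.fderiv_apply ℝ v)
  have heq : ∀ z ∈ U, fderiv ℝ G z v = fderiv ℝ g z v := fun z hz => by
    rw [(hGg z hz).fderiv_eq]
  refine ⟨(integrableOn_congr_fun heq hU.measurableSet).mp hint.integrableOn, ?_⟩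
  rw [← setIntegral_congr_fun hU.measurableSet heq, ← integral_fderiv_eq_zero hGs hGc v]
  refine setIntegral_eq_integral_of_forall_compl_eq_zero fun z hz => ?_
  have : G =ᶠ[𝓝 z] fun _ => 0 :=
    eventually_of_mem (hK.isClosed.isOpen_compl.mem_nhds fun hzK => hz (hKU hzK)) hG0
  rw [this.fderiv_eq]; simp

namespace IsClosedSurface

variable {Γ : Set E3} {n : E3 → E3} (h : IsClosedSurface Γ n)
include h

theorem inner_areaVec_smul {f : E2 → E3} {U : Set E2} (hp : IsSurfacePatch Γ f U) {z : E2}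
    (hz : z ∈ U) : areaVec (fderiv ℝ f z) = ⟪n (f z), areaVec (fderiv ℝ f z)⟫ • n (f z) :=
  cross_eq_smul_of_orthogonal (h.norm_eq_one _ (hp.mem hz)) (h.inner_patch_eq_zero hp hz _)
    (h.inner_patch_eq_zero hp hz _)

theorem abs_inner_areaVec {f : E2 → E3} {U : Set E2} (hp : IsSurfacePatch Γ f U) {z : E2}
    (hz : z ∈ U) : ‖areaVec (fderiv ℝ f z)‖ = |⟪n (f z), areaVec (fderiv ℝ f z)⟫| := by
  conv_lhs => rw [h.inner_areaVec_smul hp hz]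
  rw [norm_smul, h.norm_eq_one _ (hp.mem hz), mul_one, Real.norm_eq_abs]

/-- The divergence integrand is a divergence in the coordinates of a patch. -/
theorem divergence_patch {f : E2 → E3} {U : Set E2} (hp : IsSurfacePatch Γ f U) {z : E2}
    (hz : z ∈ U) {W : E3 → E3} (hW : DifferentiableAt ℝ W (f z)) :
    fderiv ℝ (fun y => ⟪n (f y), cross (W (f y)) (fderiv ℝ f y (fb 1))⟫) z (fb 0)
      + fderiv ℝ (fun y => ⟪n (f y), cross (fderiv ℝ f y (fb 0)) (W (f y))⟫) z (fb 1)
      = ⟪n (f z), areaVec (fderiv ℝ f z)⟫ * divergence n W (f z) := by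
  have hd := (hp.differentiableAt hz).hasFDerivAt
  have hn : HasFDerivAt (fun y => n (f y)) ((fderiv ℝ n (f z)).comp (fderiv ℝ f z)) z :=
    (h.differentiableAt (hp.mem hz)).hasFDerivAt.comp z hd
  have hWf : HasFDerivAt (fun y => W (f y)) ((fderiv ℝ W (f z)).comp (fderiv ℝ f z)) z :=
    hW.hasFDerivAt.comp z hd
  have hf2 : DifferentiableAt ℝ (fderiv ℝ f) z :=
    ((hp.contDiffAt hz).fderiv_right (m := 1) (by norm_cast)).differentiableAt (by simp)
  have hfd : ∀ d : E2,
      HasFDerivAt (fun y => fderiv ℝ f y d) ((fderiv ℝ (fderiv ℝ f) z).flip d) z := fun d => by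
    simpa using hf2.hasFDerivAt.clm_apply (hasFDerivAt_const d z)
  have hs : fderiv ℝ (fderiv ℝ f) z (fb 0) (fb 1) = fderiv ℝ (fderiv ℝ f) z (fb 1) (fb 0) :=
    ((hp.contDiffAt hz).isSymmSndFDerivAt
      (by rw [minSmoothness_of_isRCLikeNormedField]; norm_cast)).eq _ _
  have h1 := hn.inner ℝ (cross.hasFDerivAt_of_bilinear hWf (hfd (fb 1)))
  have h2 := hn.inner ℝ (cross.hasFDerivAt_of_bilinear (hfd (fb 0)) hWf)
  rw [h1.fderiv, h2.fderiv]
  have hu := h.norm_eq_one _ (hp.mem hz)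
  have ha := h.inner_patch_eq_zero hp hz (fb 0)
  have hb := h.inner_patch_eq_zero hp hz (fb 1)
  have h0 : cross (fderiv ℝ f z (fb 0)) (fderiv ℝ f z (fb 1)) ≠ 0 :=
    areaVec_ne_zero (hp.immersion z hz)
  have hna := h.inner_fderiv_normal (hp.mem hz) ha
  have hnb := h.inner_fderiv_normal (hp.mem hz) hb
  have eW := inner_normal_cross_variation hu ha hb h0 (fderiv ℝ W (f z))
  have eN := inner_normal_cross_variation hu ha hb h0 (fderiv ℝ n (f z))
  simp only [add_apply, ContinuousLinearMap.precompR_apply, ContinuousLinearMap.compL_apply,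
    ContinuousLinearMap.comp_apply,
    fderivInnerCLM_apply, ContinuousLinearMap.prod_apply,
    ContinuousLinearMap.precompL_apply, ContinuousLinearMap.flip_apply, inner_add_right,
    divergence, meanCurv_eq_neg_divP, divP, gradP, gradC, areaVec] at *
  -- The two mixed second derivatives of f cancel by antisymmetry of the cross product. The
  -- derivatives of W give the area factor times div_P W.
  rw [hs, cross_anticomm (fderiv ℝ (fderiv ℝ f) z (fb 1) (fb 0)), inner_neg_right]
  -- The derivatives of n are collected into -⟨W, ∂₀n × ∂₁f + ∂₀f × ∂₁n⟩. Both products are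
  -- multiples of n, so this is -⟨W, n⟩ times the variation of area along n: the curvature term,
  -- since H = -div_P n.
  rw [inner_cross_rotate (fderiv ℝ n (f z) (fderiv ℝ f z (fb 0))),
    inner_cross_rotate (fderiv ℝ n (f z) (fderiv ℝ f z (fb 1))),
    inner_cross_rotate (fderiv ℝ f z (fb 0)),
    cross_anticomm (fderiv ℝ f z (fb 1)) (fderiv ℝ n (f z) _),
    cross_anticomm (fderiv ℝ n (f z) _) (fderiv ℝ f z (fb 0)),
    cross_eq_smul_of_orthogonal hu hna hb, cross_eq_smul_of_orthogonal hu ha hnb]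
  simp only [inner_neg_right, inner_smul_right]
  linear_combination eW - ⟪W (f z), n (f z)⟫ * eN

end IsClosedSurface

/-- Compact parts of the image of a patch have compact preimages. -/
theorem IsSurfacePatch.isCompact_preimage {Γ : Set E3} {f : E2 → E3} {U : Set E2}
    (h : IsSurfacePatch Γ f U) {C : Set E3} (hC : IsCompact C) (hCU : C ⊆ f '' U) :
    IsCompact (U ∩ f ⁻¹' C) := by
  set g := Function.invFunOn f U with hg
  have hgU : ∀ p ∈ f '' U, g p ∈ U ∧ f (g p) = p := fun p hp =>
    ⟨Function.invFunOn_mem hp, Function.invFunOn_eq hp⟩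
  -- The inverse of the patch is continuous because images of open sets are relatively open in Γ.
  have hcont : ContinuousOn g C := by
    intro p hp
    rw [ContinuousWithinAt, tendsto_def]
    intro N hN
    obtain ⟨V, hVN, hVo, hpV⟩ := mem_nhds_iff.mp hN
    obtain ⟨O, hO, hOe⟩ := h.image_eq (V ∩ U) inter_subset_right (hVo.inter h.isOpen)
    have hpO : p ∈ Γ ∩ O := by
      rw [← hOe]; exact ⟨g p, ⟨hpV, (hgU p (hCU hp)).1⟩, (hgU p (hCU hp)).2⟩
    filter_upwards [inter_mem_nhdsWithin C (hO.mem_nhds hpO.2)] with p' hp'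
    have hp'Γ : p' ∈ Γ := by
      obtain ⟨y, hy, rfl⟩ := hCU hp'.1
      exact h.mem hy
    have : p' ∈ f '' (V ∩ U) := by rw [hOe]; exact ⟨hp'Γ, hp'.2⟩
    obtain ⟨w, hw, rfl⟩ := this
    have := hgU (f w) (hCU hp'.1)
    have hwe : g (f w) = w := h.injOn this.1 hw.2 this.2
    exact hVN (by rw [hwe]; exact hw.1)
  have : U ∩ f ⁻¹' C = g '' C := by
    ext z
    constructor
    · rintro ⟨hz, hzC⟩
      have := hgU (f z) (mem_image_of_mem f hz)
      exact ⟨f z, hzC, h.injOn this.1 hz this.2⟩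
    · rintro ⟨p, hp, rfl⟩
      exact ⟨(hgU p (hCU hp)).1, by rw [mem_preimage, (hgU p (hCU hp)).2]; exact hp⟩
  rw [this]
  exact hC.image_of_continuousOn hcont

namespace IsClosedSurface

variable {Γ : Set E3} {n : E3 → E3} (h : IsClosedSurface Γ n)
include h

theorem continuousOn_divergence {W : E3 → E3} (hW : ∀ x ∈ Γ, ContDiffAt ℝ ∞ W x) :
    ContinuousOn (divergence n W) Γ := by
  intro x hx
  have hn := (h.smooth x hx).smoothAt 0
  have hW' := (hW x hx).smoothAt 0
  have : SmoothAt (fun _ => divergence n W) 0 x :=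
    (hn.divP hW').add (hn.meanCurv.mul (hW'.inner hn))
  exact this.contDiffAt.continuousAt.continuousWithinAt

/-- The divergence theorem for fields supported near a given point. -/
theorem exists_nhds_surfInt_divergence {x : E3} (hx : x ∈ Γ) :
    ∃ O, IsOpen O ∧ x ∈ O ∧ ∀ W : E3 → E3, (∀ y ∈ Γ, ContDiffAt ℝ ∞ W y) → tsupport W ⊆ O →
      surfInt Γ (divergence n W) = 0 := by
  obtain ⟨f, U, z, hp, hz, rfl, -⟩ := h.exists_patch x hx
  set l : E2 → ℝ := fun y => ⟪n (f y), areaVec (fderiv ℝ f y)⟫ with hl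
  have hlc : ContinuousAt l z := by
    have h1 : ContinuousAt (fun y => n (f y)) z :=
      (h.differentiableAt hx).continuousAt.comp (hp.differentiableAt hz).continuousAt
    have h2 : ContinuousAt (fun y => areaVec (fderiv ℝ f y)) z :=
      continuous_areaVec.continuousAt.comp
        ((hp.contDiffAt hz).fderiv_right (m := 0) (by norm_cast)).continuousAt
    exact h1.inner h2
  have hl0 : l z ≠ 0 := by
    rw [← abs_pos, hl]
    simp only
    rw [← h.abs_inner_areaVec hp hz]
    exact norm_pos_iff.mpr (areaVec_ne_zero (hp.immersion z hz))
  -- Here ε is the sign of the oriented area factor near z. Patches need not be compatible with the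
  -- orientation, but the sign is locally constant and factors out of the integral.
  obtain ⟨ε, hε⟩ : ∃ ε : ℝ, ∀ᶠ y in 𝓝 z, |l y| = ε * l y := by
    rcases lt_or_gt_of_ne hl0 with hneg | hpos
    · exact ⟨-1, (hlc.eventually_lt continuousAt_const hneg).mono fun y hy => by
        rw [abs_of_neg hy]; ring⟩
    · exact ⟨1, (continuousAt_const.eventually_lt hlc hpos).mono fun y hy => by
        rw [abs_of_pos hy]; ring⟩
  obtain ⟨V', hV', hVo', hzV'⟩ := mem_nhds_iff.mp hε
  set V := V' ∩ U with hV
  have hVo : IsOpen V := hVo'.inter hp.isOpen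
  have hpV := hp.mono hVo inter_subset_right
  obtain ⟨O, hO, hOe⟩ := hp.image_eq V inter_subset_right hVo
  have hxO : f z ∈ Γ ∩ O := hOe ▸ mem_image_of_mem f ⟨hzV', hz⟩
  refine ⟨O, hO, hxO.2, fun W hW hsupp => ?_⟩
  have hzero : ∀ y ∉ tsupport W, divergence n W y = 0 := fun y hy => by
    have h1 : W =ᶠ[𝓝 y] fun _ => 0 := notMem_tsupport_iff_eventuallyEq.mp hy
    have h2 : fderiv ℝ W y = 0 := by rw [h1.fderiv_eq]; simp
    simp [divergence, divP, gradP, gradC, h2, h1.self_of_nhds, tr]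
  have hKc : IsCompact (V ∩ f ⁻¹' (Γ ∩ tsupport W)) := by
    refine hpV.isCompact_preimage (h.isCompact.inter_right (isClosed_tsupport W)) ?_
    rw [hOe]
    exact inter_subset_inter_right Γ hsupp
  set K := V ∩ f ⁻¹' (Γ ∩ tsupport W) with hK
  have hW0 : ∀ y ∈ V, y ∉ K → W (f y) = 0 := fun y hy hyK =>
    image_eq_zero_of_notMem_tsupport fun hs => hyK ⟨hy, hpV.mem hy, hs⟩
  have e1 : surfInt Γ (divergence n W) = ∫ y in f '' V, divergence n W y ∂μHE[2] := by
    rw [surfInt, hOe]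
    refine setIntegral_eq_of_subset_of_forall_sdiff_eq_zero h.isCompact.measurableSet
      inter_subset_left fun y hy => hzero y fun hs => hy.2 ⟨hy.1, hsupp hs⟩
  have hcont : ContinuousOn (divergence n W) (f '' V) :=
    (h.continuousOn_divergence hW).mono (by rw [hOe]; exact inter_subset_left)
  have hsm : ∀ y ∈ V, ContDiffAt ℝ 1 (fun y => n (f y)) y ∧ ContDiffAt ℝ 1 (fun y => W (f y)) y ∧
      ContDiffAt ℝ 1 (fderiv ℝ f) y := fun y hy => by
    have hfy := (hpV.contDiffAt hy)
    refine ⟨?_, ?_, hfy.fderiv_right (by norm_cast)⟩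
    · exact (ContDiffAt.comp y (h.smooth _ (hpV.mem hy)) hfy).of_le (by norm_cast)
    · exact (ContDiffAt.comp y (hW _ (hpV.mem hy)) hfy).of_le (by norm_cast)
  obtain ⟨i1, z1⟩ := setIntegral_fderiv_eq_zero (K := K)
    (g := fun y => ⟪n (f y), cross (W (f y)) (fderiv ℝ f y (fb 1))⟫) hVo
    (fun y hy => ContDiffAt.contDiffWithinAt <| (hsm y hy).1.inner ℝ <|
      ((hsm y hy).2.1.continuousLinearMap_comp cross).clm_apply
        ((hsm y hy).2.2.clm_apply contDiffAt_const))
    hKc inter_subset_left (fun y hy hyK => by simp [hW0 y hy hyK]) (fb 0)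
  obtain ⟨i2, z2⟩ := setIntegral_fderiv_eq_zero (K := K)
    (g := fun y => ⟪n (f y), cross (fderiv ℝ f y (fb 0)) (W (f y))⟫) hVo
    (fun y hy => ContDiffAt.contDiffWithinAt <| (hsm y hy).1.inner ℝ <|
      (((hsm y hy).2.2.clm_apply contDiffAt_const).continuousLinearMap_comp cross).clm_apply
        (hsm y hy).2.1)
    hKc inter_subset_left (fun y hy hyK => by simp [hW0 y hy hyK]) (fb 1)
  rw [e1, hpV.setIntegral_image hcont]
  have e2 : ∀ y ∈ V, ‖areaVec (fderiv ℝ f y)‖ * divergence n W (f y) =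
      ε * (fderiv ℝ (fun y => ⟪n (f y), cross (W (f y)) (fderiv ℝ f y (fb 1))⟫) y (fb 0)
      + fderiv ℝ (fun y => ⟪n (f y), cross (fderiv ℝ f y (fb 0)) (W (f y))⟫) y (fb 1)) := by
    intro y hy
    rw [h.divergence_patch hpV hy ((hW _ (hpV.mem hy)).differentiableAt (by simp)),
      h.abs_inner_areaVec hpV hy, ← mul_assoc]
    congr 1
    exact hV' hy.1
  rw [setIntegral_congr_fun hVo.measurableSet e2, integral_const_mul, integral_add i1 i2, z1, z2]
  simp

theorem divP_congr {W₁ W₂ : E3 → E3} {x : E3} (hx : x ∈ Γ) (h₁ : DifferentiableAt ℝ W₁ x)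
    (h₂ : DifferentiableAt ℝ W₂ x) (heq : ∀ y ∈ Γ, W₁ y = W₂ y) : divP n W₁ x = divP n W₂ x := by
  rw [divP_eq_of_unit (h.norm_eq_one x hx), divP_eq_of_unit (h.norm_eq_one x hx)]
  congr 1
  ext1 v
  exact h.fderiv_congr hx h₁ h₂ heq (inner_tangProj_self (h.norm_eq_one x hx) v)

/-- The divergence theorem on closed surfaces. -/
theorem surfInt_divergence {W : E3 → E3} (hW : ∀ x ∈ Γ, ContDiffAt ℝ ∞ W x) :
    surfInt Γ (divergence n W) = 0 := by
  choose! O hO hxO hdiv using fun x (hx : x ∈ Γ) => h.exists_nhds_surfInt_divergence hx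
  obtain ⟨T, hTΓ, hT⟩ := h.isCompact.elim_nhds_subcover O fun x hx => (hO x hx).mem_nhds (hxO x hx)
  obtain ⟨ρ, hρ⟩ := SmoothPartitionOfUnity.exists_isSubordinate 𝓘(ℝ, E3) h.isCompact.isClosed
    (fun i : T => O i) (fun i => hO i (hTΓ i i.2)) (by
      intro x hx
      obtain ⟨i, hi, hxi⟩ := mem_iUnion₂.mp (hT hx)
      exact mem_iUnion.mpr ⟨⟨i, hi⟩, hxi⟩)
  have hρs : ∀ i, ContDiff ℝ ∞ (ρ i) := fun i => (ρ i).contMDiff.contDiff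
  have hsum : ∀ x ∈ Γ, ∑ i, ρ i x = 1 := fun x hx => by
    rw [← finsum_eq_sum_of_fintype]; exact ρ.sum_eq_one hx
  have hWi : ∀ i, ∀ x ∈ Γ, ContDiffAt ℝ ∞ (fun y => ρ i y • W y) x := fun i x hx =>
    (hρs i).contDiffAt.smul (hW x hx)
  have hWd : ∀ i, ∀ x ∈ Γ, DifferentiableAt ℝ (fun y => ρ i y • W y) x := fun i x hx =>
    (hWi i x hx).differentiableAt (by simp)
  have e1 : ∀ x ∈ Γ, divergence n W x = ∑ i, divergence n (fun y => ρ i y • W y) x := by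
    intro x hx
    have h1 : divP n W x = ∑ i, divP n (fun y => ρ i y • W y) x := by
      -- The partition sums to one only on Γ, so W and the sum of its pieces are different
      -- extensions of the same field; tangential derivatives agree nevertheless.
      rw [h.divP_congr (W₂ := fun y => ∑ i, ρ i y • W y) hx ((hW x hx).differentiableAt (by simp))
        (DifferentiableAt.fun_sum fun i _ => hWd i x hx)
        (fun y hy => by rw [← Finset.sum_smul, hsum y hy, one_smul])]
      simp only [divP_eq_of_unit (h.norm_eq_one x hx)]
      rw [fderiv_fun_sum fun i _ => hWd i x hx]
      simp only [tr_eq_sum, ContinuousLinearMap.comp_apply, sum_apply, sum_inner]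
      exact Finset.sum_comm
    have h2 : ⟪W x, n x⟫ = ∑ i, ⟪ρ i x • W x, n x⟫ := by
      simp only [inner_smul_left, RCLike.conj_to_real]
      rw [← Finset.sum_mul, hsum x hx, one_mul]
    simp only [divergence, Finset.sum_add_distrib, h1, h2, Finset.mul_sum]
  rw [h.surfInt_congr e1, surfInt,
    integral_finsetSum _ fun i _ => h.integrableOn (h.continuousOn_divergence (hWi i))]
  refine Finset.sum_eq_zero fun i _ => hdiv i (hTΓ i i.2) _ (hWi i) ?_
  refine Subset.trans ?_ (hρ i)
  exact closure_mono fun y hy hρy => hy (by simp [hρy])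

end IsClosedSurface

/-! ### Material derivatives and transport -/

/-- Material derivative of a space-time field along the velocity field `u`. -/
def matD {G : Type*} [NormedAddCommGroup G] [NormedSpace ℝ G] (u : ℝ → E3 → E3) (F : ℝ → E3 → G)
    (t : ℝ) (x : E3) : G :=
  fderiv ℝ (fun q : ℝ × E3 => F q.1 q.2) (t, x) (1, u t x)

section MatD

variable {G : Type*} [NormedAddCommGroup G] [NormedSpace ℝ G] {u : ℝ → E3 → E3} {t : ℝ} {x : E3}

theorem SmoothAt.differentiableAt_uncurry {F : ℝ → E3 → G} (h : SmoothAt F t x) :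
    DifferentiableAt ℝ (fun q : ℝ × E3 => F q.1 q.2) (t, x) :=
  ContDiffAt.differentiableAt h (by simp)

theorem SmoothAt.matD {F : ℝ → E3 → G} (hF : SmoothAt F t x) (hu : SmoothAt u t x) :
    SmoothAt (matD u F) t x :=
  ContDiffAt.clm_apply (ContDiffAt.fderiv_right hF (by norm_cast)) (contDiffAt_const.prodMk hu)

theorem fderiv_eq_uncurry {F : ℝ → E3 → G} (h : SmoothAt F t x) (v : E3) :
    fderiv ℝ (F t) x v = fderiv ℝ (fun q : ℝ × E3 => F q.1 q.2) (t, x) (0, v) := by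
  have h1 : HasFDerivAt (fun y : E3 => (t, y)) (ContinuousLinearMap.inr ℝ ℝ E3) x :=
    hasFDerivAt_prodMk_right t x
  have h2 := HasFDerivAt.comp x h.differentiableAt_uncurry.hasFDerivAt h1
  have h3 : HasFDerivAt (F t) _ x := h2
  rw [h3.fderiv]; simp

/-- Chain rule along a space-time curve. -/
theorem hasDerivAt_along {F : ℝ → E3 → G} {γ : ℝ → E3} {w : E3} (hγ : HasDerivAt γ w t)
    (h : SmoothAt F t (γ t)) :
    HasDerivAt (fun s => F s (γ s))
      (fderiv ℝ (fun q : ℝ × E3 => F q.1 q.2) (t, γ t) (1, w)) t :=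
  HasFDerivAt.comp_hasDerivAt (f := fun s => (s, γ s)) t h.differentiableAt_uncurry.hasFDerivAt
    ((hasDerivAt_id t).prodMk hγ)

theorem hasDerivAt_matD {F : ℝ → E3 → G} {γ : ℝ → E3} (hγ : HasDerivAt γ (u t (γ t)) t)
    (h : SmoothAt F t (γ t)) :
    HasDerivAt (fun s => F s (γ s)) (matD u F t (γ t)) t :=
  hasDerivAt_along hγ h

/-- The material derivative of the spatial derivative. -/
theorem matD_fderiv {F : ℝ → E3 → G} (hF : SmoothAt F t x) (hu : SmoothAt u t x)
    (v : E3) : matD u (fun s => fderiv ℝ (F s)) t x v =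
      fderiv ℝ (matD u F t) x v
        - fderiv ℝ (F t) x (fderiv ℝ (u t) x v) := by
  set Φ := fun q : ℝ × E3 => F q.1 q.2 with hΦ
  have hΦ2 : DifferentiableAt ℝ (fderiv ℝ Φ) (t, x) :=
    (ContDiffAt.fderiv_right (m := 1) hF (by norm_cast)).differentiableAt (by simp)
  have hsym : IsSymmSndFDerivAt ℝ Φ (t, x) :=
    ContDiffAt.isSymmSndFDerivAt hF (by rw [minSmoothness_of_isRCLikeNormedField]; norm_cast)
  have hev : ∀ᶠ q in 𝓝 (t, x), ContDiffAt ℝ 1 Φ q :=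
    (ContDiffAt.of_le (m := 1) hF (by norm_cast)).eventually (by simp)
  have e1 : (fun q : ℝ × E3 => fderiv ℝ (F q.1) q.2) =ᶠ[𝓝 (t, x)]
      fun q => (fderiv ℝ Φ q).comp (ContinuousLinearMap.inr ℝ ℝ E3) := by
    filter_upwards [hev] with q hq
    have h1 : HasFDerivAt (fun y : E3 => (q.1, y)) (ContinuousLinearMap.inr ℝ ℝ E3) q.2 :=
      hasFDerivAt_prodMk_right q.1 q.2
    have h3 : HasFDerivAt (F q.1) _ q.2 :=
      HasFDerivAt.comp (g := Φ) q.2 (hq.differentiableAt (by simp)).hasFDerivAt h1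
    exact h3.fderiv
  -- Both sides are now second derivatives of the space-time function in the directions (1, u) and
  -- (0, v). Differentiating the direction (1, u) itself produces the ∇F ∇u correction.
  have e2 : matD u (fun s => fderiv ℝ (F s)) t x v =
      fderiv ℝ (fderiv ℝ Φ) (t, x) (1, u t x) (0, v) := by
    rw [matD, e1.fderiv_eq]
    have := hΦ2.hasFDerivAt.clm_comp
      (hasFDerivAt_const (ContinuousLinearMap.inr ℝ ℝ E3) (t, x))
    rw [this.fderiv]
    simp
  have hu1 : HasFDerivAt (fun y => ((1 : ℝ), u t y))
      ((0 : E3 →L[ℝ] ℝ).prod (fderiv ℝ (u t) x)) x :=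
    (hasFDerivAt_const (1 : ℝ) x).prodMk hu.differentiableAt.hasFDerivAt
  have h4 : HasFDerivAt (fun y => fderiv ℝ Φ (t, y))
      ((fderiv ℝ (fderiv ℝ Φ) (t, x)).comp (ContinuousLinearMap.inr ℝ ℝ E3)) x :=
    HasFDerivAt.comp x hΦ2.hasFDerivAt (hasFDerivAt_prodMk_right t x)
  have h5 := h4.clm_apply hu1
  have h6 : HasFDerivAt (matD u F t) _ x := h5
  rw [e2, h6.fderiv, fderiv_eq_uncurry hF, hsym.eq]
  simp [hΦ]

end MatD

theorem chartMap_extChartAt {M : Type*} [TopologicalSpace M]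
    [ChartedSpace (EuclideanSpace ℝ (Fin 2)) M] (X : ℝ → M → E3) (y : M) (s : ℝ) :
    chartMap X y s (extChartAt (𝓡 2) y y) = X s y := by simp [chartMap]

section Param

variable {M : Type*} [TopologicalSpace M] [T2Space M] [CompactSpace M]
  [ChartedSpace (EuclideanSpace ℝ (Fin 2)) M] [IsManifold (𝓡 2) ∞ M]
  {I : Set ℝ} {X : ℝ → M → E3} {n : ℝ → E3 → E3}

theorem IsUnitNormal.isClosedSurface (hI : IsOpen I) (hX : IsParametrization I X)
    (hn : IsUnitNormal I X n) {t : ℝ} (ht : t ∈ I) : IsClosedSurface (range (X t)) (n t) where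
  isCompact := isCompact_range (hX.continuous ht)
  smooth x hx := SmoothAt.contDiffAt (hn.smooth t ht x hx)
  norm_eq_one := by rintro _ ⟨y, rfl⟩; exact hn.norm_eq_one t ht y
  exists_patch := by
    rintro _ ⟨y, rfl⟩
    refine ⟨chartMap X y t, _, extChartAt (𝓡 2) y y, hX.isSurfacePatch hI ht y,
      mem_extChartAt_target y, chartMap_extChartAt X y t, fun v => ?_⟩
    obtain ⟨L, hL⟩ := hX.fderiv_chartMap hI ht y (mem_extChartAt_target y)
    have h1 := hn.orthogonal t ht ((extChartAt (𝓡 2) y).symm (extChartAt (𝓡 2) y y)) (L v)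
    rw [← hL] at h1
    simpa only [extChartAt_to_inv] using h1

omit [T2Space M] [CompactSpace M] in
theorem IsParametrization.hasDerivAt (hI : IsOpen I) (hX : IsParametrization I X) {t : ℝ}
    (ht : t ∈ I) (y : M) : HasDerivAt (fun s => X s y) (obsVel X t y) t := by
  have h1 : DifferentiableAt ℝ (fun s => X s y) t := by
    have h2 := (hX.contDiffAt_chartMap hI y ht (mem_extChartAt_target y)).differentiableAt
      (by simp)
    have h3 := DifferentiableAt.comp (f := fun s : ℝ => (s, extChartAt (𝓡 2) y y)) t h2
      (by fun_prop)
    simpa only [Function.comp_def, chartMap_extChartAt] using h3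
  exact h1.hasDerivAt

end Param

/-- `Y` is the material parametrization of an evolving inextensible closed surface with unit
normal `n` and velocity `u`. -/
structure IsMaterialFlow {M : Type*} [TopologicalSpace M]
    [ChartedSpace (EuclideanSpace ℝ (Fin 2)) M] (I : Set ℝ) (Y : ℝ → M → E3)
    (n u : ℝ → E3 → E3) : Prop where
  isOpen : IsOpen I
  param : IsParametrization I Y
  surface : ∀ t ∈ I, IsClosedSurface (range (Y t)) (n t)
  smooth_n : ∀ t ∈ I, ∀ x ∈ range (Y t), SmoothAt n t x
  smooth_u : ∀ t ∈ I, ∀ x ∈ range (Y t), SmoothAt u t x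
  velocity : ∀ t ∈ I, ∀ y, HasDerivAt (fun s => Y s y) (u t (Y t y)) t
  inextensible : ∀ t ∈ I, ∀ x ∈ range (Y t), divP (n t) (u t) x = 0

/-! ### Inextensible material flows: transport of area and of the normal -/

namespace IsMaterialFlow

variable {M : Type*} [TopologicalSpace M] [T2Space M] [CompactSpace M]
  [ChartedSpace (EuclideanSpace ℝ (Fin 2)) M] [IsManifold (𝓡 2) ∞ M]
  {I : Set ℝ} {Y : ℝ → M → E3} {n u : ℝ → E3 → E3} (h : IsMaterialFlow I Y n u)
include h

omit [T2Space M] [CompactSpace M] in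
/-- The coordinate tangent vectors are transported by the velocity gradient. -/
theorem hasDerivAt_fderiv_chartMap (y₀ : M) {t : ℝ} (ht : t ∈ I) {z : E2}
    (hz : z ∈ (extChartAt (𝓡 2) y₀).target) (v : E2) :
    HasDerivAt (fun s => fderiv ℝ (chartMap Y y₀ s) z v)
      (fderiv ℝ (u t) (chartMap Y y₀ t z) (fderiv ℝ (chartMap Y y₀ t) z v)) t := by
  set Φ := fun q : ℝ × E2 => chartMap Y y₀ q.1 q.2 with hΦ
  have hsm : ∀ s ∈ I, ∀ w ∈ (extChartAt (𝓡 2) y₀).target, ContDiffAt ℝ ∞ Φ (s, w) :=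
    fun s hs w hw => h.param.contDiffAt_chartMap h.isOpen y₀ hs hw
  have hd : ∀ s ∈ I, ∀ w ∈ (extChartAt (𝓡 2) y₀).target, HasFDerivAt Φ (fderiv ℝ Φ (s, w)) (s, w) :=
    fun s hs w hw => ((hsm s hs w hw).differentiableAt (by simp)).hasFDerivAt
  have hsp : ∀ s ∈ I, ∀ w ∈ (extChartAt (𝓡 2) y₀).target, HasFDerivAt (chartMap Y y₀ s)
      ((fderiv ℝ Φ (s, w)).comp (ContinuousLinearMap.inr ℝ ℝ E2)) w := fun s hs w hw =>
    HasFDerivAt.comp (g := Φ) w (hd s hs w hw) (hasFDerivAt_prodMk_right s w)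
  -- The time derivative of the chart map is u along the surface for all w, so it may be
  -- differentiated in space; symmetry of second derivatives then exchanges time and space.
  have htm : ∀ w ∈ (extChartAt (𝓡 2) y₀).target,
      fderiv ℝ Φ (t, w) (1, 0) = u t (chartMap Y y₀ t w) := fun w hw => by
    have h1 : HasDerivAt (fun s => chartMap Y y₀ s w) (fderiv ℝ Φ (t, w) (1, 0)) t :=
      HasFDerivAt.comp_hasDerivAt (f := fun s => (s, w)) t (hd t ht w hw)
        ((hasDerivAt_id t).prodMk (hasDerivAt_const t w))
    exact h1.unique (h.velocity t ht _)
  have h2 : HasFDerivAt (fderiv ℝ Φ) (fderiv ℝ (fderiv ℝ Φ) (t, z)) (t, z) :=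
    (((hsm t ht z hz).fderiv_right (m := 1) (by norm_cast)).differentiableAt
      (by simp)).hasFDerivAt
  have hsym : IsSymmSndFDerivAt ℝ Φ (t, z) :=
    (hsm t ht z hz).isSymmSndFDerivAt
      (by rw [minSmoothness_of_isRCLikeNormedField]; norm_cast)
  have h3 : HasDerivAt (fun s => fderiv ℝ Φ (s, z)) (fderiv ℝ (fderiv ℝ Φ) (t, z) (1, 0)) t :=
    HasFDerivAt.comp_hasDerivAt (f := fun s => (s, z)) t h2
      ((hasDerivAt_id t).prodMk (hasDerivAt_const t z))
  have h4 : HasDerivAt (fun s => fderiv ℝ Φ (s, z) (0, v))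
      (fderiv ℝ (fderiv ℝ Φ) (t, z) (1, 0) (0, v)) t := by
    simpa using h3.clm_apply (hasDerivAt_const t ((0 : ℝ), v))
  have h5 : (fun s => fderiv ℝ (chartMap Y y₀ s) z v) =ᶠ[𝓝 t] fun s => fderiv ℝ Φ (s, z) (0, v) :=
    eventually_of_mem (h.isOpen.mem_nhds ht) fun s hs => by
      simp only [(hsp s hs z hz).fderiv]; simp
  have h6 : HasFDerivAt (fun w => fderiv ℝ Φ (t, w) (1, 0))
      (((fderiv ℝ (fderiv ℝ Φ) (t, z)).comp (ContinuousLinearMap.inr ℝ ℝ E2)).flip (1, 0)) z := by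
    have := (HasFDerivAt.comp (g := fderiv ℝ Φ) z h2 (hasFDerivAt_prodMk_right t z)).clm_apply
      (hasFDerivAt_const ((1 : ℝ), (0 : E2)) z)
    simpa using this
  have h7 : HasFDerivAt (fun w => u t (chartMap Y y₀ t w))
      ((fderiv ℝ (u t) (chartMap Y y₀ t z)).comp (fderiv ℝ (chartMap Y y₀ t) z)) z :=
    HasFDerivAt.comp z (h.smooth_u t ht _ ⟨_, rfl⟩).differentiableAt.hasFDerivAt
      (hsp t ht z hz).differentiableAt.hasFDerivAt
  have h8 := h6.unique (h7.congr_of_eventuallyEq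
    (eventually_of_mem ((isOpen_extChartAt_target y₀).mem_nhds hz) htm))
  have h9 := congrArg (fun L => L v) h8
  simp only [ContinuousLinearMap.flip_apply, ContinuousLinearMap.comp_apply,
    ContinuousLinearMap.inr_apply] at h9
  rw [← h9, hsym.eq]
  exact h4.congr_of_eventuallyEq h5

/-- The area element of an inextensible material parametrization does not depend on time. -/
theorem norm_areaVec_eq (y₀ : M) {t δ : ℝ} (hδ : Metric.ball t δ ⊆ I) {s : ℝ}
    (hs : s ∈ Metric.ball t δ) {z : E2} (hz : z ∈ (extChartAt (𝓡 2) y₀).target) :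
    ‖areaVec (fderiv ℝ (chartMap Y y₀ s) z)‖ = ‖areaVec (fderiv ℝ (chartMap Y y₀ t) z)‖ := by
  set c := fun s => areaVec (fderiv ℝ (chartMap Y y₀ s) z) with hc
  have hder : ∀ r ∈ I, HasDerivAt (fun r => ⟪c r, c r⟫) 0 r := by
    intro r hr
    have h0 := h.hasDerivAt_fderiv_chartMap y₀ hr hz (fb 0)
    have h1 := h.hasDerivAt_fderiv_chartMap y₀ hr hz (fb 1)
    have h2 : HasDerivAt c _ r := cross.hasDerivAt_of_bilinear (fun _ => h0) (fun _ => h1)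
    have h3 := h2.inner ℝ h2
    have hp := h.param.isSurfacePatch h.isOpen hr y₀
    have hS := h.surface r hr
    have h4 := inner_normal_cross_variation (hS.norm_eq_one _ (hp.mem hz))
      (hS.inner_patch_eq_zero hp hz (fb 0)) (hS.inner_patch_eq_zero hp hz (fb 1))
      (areaVec_ne_zero (hp.immersion z hz)) (fderiv ℝ (u r) (chartMap Y y₀ r z))
    have h5 : divP (n r) (u r) (chartMap Y y₀ r z) = 0 := h.inextensible r hr _ (hp.mem hz)
    simp only [divP, gradP, gradC] at h5
    rw [h5, mul_zero, add_comm] at h4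
    have h6 : c r = ⟪n r (chartMap Y y₀ r z), c r⟫ • n r (chartMap Y y₀ r z) :=
      hS.inner_areaVec_smul hp hz
    -- The area vector c is parallel to n, and the normal component of its rate is proportional to
    -- div_P u = 0. Hence ⟨c, c⟩ has zero derivative.
    have h7 : ∀ w, ⟪n r (chartMap Y y₀ r z), w⟫ = 0 → ⟪c r, w⟫ = 0 := fun w hw => by
      rw [h6, inner_smul_left, hw, mul_zero]
    rwa [real_inner_comm (c r), h7 _ h4, add_zero] at h3
  have h1 : ⟪c s, c s⟫ = ⟪c t, c t⟫ := by
    -- Constancy needs a connected time set; I is only open, hence the ball.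
    refine Metric.isOpen_ball.is_const_of_deriv_eq_zero (f := fun r => ⟪c r, c r⟫) ?_
      (fun r hr => (hder r (hδ hr)).differentiableAt.differentiableWithinAt)
      (fun r hr => (hder r (hδ hr)).deriv) hs ?_
    · exact (convex_ball t δ).isPreconnected
    · exact Metric.mem_ball_self (Metric.pos_of_mem_ball hs)
  rw [real_inner_self_eq_norm_sq, real_inner_self_eq_norm_sq] at h1
  exact (sq_eq_sq₀ (norm_nonneg _) (norm_nonneg _)).mp h1

/-- On each chart the pulled-back area measure has the norm of the area vector as density, which
inextensibility freezes in time. Finitely many charts cover the compact manifold. -/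
theorem comap_eq [MeasurableSpace M] [BorelSpace M] {t δ : ℝ} (hδ : Metric.ball t δ ⊆ I) {s : ℝ}
    (hs : s ∈ Metric.ball t δ) :
    (μHE[2] : Measure E3).comap (Y s) = (μHE[2] : Measure E3).comap (Y t) := by
  have ht : t ∈ Metric.ball t δ := Metric.mem_ball_self (Metric.pos_of_mem_ball hs)
  obtain ⟨T, hT⟩ := (isCompact_univ (X := M)).elim_nhds_subcover
    (fun y => (extChartAt (𝓡 2) y).source) (fun y _ => extChartAt_source_mem_nhds y)
  have hcov : ⋃ y : T, (extChartAt (𝓡 2) (y : M)).source = univ := by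
    rw [eq_univ_iff_forall]
    intro x
    obtain ⟨i, hi, hxi⟩ := mem_iUnion₂.mp (hT.2 (mem_univ x))
    exact mem_iUnion.mpr ⟨⟨i, hi⟩, hxi⟩
  rw [Measure.ext_iff_of_iUnion_eq_univ hcov]
  rintro ⟨y₀, -⟩
  ext A hA
  have hAs : MeasurableSet (A ∩ (extChartAt (𝓡 2) y₀).source) :=
    hA.inter (isOpen_extChartAt_source y₀).measurableSet
  set B := (extChartAt (𝓡 2) y₀).target ∩ (extChartAt (𝓡 2) y₀).symm ⁻¹' A with hB
  have hBm : MeasurableSet B := by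
    obtain ⟨g, hg, hge⟩ := (continuousOn_iff_continuous_domRestrict.mp
      (continuousOn_extChartAt_symm (I := 𝓡 2) y₀)).measurable hA
    rw [hB, ← Subtype.image_preimage_coe]
    exact (isOpen_extChartAt_target y₀).measurableSet.subtype_image ⟨g, hg, hge⟩
  have himg : A ∩ (extChartAt (𝓡 2) y₀).source = (extChartAt (𝓡 2) y₀).symm '' B := by
    rw [inter_comm, (extChartAt (𝓡 2) y₀).symm_image_target_inter_eq',
      (extChartAt (𝓡 2) y₀).source_inter_preimage_inv_preimage]
  have key : ∀ r ∈ Metric.ball t δ, (μHE[2] : Measure E3).comap (Y r)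
      (A ∩ (extChartAt (𝓡 2) y₀).source)
      = ∫⁻ z in B, ENNReal.ofReal ‖areaVec (fderiv ℝ (chartMap Y y₀ t) z)‖ := by
    intro r hr
    have he := (h.param.isClosedEmbedding (hδ hr)).measurableEmbedding
    have h1 : Y r '' ((extChartAt (𝓡 2) y₀).symm '' B) = chartMap Y y₀ r '' B := by
      rw [image_image]; rfl
    rw [he.comap_apply, himg, h1,
      (h.param.isSurfacePatch h.isOpen (hδ hr) y₀).euclideanHausdorffMeasure_image hBm
        inter_subset_left]
    refine setLIntegral_congr_fun hBm fun z hz => ?_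
    rw [h.norm_areaVec_eq y₀ hδ hr hz.1]
  rw [Measure.restrict_apply hA, Measure.restrict_apply hA, key s hs, key t ht]

omit [T2Space M] [CompactSpace M] [IsManifold (𝓡 2) ∞ M] in
theorem continuousOn_comp {G : Type*} [NormedAddCommGroup G] [NormedSpace ℝ G] {F : ℝ → E3 → G}
    (hF : ∀ t ∈ I, ∀ x ∈ range (Y t), SmoothAt F t x) :
    ContinuousOn (fun q : ℝ × M => F q.1 (Y q.1 q.2)) (I ×ˢ univ) := by
  intro q hq
  have h1 : ContinuousAt (fun q : ℝ × E3 => F q.1 q.2) (q.1, Y q.1 q.2) :=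
    ContDiffAt.continuousAt (hF q.1 hq.1 _ ⟨q.2, rfl⟩)
  exact ContinuousAt.comp_continuousWithinAt (f := fun q : ℝ × M => (q.1, Y q.1 q.2)) h1
    (continuousWithinAt_fst.prodMk (h.param.smooth.continuousOn q hq))

/-- Transport theorem on inextensible surfaces. -/
theorem hasDerivAt_surfInt {F : ℝ → E3 → ℝ} (hF : ∀ t ∈ I, ∀ x ∈ range (Y t), SmoothAt F t x)
    {t : ℝ} (ht : t ∈ I) :
    HasDerivAt (fun s => surfInt (range (Y s)) (F s))
      (surfInt (range (Y t)) (matD u F t)) t := by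
  borelize M
  obtain ⟨δ, hδ0, hδ⟩ := Metric.isOpen_iff.mp h.isOpen t ht
  -- One measure on `M` serves for all times in the ball, so differentiating the surface integral
  -- reduces to differentiation under the integral sign.
  set ν := (μHE[2] : Measure E3).comap (Y t) with hν
  have hint : ∀ s ∈ Metric.ball t δ, ∀ G : E3 → ℝ,
      surfInt (range (Y s)) G = ∫ y, G (Y s y) ∂ν := by
    intro s hs G
    have he := (h.param.isClosedEmbedding (hδ hs)).measurableEmbedding
    rw [hν, ← h.comap_eq hδ hs, ← he.integral_map, he.map_comap]
    rfl
  have hfin : IsFiniteMeasure ν := ⟨by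
    have he := (h.param.isClosedEmbedding ht).measurableEmbedding
    rw [hν, he.comap_apply, image_univ]
    exact (h.surface t ht).measure_lt_top⟩
  have hD : ∀ t ∈ I, ∀ x ∈ range (Y t), SmoothAt (matD u F) t x := fun s hs x hx =>
    (hF s hs x hx).matD (h.smooth_u s hs x hx)
  -- Halving the radius gives a compact time interval inside I, on which the material derivative is
  -- bounded uniformly over `M`; the constant bound is integrable because ν is finite.
  have hball : Metric.closedBall t (δ / 2) ⊆ I :=
    (Metric.closedBall_subset_ball (half_lt_self hδ0)).trans hδ
  obtain ⟨C, hC⟩ := ((isCompact_closedBall t (δ / 2)).prod (isCompact_univ (X := M))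
    ).exists_bound_of_continuousOn
      ((h.continuousOn_comp hD).mono (prod_mono hball Subset.rfl))
  have hcs : ∀ {G : ℝ → E3 → ℝ}, (∀ t ∈ I, ∀ x ∈ range (Y t), SmoothAt G t x) →
      ∀ s ∈ I, Continuous fun y => G s (Y s y) := fun hG s hs =>
    (h.continuousOn_comp hG).comp_continuous (f := fun y : M => (s, y)) (by fun_prop)
      fun y => ⟨hs, mem_univ _⟩
  have hmain := hasDerivAt_integral_of_dominated_loc_of_deriv_le (μ := ν)
    (F := fun s y => F s (Y s y)) (F' := fun s y => matD u F s (Y s y)) (x₀ := t)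
    (bound := fun _ => C) (Metric.ball_mem_nhds t (half_pos hδ0))
    (eventually_of_mem (h.isOpen.mem_nhds ht) fun s hs => (hcs hF s hs).aestronglyMeasurable)
    ((hcs hF t ht).integrable_of_hasCompactSupport (HasCompactSupport.of_compactSpace _))
    (hcs hD t ht).aestronglyMeasurable
    (ae_of_all _ fun y s hs => hC (s, y) ⟨Metric.ball_subset_closedBall hs, mem_univ _⟩)
    (integrable_const C)
    (ae_of_all _ fun y s hs => hasDerivAt_matD
      (h.velocity s (hball (Metric.ball_subset_closedBall hs)) y)
      (hF s (hball (Metric.ball_subset_closedBall hs)) _ ⟨y, rfl⟩))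
  rw [hint t (Metric.mem_ball_self hδ0)]
  exact hmain.2.congr_of_eventuallyEq
    (eventually_of_mem (Metric.ball_mem_nhds t hδ0) fun s hs => hint s hs (F s))

/-- Evolution of the unit normal. -/
theorem inner_matD_normal {t : ℝ} (ht : t ∈ I) {x : E3} (hx : x ∈ range (Y t)) {w : E3}
    (hw : ⟪n t x, w⟫ = 0) : ⟪matD u n t x, w⟫ = -⟪n t x, fderiv ℝ (u t) x w⟫ := by
  obtain ⟨y, rfl⟩ := hx
  have hz := mem_extChartAt_target (I := 𝓡 2) y
  have hp := h.param.isSurfacePatch h.isOpen ht y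
  have hS := h.surface t ht
  have hort := hS.inner_patch_eq_zero hp hz
  rw [chartMap_extChartAt] at hort
  obtain ⟨v, rfl⟩ := exists_apply_eq_of_orthogonal (hp.immersion _ hz)
    (hS.norm_eq_one _ ⟨y, rfl⟩) hort hw
  have h1 := h.hasDerivAt_fderiv_chartMap y ht hz v
  rw [chartMap_extChartAt] at h1
  have h2 : HasDerivAt (fun s => n s (Y s y)) (matD u n t (Y t y)) t :=
    hasDerivAt_matD (h.velocity t ht y) (h.smooth_n t ht _ ⟨y, rfl⟩)
  have h3 := h2.inner ℝ h1
  -- The normal stays orthogonal to a coordinate tangent vector, and that vector is transported by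
  -- ∇u.
  have h4 : (fun s => ⟪n s (Y s y), fderiv ℝ (chartMap Y y s) (extChartAt (𝓡 2) y y) v⟫)
      =ᶠ[𝓝 t] fun _ => 0 :=
    eventually_of_mem (h.isOpen.mem_nhds ht) fun s hs => by
      have := (h.surface s hs).inner_patch_eq_zero (h.param.isSurfacePatch h.isOpen hs y) hz v
      rwa [chartMap_extChartAt] at this
  have h5 := h3.unique ((hasDerivAt_const t (0 : ℝ)).congr_of_eventuallyEq h4)
  linarith

-- Differentiating ‖n‖² = 1 along trajectories shows that the rate of the normal is tangential.
-- Together with `inner_matD_normal` this determines it.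
omit [T2Space M] [CompactSpace M] [IsManifold (𝓡 2) ∞ M] in
theorem inner_matD_normal_self {t : ℝ} (ht : t ∈ I) {x : E3} (hx : x ∈ range (Y t)) :
    ⟪n t x, matD u n t x⟫ = 0 := by
  obtain ⟨y, rfl⟩ := hx
  have h2 : HasDerivAt (fun s => n s (Y s y)) (matD u n t (Y t y)) t :=
    hasDerivAt_matD (h.velocity t ht y) (h.smooth_n t ht _ ⟨y, rfl⟩)
  have h3 := h2.inner ℝ h2
  have h4 : (fun s => ⟪n s (Y s y), n s (Y s y)⟫) =ᶠ[𝓝 t] fun _ => 1 :=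
    eventually_of_mem (h.isOpen.mem_nhds ht) fun s hs =>
      inner_self_unit ((h.surface s hs).norm_eq_one _ ⟨y, rfl⟩)
  have h5 := h3.unique ((hasDerivAt_const t (1 : ℝ)).congr_of_eventuallyEq h4)
  rw [real_inner_comm (n t (Y t y))] at h5
  linarith

end IsMaterialFlow

/-! ### Calculus on a closed surface -/

theorem inner_gradient (f : E3 → ℝ) (x v : E3) : ⟪gradient f x, v⟫ = fderiv ℝ f x v := by
  simp [gradient]

theorem inner_gradS (n : E3 → E3) (f : E3 → ℝ) (x w : E3) :
    ⟪gradS n f x, w⟫ = fderiv ℝ f x (tangProj (n x) w) := by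
  rw [gradS, inner_tangProj_comm, inner_gradient]

theorem inner_gradS_of_tangential {n : E3 → E3} {x w : E3} (hw : ⟪n x, w⟫ = 0) (f : E3 → ℝ) :
    ⟪gradS n f x, w⟫ = fderiv ℝ f x w := by
  rw [inner_gradS, tangProj_eq_of_orthogonal hw]

theorem inner_normal_gradS {n : E3 → E3} {x : E3} (hn : ‖n x‖ = 1) (f : E3 → ℝ) :
    ⟪n x, gradS n f x⟫ = 0 :=
  inner_tangProj_self hn _

theorem tr_eq_zero_of_forall {A : E3 →L[ℝ] E3} (h : ∀ v, A v = 0) : tr A = 0 := by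
  simp [tr_eq_sum, h]

section Divergence

variable {n : E3 → E3} {x : E3} (hn : ‖n x‖ = 1)
include hn

theorem divP_add {V W : E3 → E3} (hV : DifferentiableAt ℝ V x) (hW : DifferentiableAt ℝ W x) :
    divP n (fun y => V y + W y) x = divP n V x + divP n W x := by
  simp only [divP_eq_of_unit hn]
  rw [fderiv_fun_add hV hW, ContinuousLinearMap.add_comp, tr_add]

theorem divP_smul {f : E3 → ℝ} {W : E3 → E3} (hf : DifferentiableAt ℝ f x)
    (hW : DifferentiableAt ℝ W x) :
    divP n (fun y => f y • W y) x = f x * divP n W x + ⟪gradS n f x, W x⟫ := by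
  simp only [divP_eq_of_unit hn]
  rw [fderiv_fun_smul hf hW, ContinuousLinearMap.add_comp, tr_add, inner_gradS]
  congr 1
  · rw [← tr_smul]; rfl
  · have : ((fderiv ℝ f x).smulRight (W x)).comp (tangProj (n x))
        = ((fderiv ℝ f x).comp (tangProj (n x))).smulRight (W x) := by ext1 v; simp
    rw [this, tr_smulRight]; rfl

theorem divergence_add {V W : E3 → E3} (hV : DifferentiableAt ℝ V x)
    (hW : DifferentiableAt ℝ W x) :
    divergence n (fun y => V y + W y) x = divergence n V x + divergence n W x := by
  simp only [divergence, divP_add hn hV hW, inner_add_left]; ring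

theorem divergence_smul {f : E3 → ℝ} {W : E3 → E3} (hf : DifferentiableAt ℝ f x)
    (hW : DifferentiableAt ℝ W x) :
    divergence n (fun y => f y • W y) x = f x * divergence n W x + ⟪gradS n f x, W x⟫ := by
  simp only [divergence, divP_smul hn hf hW, inner_smul_left, RCLike.conj_to_real]; ring

end Divergence

theorem divergence_of_tangential {n : E3 → E3} {x : E3} {W : E3 → E3} (hW : ⟪W x, n x⟫ = 0) :
    divergence n W x = divP n W x := by
  simp [divergence, hW]

namespace IsClosedSurface

variable {Γ : Set E3} {n : E3 → E3} (h : IsClosedSurface Γ n) {x : E3} (hx : x ∈ Γ)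
include h hx

/-- Divergence of a symmetric tensor field applied to a vector field. -/
theorem divP_clm_apply {A : E3 → E3 →L[ℝ] E3} {w : E3 → E3} (hA : DifferentiableAt ℝ A x)
    (hw : DifferentiableAt ℝ w x)
    (hsym : ∀ y ∈ Γ, ∀ v₁ v₂, ⟪A y v₁, v₂⟫ = ⟪v₁, A y v₂⟫) :
    divP n (fun y => A y (w y)) x =
      ⟪w x, divC n A x⟫ + tr ((A x).comp ((fderiv ℝ w x).comp (tangProj (n x)))) := by
  have hn := h.norm_eq_one x hx
  -- The symmetry of A holds only on Γ; the directions P e_i are tangential, so it survives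
  -- differentiation.
  have hs : ∀ i, ⟪fderiv ℝ A x (tangProj (n x) (eb i)) (w x), eb i⟫
      = ⟪w x, fderiv ℝ A x (tangProj (n x) (eb i)) (eb i)⟫ := fun i => by
    have hcon : ∀ v : E3, DifferentiableAt ℝ (fun y => A y v) x := fun v =>
      hA.clm_apply (differentiableAt_const v)
    have hfd : ∀ v d : E3, fderiv ℝ (fun y => A y v) x d = fderiv ℝ A x d v := fun v d => by
      rw [fderiv_clm_apply hA (differentiableAt_const v)]; simp
    have := h.fderiv_congr (F₁ := fun y => ⟪A y (w x), eb i⟫) (F₂ := fun y => ⟪w x, A y (eb i)⟫)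
      hx ((hcon _).inner ℝ (differentiableAt_const _))
      ((differentiableAt_const _).inner ℝ (hcon _)) (fun y hy => hsym y hy _ _)
      (inner_tangProj_self hn (eb i))
    rw [fderiv_inner_apply ℝ (hcon _) (differentiableAt_const _),
      fderiv_inner_apply ℝ (differentiableAt_const _) (hcon _), hfd, hfd] at this
    simpa using this
  rw [divP_eq_of_unit hn, fderiv_clm_apply hA hw]
  simp only [tr_eq_sum, divC, inner_sum, ← Finset.sum_add_distrib]
  refine Finset.sum_congr rfl fun i _ => ?_
  rw [← hs i, ContinuousLinearMap.comp_apply, add_apply, ContinuousLinearMap.comp_apply,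
    ContinuousLinearMap.flip_apply, inner_add_left, add_comm]
  rfl

theorem gradC_normal_orthogonal (v : E3) : ⟪n x, gradC n n x v⟫ = 0 :=
  h.inner_fderiv_normal hx (inner_tangProj_self (h.norm_eq_one x hx) v)

theorem gradC_normal_symm (v w : E3) : ⟪gradC n n x v, w⟫ = ⟪v, gradC n n x w⟫ := by
  have hn := h.norm_eq_one x hx
  have key : ∀ v w : E3, ⟪gradC n n x v, w⟫
      = ⟪fderiv ℝ n x (tangProj (n x) v), tangProj (n x) w⟫ := fun v w => by
    rw [← inner_tangProj_comm]
    exact (congrArg (fun z => ⟪z, w⟫)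
      (tangProj_eq_of_orthogonal (h.gradC_normal_orthogonal hx v))).symm
  rw [real_inner_comm (gradC n n x w) v, key, key]
  exact h.fderiv_normal_symm hx (inner_tangProj_self hn v) (inner_tangProj_self hn w)

/-- Since ‖n‖ = 1, tangential derivatives of n are already tangential and the outer projection does
nothing. Curvature can be computed with the simpler tensor `gradC n n`. -/
theorem shapeOp_eq : shapeOp n x = -gradC n n x := by
  ext1 v
  simp only [shapeOp, gradP, neg_apply, ContinuousLinearMap.comp_apply]
  rw [tangProj_eq_of_orthogonal (h.gradC_normal_orthogonal hx v)]

theorem meanCurv_eq : meanCurv n x = -tr (gradC n n x) := by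
  rw [meanCurv, h.shapeOp_eq hx, tr_neg]

theorem frobSq_shapeOp : frobSq (shapeOp n x) = tr ((gradC n n x).comp (gradC n n x)) := by
  rw [h.shapeOp_eq hx]
  simp only [frobSq, tr_eq_sum]
  refine Finset.sum_congr rfl fun i _ => ?_
  rw [neg_apply, norm_neg, ContinuousLinearMap.comp_apply, h.gradC_normal_symm hx,
    real_inner_self_eq_norm_sq]

/-- Product rule for (∇n)P. The term with the derivative of n along n depends on the extension and
has to disappear in the Codazzi identity. -/
theorem fderiv_gradC_normal_apply (w v : E3) :
    fderiv ℝ (fun y => gradC n n y w) x v =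
      fderiv ℝ (fderiv ℝ n) x v (tangProj (n x) w) - ⟪fderiv ℝ n x v, w⟫ • fderiv ℝ n x (n x)
        - ⟪n x, w⟫ • fderiv ℝ n x (fderiv ℝ n x v) := by
  have hd := h.differentiableAt hx
  have h2 : DifferentiableAt ℝ (fderiv ℝ n) x :=
    ((h.smooth x hx).fderiv_right (m := 1) (by norm_cast)).differentiableAt (by simp)
  have hi : DifferentiableAt ℝ (fun y => ⟪n y, w⟫) x := hd.inner ℝ (differentiableAt_const w)
  have hs : DifferentiableAt ℝ (fun y => ⟪n y, w⟫ • n y) x := hi.smul hd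
  have hp : DifferentiableAt ℝ (fun y => w - ⟪n y, w⟫ • n y) x :=
    (differentiableAt_const w).sub hs
  have e : (fun y => gradC n n y w) = fun y => fderiv ℝ n y (w - ⟪n y, w⟫ • n y) := by
    funext y; rw [gradC, ContinuousLinearMap.comp_apply, tangProj_apply]
  rw [e, fderiv_clm_apply h2 hp, fderiv_fun_sub (differentiableAt_const w) hs,
    fderiv_fun_smul hi hd, tangProj_apply]
  have e2 : fderiv ℝ (fun y => ⟪n y, w⟫) x v = ⟪fderiv ℝ n x v, w⟫ := by
    rw [fderiv_inner_apply ℝ hd (differentiableAt_const w)]; simp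
  simp [e2]
  abel

/-- The Codazzi identity. -/
theorem inner_divC_gradC_normal (w : E3) :
    ⟪w, divC n (gradC n n) x⟫ =
      -⟪gradS n (meanCurv n) x, w⟫ - ⟪n x, w⟫ * frobSq (shapeOp n x) := by
  have hn := h.norm_eq_one x hx
  have hd := h.differentiableAt hx
  have hns := (h.smooth x hx).smoothAt 0
  have hb : DifferentiableAt ℝ (gradC n n) x := (hns.gradC hns).differentiableAt
  have hbw : ∀ w : E3, DifferentiableAt ℝ (fun y => gradC n n y w) x := fun w =>
    hb.clm_apply (differentiableAt_const w)
  have hsym := ((h.smooth x hx).isSymmSndFDerivAt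
      (by rw [minSmoothness_of_isRCLikeNormedField]; norm_cast))
  set b := gradC n n x with hbdef
  have hbP : ∀ v, b v = fderiv ℝ n x (tangProj (n x) v) := fun v => rfl
  have hNb : ∀ v, fderiv ℝ n x (b v) = b (b v) := fun v => by
    rw [hbP (b v), tangProj_eq_of_orthogonal (h.gradC_normal_orthogonal hx v)]
  have e1 : ⟪w, divC n (gradC n n) x⟫
      = ∑ i, ⟪fderiv ℝ (fun y => gradC n n y w) x (tangProj (n x) (eb i)), eb i⟫ := by
    have := h.divP_clm_apply hx hb (differentiableAt_const w)
      (fun y hy => h.gradC_normal_symm hy)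
    rw [divP_eq_of_unit hn, tr_eq_sum, tr_eq_zero_of_forall (fun v => by simp), add_zero] at this
    exact this.symm
  have e2 : ⟪gradS n (meanCurv n) x, w⟫
      = -∑ i, ⟪fderiv ℝ (fun y => gradC n n y (eb i)) x (tangProj (n x) w), eb i⟫ := by
    have hdi : ∀ i : Fin 3, DifferentiableAt ℝ (fun y => ⟪gradC n n y (eb i), eb i⟫) x :=
      fun i => (hbw _).inner ℝ (differentiableAt_const _)
    rw [inner_gradS, h.fderiv_congr (F₂ := fun y => -∑ i, ⟪gradC n n y (eb i), eb i⟫) hx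
      hns.meanCurv.differentiableAt (DifferentiableAt.fun_sum fun i _ => hdi i).neg
      (fun y hy => by rw [h.meanCurv_eq hy, tr_eq_sum]) (inner_tangProj_self hn w),
      fderiv_fun_neg, fderiv_fun_sum fun i _ => hdi i]
    simp only [neg_apply, sum_apply]
    congr 1
    refine Finset.sum_congr rfl fun i _ => ?_
    rw [fderiv_inner_apply ℝ (hbw _) (differentiableAt_const _)]; simp
  rw [e1, e2, h.frobSq_shapeOp hx, ← hbdef, tr_eq_sum]
  -- Symmetry of the second derivative of n matches the leading terms of the divergence of ∇n and of
  -- the gradient of its trace.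
  simp only [h.fderiv_gradC_normal_apply hx, ← hbP, hNb, inner_sub_left, inner_smul_left,
    Finset.sum_sub_distrib, RCLike.conj_to_real, ContinuousLinearMap.comp_apply,
    hsym.eq (tangProj (n x) w)]
  -- The extension-dependent contributions s1 and s2 coincide and cancel between the two sides; s3
  -- vanishes because ∇n has tangential values. The remaining ⟨n, w⟩ tr((∇n)²) is the ‖B‖² term.
  have s1 : ∑ i, ⟪b (eb i), w⟫ * ⟪fderiv ℝ n x (n x), eb i⟫ = ⟪b w, fderiv ℝ n x (n x)⟫ := by
    rw [← sum_inner_eb_mul]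
    exact Finset.sum_congr rfl fun i _ => by
      rw [h.gradC_normal_symm hx, real_inner_comm]
  have s2 : ∑ i, ⟪b w, eb i⟫ * ⟪fderiv ℝ n x (n x), eb i⟫ = ⟪b w, fderiv ℝ n x (n x)⟫ :=
    sum_inner_eb_mul _ _
  have s3 : ∑ i, ⟪n x, eb i⟫ * ⟪b (b w), eb i⟫ = 0 := by
    rw [sum_inner_eb_mul]; exact h.gradC_normal_orthogonal hx _
  rw [s1, s2, s3, ← Finset.mul_sum]
  ring

/-- The tangential Hessian is symmetric. -/
theorem fderiv_gradS_symm {φ : E3 → ℝ} (hφ : ContDiffAt ℝ ∞ φ x) {v w : E3} (hv : ⟪n x, v⟫ = 0)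
    (hw : ⟪n x, w⟫ = 0) :
    ⟪fderiv ℝ (gradS n φ) x v, w⟫ = ⟪fderiv ℝ (gradS n φ) x w, v⟫ := by
  have hd := h.differentiableAt hx
  have hg : DifferentiableAt ℝ (gradS n φ) x :=
    (((h.smooth x hx).smoothAt 0).gradS (hφ.smoothAt 0)).differentiableAt
  have h2 : DifferentiableAt ℝ (fderiv ℝ φ) x :=
    (hφ.fderiv_right (m := 1) (by norm_cast)).differentiableAt (by simp)
  have hsym := (hφ.isSymmSndFDerivAt
      (by rw [minSmoothness_of_isRCLikeNormedField]; norm_cast))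
  -- The tangential Hessian is the ambient Hessian corrected by the second fundamental form times
  -- the normal derivative of φ, and each part is symmetric.
  have key : ∀ a c : E3, ⟪n x, c⟫ = 0 → ⟪fderiv ℝ (gradS n φ) x a, c⟫ =
      fderiv ℝ (fderiv ℝ φ) x a c - ⟪fderiv ℝ n x a, c⟫ * fderiv ℝ φ x (n x) := by
    intro a c hc
    have hi : DifferentiableAt ℝ (fun y => ⟪n y, c⟫) x := hd.inner ℝ (differentiableAt_const c)
    have hs : DifferentiableAt ℝ (fun y => ⟪n y, c⟫ • n y) x := hi.smul hd
    have hp : DifferentiableAt ℝ (fun y => c - ⟪n y, c⟫ • n y) x :=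
      (differentiableAt_const c).sub hs
    have e1 : (fun y => ⟪gradS n φ y, c⟫) = fun y => fderiv ℝ φ y (c - ⟪n y, c⟫ • n y) := by
      funext y; rw [inner_gradS, tangProj_apply]
    have e2 : fderiv ℝ (fun y => ⟪gradS n φ y, c⟫) x a = ⟪fderiv ℝ (gradS n φ) x a, c⟫ := by
      rw [fderiv_inner_apply ℝ hg (differentiableAt_const c)]; simp
    have e3 : fderiv ℝ (fun y => ⟪n y, c⟫) x a = ⟪fderiv ℝ n x a, c⟫ := by
      rw [fderiv_inner_apply ℝ hd (differentiableAt_const c)]; simp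
    rw [← e2, e1, fderiv_clm_apply h2 hp,
      fderiv_fun_sub (differentiableAt_const c) hs, fderiv_fun_smul hi hd]
    simp [e3, hc]
    ring
  rw [key v w hw, key w v hv, hsym.eq, h.fderiv_normal_symm hx hv hw]

end IsClosedSurface

/-! ### Evolution of the surface gradient and of the mean curvature -/

namespace IsMaterialFlow

variable {M : Type*} [TopologicalSpace M] [T2Space M] [CompactSpace M]
  [ChartedSpace (EuclideanSpace ℝ (Fin 2)) M] [IsManifold (𝓡 2) ∞ M]
  {I : Set ℝ} {Y : ℝ → M → E3} {n u : ℝ → E3 → E3} (h : IsMaterialFlow I Y n u)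
include h

/-- Commuting the material derivative with ∇ costs a ∇u term, and the motion of n enters through
‖P∇φ‖² = ‖∇φ‖² - ⟨n, ∇φ⟩². -/
theorem hasDerivAt_norm_gradS_sq {φ : ℝ → E3 → ℝ} {t : ℝ} (ht : t ∈ I) (y : M)
    (hφ : SmoothAt φ t (Y t y)) :
    HasDerivAt (fun s => ‖gradS (n s) (φ s) (Y s y)‖ ^ 2)
      (2 * (⟪gradS (n t) (matD u φ t) (Y t y), gradS (n t) (φ t) (Y t y)⟫
        - ⟪gradS (n t) (φ t) (Y t y), fderiv ℝ (u t) (Y t y) (gradS (n t) (φ t) (Y t y))⟫)) t := by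
  have hx : Y t y ∈ range (Y t) := ⟨y, rfl⟩
  have hv := h.velocity t ht y
  have hns := h.smooth_n t ht _ hx
  have hus := h.smooth_u t ht _ hx
  have hS := h.surface t ht
  have hn1 := hS.norm_eq_one _ hx
  have hGs : SmoothAt (fun s => gradient (φ s)) t (Y t y) :=
    ContDiffAt.continuousLinearMap_comp (LinearMap.toContinuousLinearMap rieszLin) hφ.fderiv
  have hG := hasDerivAt_matD hv hGs
  have hn := hasDerivAt_matD hv hns
  have hN := hasDerivAt_matD hv hφ.fderiv
  have hDG : ∀ v, ⟪matD u (fun s => gradient (φ s)) t (Y t y), v⟫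
      = fderiv ℝ (matD u φ t) (Y t y) v
        - ⟪gradient (φ t) (Y t y), fderiv ℝ (u t) (Y t y) v⟫ := fun v => by
    rw [inner_gradient, ← matD_fderiv hφ hus]
    have h1 := hG.inner ℝ (hasDerivAt_const t v)
    have h2 := hN.clm_apply (hasDerivAt_const t v)
    simp only [inner_gradient] at h1
    have := h1.unique h2
    simpa using this
  have hd := (hG.inner ℝ hG).sub ((hn.inner ℝ hG).mul (hn.inner ℝ hG))
  have hev : (fun s => ‖gradS (n s) (φ s) (Y s y)‖ ^ 2) =ᶠ[𝓝 t] fun s =>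
      ⟪gradient (φ s) (Y s y), gradient (φ s) (Y s y)⟫
        - ⟪n s (Y s y), gradient (φ s) (Y s y)⟫ * ⟪n s (Y s y), gradient (φ s) (Y s y)⟫ :=
    eventually_of_mem (h.isOpen.mem_nhds ht) fun s hs => by
      have h1 := (h.surface s hs).norm_eq_one _ ⟨y, rfl⟩
      show ‖gradS (n s) (φ s) (Y s y)‖ ^ 2 = _
      rw [← real_inner_self_eq_norm_sq, gradS, inner_tangProj_comm, tangProj_idem h1,
        tangProj_apply, inner_sub_right, inner_smul_right,
        real_inner_comm (n s (Y s y)) (gradient (φ s) (Y s y))]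
  refine (hd.congr_of_eventuallyEq hev).congr_deriv ?_
  set x := Y t y
  set G := gradient (φ t) x with hGdef
  set q := gradS (n t) (φ t) x with hq
  have hqG : q = G - ⟪n t x, G⟫ • n t x := by rw [hq, gradS, tangProj_apply]
  -- The ambient gradient is split into its surface part q and its normal part. The normal part
  -- depends on the extension and drops out through the evolution of n.
  have hGq : G = q + ⟪n t x, G⟫ • n t x := by rw [hqG]; abel
  have hnq : ⟪n t x, q⟫ = 0 := inner_normal_gradS hn1 _
  have e1 : ⟪matD u n t x, G⟫ = -⟪n t x, fderiv ℝ (u t) x q⟫ := by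
    conv_lhs => rw [hGq]
    rw [inner_add_right, inner_smul_right, real_inner_comm (n t x) (matD u n t x),
      h.inner_matD_normal_self ht hx, h.inner_matD_normal ht hx hnq]
    ring
  have e2 := hDG q
  rw [inner_gradS_of_tangential hnq, real_inner_comm (matD u (fun s => gradient (φ s)) t x) G,
    e1]
  have e3 : ⟪matD u (fun s => gradient (φ s)) t x, G⟫
      = ⟪matD u (fun s => gradient (φ s)) t x, q⟫
        + ⟪n t x, G⟫ * ⟪n t x, matD u (fun s => gradient (φ s)) t x⟫ := by
    conv_lhs => rw [hGq]
    rw [inner_add_right, inner_smul_right, real_inner_comm (n t x)]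
  have e4 : ⟪q, fderiv ℝ (u t) x q⟫ = ⟪G, fderiv ℝ (u t) x q⟫
      - ⟪n t x, G⟫ * ⟪n t x, fderiv ℝ (u t) x q⟫ := by
    conv_lhs => rw [hqG]
    rw [inner_sub_left, real_inner_smul_left, ← hqG]
  rw [e4, e3, e2]
  ring

/-- On the surface H = -(tr ∇n - ⟨n, ∇n n⟩). Its rate follows from the commutator of the material
derivative with ∇ and from the evolution of n. -/
theorem matD_meanCurv {t : ℝ} (ht : t ∈ I) {x : E3} (hx : x ∈ range (Y t)) :
    matD u (fun s => meanCurv (n s)) t x = -divP (n t) (matD u n t) x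
      + tr ((gradC (n t) (n t) x).comp ((fderiv ℝ (u t) x).comp (tangProj (n t x)))) := by
  obtain ⟨y, rfl⟩ := hx
  have hx : Y t y ∈ range (Y t) := ⟨y, rfl⟩
  have hv := h.velocity t ht y
  have hns := h.smooth_n t ht _ hx
  have hus := h.smooth_u t ht _ hx
  have hS := h.surface t ht
  have hn1 := hS.norm_eq_one _ hx
  have hn := hasDerivAt_matD hv hns
  have hN := hasDerivAt_matD hv hns.fderiv
  have hH := hasDerivAt_matD hv hns.meanCurv
  have htr : HasDerivAt (fun s => tr (fderiv ℝ (n s) (Y s y)))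
      (tr (matD u (fun s => fderiv ℝ (n s)) t (Y t y))) t := by
    simp only [tr_eq_sum]
    refine HasDerivAt.fun_sum fun i _ => ?_
    have := (hN.clm_apply (hasDerivAt_const t (eb i))).inner ℝ (hasDerivAt_const t (eb i))
    simpa using this
  have hd := (htr.sub (hn.inner ℝ (hN.clm_apply hn))).neg
  have hev : (fun s => meanCurv (n s) (Y s y)) =ᶠ[𝓝 t] fun s =>
      -(tr (fderiv ℝ (n s) (Y s y)) - ⟪n s (Y s y), fderiv ℝ (n s) (Y s y) (n s (Y s y))⟫) :=
    eventually_of_mem (h.isOpen.mem_nhds ht) fun s hs => by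
      show meanCurv (n s) (Y s y) = _
      rw [(h.surface s hs).meanCurv_eq ⟨y, rfl⟩, gradC, tr_comp_tangProj]
  have e0 := hH.unique (hd.congr_of_eventuallyEq hev)
  set x := Y t y
  set N := fderiv ℝ (n t) x with hNdef
  set DN := matD u (fun s => fderiv ℝ (n s)) t x
  set P := tangProj (n t x) with hP
  set L := fderiv ℝ (u t) x with hL
  have hDn0 := h.inner_matD_normal_self ht hx
  have e1 : ⟪n t x, N (matD u n t x)⟫ = 0 := hS.inner_fderiv_normal hx hDn0
  have e2 : DN.comp P = (fderiv ℝ (matD u n t) x).comp P - N.comp (L.comp P) := by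
    ext1 v; exact matD_fderiv hns hus (P v)
  have e3 : tr DN - ⟪n t x, DN (n t x)⟫
      = divP (n t) (matD u n t) x - tr (N.comp (L.comp P)) := by
    rw [← tr_comp_tangProj, ← hP, e2, tr_sub, divP_eq_of_unit hn1]
  -- Replacing ∇n by its tangential version leaves the normal part of ∇u P paired with ∇n n. The
  -- evolution of the normal makes this exactly ⟨Dn, ∇n n⟩, which the product rule contributed.
  have e4 : tr (N.comp (L.comp P)) = tr ((gradC (n t) (n t) x).comp (L.comp P))
      - ⟪matD u n t x, N (n t x)⟫ := by
    have : ⟪matD u n t x, N (n t x)⟫ = -∑ i, ⟪n t x, L (P (eb i))⟫ * ⟪N (n t x), eb i⟫ := by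
      rw [← sum_inner_eb_mul, ← Finset.sum_neg_distrib]
      refine Finset.sum_congr rfl fun i _ => ?_
      have h1 := h.inner_matD_normal ht hx (inner_tangProj_self hn1 (eb i))
      rw [← inner_tangProj_comm, tangProj_eq_of_orthogonal hDn0] at h1
      rw [h1]; ring
    rw [this, tr_eq_sum, tr_eq_sum, sub_neg_eq_add, ← Finset.sum_add_distrib]
    refine Finset.sum_congr rfl fun i _ => ?_
    simp only [ContinuousLinearMap.comp_apply, gradC, tangProj_apply (n t x) (L (P (eb i))),
      map_sub, map_smul, inner_sub_left, real_inner_smul_left, ← hNdef]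
    ring
  rw [e0, inner_add_right, e1]
  linarith [e3, e4]

end IsMaterialFlow

/-! ### Divergence identities on a closed surface -/

theorem rateOfDef_symm (n u : E3 → E3) (x v w : E3) :
    ⟪rateOfDef n u x v, w⟫ = ⟪v, rateOfDef n u x w⟫ := by
  simp only [rateOfDef, smul_apply, add_apply, real_inner_smul_left,
    inner_smul_right, inner_add_left, inner_add_right, ContinuousLinearMap.adjoint_inner_left,
    ContinuousLinearMap.adjoint_inner_right]
  ring

theorem inner_normal_gradP {n : E3 → E3} {x : E3} (hn : ‖n x‖ = 1) (u : E3 → E3) (v : E3) :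
    ⟪n x, gradP n u x v⟫ = 0 :=
  inner_tangProj_self hn _

theorem gradP_normal {n : E3 → E3} {x : E3} (hn : ‖n x‖ = 1) (u : E3 → E3) :
    gradP n u x (n x) = 0 := by
  simp [gradP, gradC, tangProj_self hn]

theorem inner_normal_rateOfDef {n : E3 → E3} {x : E3} (hn : ‖n x‖ = 1) (u : E3 → E3) (v : E3) :
    ⟪n x, rateOfDef n u x v⟫ = 0 := by
  simp [rateOfDef, inner_smul_right, inner_add_right, inner_normal_gradP hn,
    ContinuousLinearMap.adjoint_inner_right, gradP_normal hn]

theorem rateOfDef_comp_tangProj {n : E3 → E3} {x : E3} (hn : ‖n x‖ = 1) (u : E3 → E3) :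
    (rateOfDef n u x).comp (tangProj (n x)) = rateOfDef n u x := by
  ext1 v
  refine ext_inner_right ℝ fun w => ?_
  rw [ContinuousLinearMap.comp_apply, rateOfDef_symm, inner_tangProj_comm,
    tangProj_eq_of_orthogonal (inner_normal_rateOfDef hn u w), rateOfDef_symm]

/-- A symmetric tangential tensor contracts ∇u only through the symmetric part of its tangential
projection, which is the rate of deformation itself. This makes viscous power equal to dissipation.
-/
theorem tr_rateOfDef_comp {n : E3 → E3} {x : E3} (hn : ‖n x‖ = 1) (u : E3 → E3) :
    tr ((rateOfDef n u x).comp ((fderiv ℝ u x).comp (tangProj (n x))))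
      = frobSq (rateOfDef n u x) := by
  set S := rateOfDef n u x with hS
  have hSa : ContinuousLinearMap.adjoint S = S := by
    refine ((ContinuousLinearMap.eq_adjoint_iff S S).2 fun v w => ?_).symm
    exact rateOfDef_symm n u x v w
  have e1 : S.comp ((fderiv ℝ u x).comp (tangProj (n x))) = S.comp (gradP n u x) := by
    conv_lhs => rw [hS, ← rateOfDef_comp_tangProj hn u]
    rfl
  have e2 : tr (S.comp (ContinuousLinearMap.adjoint (gradP n u x))) = tr (S.comp (gradP n u x)) := by
    rw [← tr_adjoint, ContinuousLinearMap.adjoint_comp, ContinuousLinearMap.adjoint_adjoint, hSa,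
      tr_comp_comm]
  have e3 : S.comp S = (1 / 2 : ℝ) • (S.comp (gradP n u x)
      + S.comp (ContinuousLinearMap.adjoint (gradP n u x))) := by
    ext1 v
    simp [hS, rateOfDef]
  rw [frobSq_eq_tr, hSa, e1, e3, tr_smul, tr_add, e2]
  ring

theorem divergence_smul_gradS {n : E3 → E3} {x : E3} (hn : ‖n x‖ = 1) {f g : E3 → ℝ}
    (hf : DifferentiableAt ℝ f x) (hg : DifferentiableAt ℝ (gradS n g) x) :
    divergence n (fun y => f y • gradS n g y) x
      = f x * lapS n g x + ⟪gradS n f x, gradS n g x⟫ := by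
  rw [divergence_smul hn hf hg, divergence_of_tangential, lapS]
  rw [real_inner_comm]; exact inner_normal_gradS hn g

theorem divergence_smul_of_divP_eq_zero {n : E3 → E3} {x : E3} (hn : ‖n x‖ = 1) {f : E3 → ℝ}
    {u : E3 → E3} (hf : DifferentiableAt ℝ f x) (hu : DifferentiableAt ℝ u x)
    (hdiv : divP n u x = 0) :
    divergence n (fun y => f y • u y) x
      = f x * (meanCurv n x * ⟪u x, n x⟫) + ⟪gradS n f x, u x⟫ := by
  rw [divergence_smul hn hf hu, divergence, hdiv, zero_add]

namespace IsClosedSurface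

variable {Γ : Set E3} {n : E3 → E3} (h : IsClosedSurface Γ n) {x : E3} (hx : x ∈ Γ)
include h hx

theorem divergence_rateOfDef {u : E3 → E3} (hu : ContDiffAt ℝ ∞ u x) :
    divergence n (fun y => rateOfDef n u y (u y)) x
      = ⟪u x, divC n (rateOfDef n u) x⟫ + frobSq (rateOfDef n u x) := by
  have hn := h.norm_eq_one x hx
  have hS : DifferentiableAt ℝ (rateOfDef n u) x :=
    (((h.smooth x hx).smoothAt 0).rateOfDef (hu.smoothAt 0)).differentiableAt
  rw [divergence_of_tangential, h.divP_clm_apply hx hS (hu.differentiableAt (by simp))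
    (fun y _ => rateOfDef_symm n u y), tr_rateOfDef_comp hn]
  rw [real_inner_comm]; exact inner_normal_rateOfDef hn u _

/-- The Korteweg stress as a force. -/
theorem inner_gradS_fderiv {φ : E3 → ℝ} {u : E3 → E3} (hφ : ContDiffAt ℝ ∞ φ x)
    (hu : DifferentiableAt ℝ u x) :
    ⟪gradS n φ x, fderiv ℝ u x (gradS n φ x)⟫
      = divergence n (fun y => ⟪gradS n φ y, u y⟫ • gradS n φ y) x
        - ⟪gradS n φ x, u x⟫ * lapS n φ x
        - 1 / 2 * ⟪gradS n (fun y => ‖gradS n φ y‖ ^ 2) x, u x⟫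
        - ⟪gradS n φ x, shapeOp n x (gradS n φ x)⟫ * ⟪u x, n x⟫ := by
  have hn := h.norm_eq_one x hx
  have hd := h.differentiableAt hx
  have hg : DifferentiableAt ℝ (gradS n φ) x :=
    (((h.smooth x hx).smoothAt 0).gradS (hφ.smoothAt 0)).differentiableAt
  set q := gradS n φ x with hq
  have hnq : ⟪n x, q⟫ = 0 := inner_normal_gradS hn φ
  have hPu := inner_tangProj_self hn (u x)
  have e1 : ⟪gradS n (fun y => ⟪gradS n φ y, u y⟫) x, q⟫
      = ⟪q, fderiv ℝ u x q⟫ + ⟪fderiv ℝ (gradS n φ) x q, u x⟫ := by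
    rw [inner_gradS_of_tangential hnq, fderiv_inner_apply ℝ hg hu]
  -- The gradient of ‖∇φ‖² becomes the derivative of ∇φ along itself by symmetry of the tangential
  -- Hessian.
  have e2 : ⟪gradS n (fun y => ‖gradS n φ y‖ ^ 2) x, u x⟫
      = 2 * ⟪fderiv ℝ (gradS n φ) x q, tangProj (n x) (u x)⟫ := by
    rw [inner_gradS, h.fderiv_gradS_symm hx hφ hnq hPu]
    have : (fun y => ‖gradS n φ y‖ ^ 2) = fun y => ⟪gradS n φ y, gradS n φ y⟫ := by
      funext y; rw [real_inner_self_eq_norm_sq]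
    rw [this, fderiv_inner_apply ℝ hg hg, real_inner_comm q]
    ring
  -- Differentiating ⟨n, ∇φ⟩ = 0 along q turns the normal component of this derivative into a
  -- curvature term.
  have e3 : ⟪n x, fderiv ℝ (gradS n φ) x q⟫ = ⟪q, shapeOp n x q⟫ := by
    have := h.fderiv_eq_zero (F := fun y => ⟪n y, gradS n φ y⟫) hx (hd.inner ℝ hg)
      (fun y hy => inner_normal_gradS (h.norm_eq_one y hy) φ) hnq
    rw [fderiv_inner_apply ℝ hd hg] at this
    rw [h.shapeOp_eq hx, neg_apply, inner_neg_right, gradC, ContinuousLinearMap.comp_apply,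
      tangProj_eq_of_orthogonal hnq, real_inner_comm (fderiv ℝ n x q) q]
    linarith
  have e4 : ⟪fderiv ℝ (gradS n φ) x q, u x⟫
      = ⟪fderiv ℝ (gradS n φ) x q, tangProj (n x) (u x)⟫
        + ⟪u x, n x⟫ * ⟪n x, fderiv ℝ (gradS n φ) x q⟫ := by
    rw [tangProj_apply, inner_sub_right, inner_smul_right, real_inner_comm (n x) (u x),
      real_inner_comm (n x) (fderiv ℝ (gradS n φ) x q)]
    ring
  rw [divergence_smul_gradS hn (hg.inner ℝ hu) hg, e1, e2, e4, e3]
  ring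

/-- First variation of the bending energy in divergence form; `d` is the rate of change of the
unit normal. -/
theorem bending_variation {u d : E3 → E3} {k : E3 → ℝ} (hu : DifferentiableAt ℝ u x)
    (hd : DifferentiableAt ℝ d x) (hk : ContDiffAt ℝ ∞ k x) (hd0 : ⟪n x, d x⟫ = 0)
    (hdu : ∀ w, ⟪n x, w⟫ = 0 → ⟪d x, w⟫ = -⟪n x, fderiv ℝ u x w⟫) :
    k x * (-divP n d x + tr ((gradC n n x).comp ((fderiv ℝ u x).comp (tangProj (n x)))))
      = -divergence n (fun y => k y • d y) x
        + divergence n (fun y => k y • gradC n n y (u y)) x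
        - divergence n (fun y => ⟪u y, n y⟫ • gradS n k y) x
        + ⟪u x, n x⟫ * lapS n k x + k x * ⟪gradS n (meanCurv n) x, u x⟫
        + k x * frobSq (shapeOp n x) * ⟪u x, n x⟫ := by
  have hn := h.norm_eq_one x hx
  have hnd := h.differentiableAt hx
  have hns := (h.smooth x hx).smoothAt 0
  have hb : DifferentiableAt ℝ (gradC n n) x := (hns.gradC hns).differentiableAt
  have hgk : DifferentiableAt ℝ (gradS n k) x := (hns.gradS (hk.smoothAt 0)).differentiableAt
  have hkd : DifferentiableAt ℝ k x := hk.differentiableAt (by simp)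
  have hnk : ⟪n x, gradS n k x⟫ = 0 := inner_normal_gradS hn k
  -- The gradient of the normal velocity links the rate of the normal with ∇n u, which is why the
  -- three divergences combine.
  have e1 : ⟪gradS n (fun y => ⟪u y, n y⟫) x, gradS n k x⟫
      = -⟪d x, gradS n k x⟫ + ⟪gradS n k x, gradC n n x (u x)⟫ := by
    rw [inner_gradS_of_tangential hnk, fderiv_inner_apply ℝ hu hnd, hdu _ hnk,
      ← h.gradC_normal_symm hx, gradC, ContinuousLinearMap.comp_apply,
      tangProj_eq_of_orthogonal hnk, real_inner_comm (n x), real_inner_comm (u x)]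
    ring
  rw [divergence_smul hn hkd hd, divergence_of_tangential (by rwa [real_inner_comm]),
    divergence_smul hn hkd (hb.clm_apply hu), divergence_smul_gradS hn (hu.inner ℝ hnd) hgk, e1,
    divergence_of_tangential (by rw [real_inner_comm]; exact h.gradC_normal_orthogonal hx _),
    h.divP_clm_apply hx hb hu (fun y hy => h.gradC_normal_symm hy),
    h.inner_divC_gradC_normal hx, real_inner_comm (d x), real_inner_comm (n x) (u x)]
  ring

end IsClosedSurface

/-! ### Exact integrands and the `H⁻¹` seminorm -/

/-- `f` is on `Γ` the integrand of the divergence theorem for a smooth vector field. -/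
def IsDivergence (Γ : Set E3) (n : E3 → E3) (f : E3 → ℝ) : Prop :=
  ∃ W : E3 → E3, (∀ x ∈ Γ, ContDiffAt ℝ ∞ W x) ∧ ∀ x ∈ Γ, f x = divergence n W x

namespace IsClosedSurface

variable {Γ : Set E3} {n : E3 → E3} (h : IsClosedSurface Γ n)
include h

theorem surfInt_eq_zero {f : E3 → ℝ} (hf : IsDivergence Γ n f) : surfInt Γ f = 0 := by
  obtain ⟨W, hW, hfW⟩ := hf
  rw [h.surfInt_congr hfW, h.surfInt_divergence hW]

theorem isDivergence_add {f g : E3 → ℝ} (hf : IsDivergence Γ n f) (hg : IsDivergence Γ n g) :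
    IsDivergence Γ n (fun x => f x + g x) := by
  obtain ⟨V, hV, hfV⟩ := hf
  obtain ⟨W, hW, hgW⟩ := hg
  refine ⟨fun y => V y + W y, fun x hx => (hV x hx).add (hW x hx), fun x hx => ?_⟩
  show f x + g x = _
  rw [hfV x hx, hgW x hx, divergence_add (h.norm_eq_one x hx)
    ((hV x hx).differentiableAt (by simp)) ((hW x hx).differentiableAt (by simp))]

theorem isDivergence_const_mul {f : E3 → ℝ} (hf : IsDivergence Γ n f) (a : ℝ) :
    IsDivergence Γ n (fun x => a * f x) := by
  obtain ⟨V, hV, hfV⟩ := hf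
  refine ⟨fun y => a • V y, fun x hx => (hV x hx).const_smul a, fun x hx => ?_⟩
  show a * f x = _
  rw [hfV x hx, divergence_smul (f := fun _ => a) (h.norm_eq_one x hx) (differentiableAt_const a)
    ((hV x hx).differentiableAt (by simp)), inner_gradS]
  simp

theorem isDivergence_sub {f g : E3 → ℝ} (hf : IsDivergence Γ n f) (hg : IsDivergence Γ n g) :
    IsDivergence Γ n (fun x => f x - g x) := by
  have := h.isDivergence_add hf (h.isDivergence_const_mul hg (-1))
  simpa only [neg_mul, one_mul, ← sub_eq_add_neg] using this

/-- Green's formula. -/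
theorem isDivergence_green {f g : E3 → ℝ} (hf : ∀ x ∈ Γ, ContDiffAt ℝ ∞ f x)
    (hg : ∀ x ∈ Γ, ContDiffAt ℝ ∞ g x) :
    IsDivergence Γ n (fun x => f x * lapS n g x + ⟪gradS n f x, gradS n g x⟫) := by
  have hgs : ∀ x ∈ Γ, ContDiffAt ℝ ∞ (gradS n g) x := fun x hx =>
    (((h.smooth x hx).smoothAt 0).gradS ((hg x hx).smoothAt 0)).contDiffAt
  exact ⟨fun y => f y • gradS n g y, fun x hx => (hf x hx).smul (hgs x hx), fun x hx =>
    (divergence_smul_gradS (h.norm_eq_one x hx) ((hf x hx).differentiableAt (by simp))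
      ((hgs x hx).differentiableAt (by simp))).symm⟩

theorem continuousOn_norm_gradS_sq {f : E3 → ℝ} (hf : ∀ x ∈ Γ, ContDiffAt ℝ ∞ f x) :
    ContinuousOn (fun x => ‖gradS n f x‖ ^ 2) Γ := fun x hx =>
  (((h.smooth x hx).smoothAt 0).gradS
    ((hf x hx).smoothAt 0)).norm_sq.differentiableAt.continuousAt.continuousWithinAt

theorem surfInt_sub {F G : E3 → ℝ} (hF : ContinuousOn F Γ) (hG : ContinuousOn G Γ) :
    surfInt Γ (fun x => F x - G x) = surfInt Γ F - surfInt Γ G :=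
  integral_sub (h.integrableOn hF) (h.integrableOn hG)

/-- The `H⁻¹` seminorm is the Dirichlet energy of any potential. -/
theorem hMinusOneSq_eq {f ψ : E3 → ℝ} (hψ : ∀ x ∈ Γ, ContDiffAt ℝ ∞ ψ x)
    (hf : ∀ x ∈ Γ, lapS n ψ x = f x) :
    hMinusOneSq Γ n f = surfInt Γ fun x => ‖gradS n ψ x‖ ^ 2 := by
  have key : {a | ∃ ψ : E3 → ℝ, (∀ x ∈ Γ, ContDiffAt ℝ ∞ ψ x) ∧ (∀ x ∈ Γ, lapS n ψ x = f x) ∧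
      a = surfInt Γ fun x => ‖gradS n ψ x‖ ^ 2} = {surfInt Γ fun x => ‖gradS n ψ x‖ ^ 2} := by
    ext a
    refine ⟨?_, fun ha => ⟨ψ, hψ, hf, ha⟩⟩
    rintro ⟨χ, hχ, hχf, rfl⟩
    -- With Δχ = Δψ = f, these four Green formulas leave ‖∇χ‖² - ‖∇ψ‖²: the products of f with the
    -- potentials and the mixed gradients cancel.
    have h1 := h.isDivergence_add
      (h.isDivergence_sub (h.isDivergence_green hχ hχ) (h.isDivergence_green hψ hψ))
      (h.isDivergence_sub (h.isDivergence_green hψ hχ) (h.isDivergence_green hχ hψ))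
    rw [mem_singleton_iff, ← sub_eq_zero, ← h.surfInt_sub (h.continuousOn_norm_gradS_sq hχ)
      (h.continuousOn_norm_gradS_sq hψ), ← h.surfInt_eq_zero h1]
    refine h.surfInt_congr fun x hx => ?_
    simp only [real_inner_self_eq_norm_sq, hf x hx, hχf x hx,
      real_inner_comm (gradS n χ x) (gradS n ψ x)]
    ring
  rw [hMinusOneSq, key, csInf_singleton]

end IsClosedSurface

theorem gradS_const_mul (n : E3 → E3) (a : ℝ) (f : E3 → ℝ) :
    gradS n (fun y => a * f y) = fun y => a • gradS n f y := by
  funext x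
  refine ext_inner_right ℝ fun w => ?_
  have : fderiv ℝ (fun y => a * f y) x = a • fderiv ℝ f x :=
    congrFun (fderiv_const_smul_field (R := ℝ) (f := f) a) x
  rw [real_inner_smul_left, inner_gradS, inner_gradS, this]; rfl

theorem lapS_const_mul {n : E3 → E3} {x : E3} (hn : ‖n x‖ = 1) {f : E3 → ℝ}
    (hf : DifferentiableAt ℝ (gradS n f) x) (a : ℝ) :
    lapS n (fun y => a * f y) x = a * lapS n f x := by
  rw [lapS, gradS_const_mul, divP_smul (f := fun _ => a) hn (differentiableAt_const a) hf,
    inner_gradS]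
  simp [lapS]

/-! ### Smooth solutions -/

section Observer

variable {M : Type*} [TopologicalSpace M] [T2Space M] [CompactSpace M]
  [ChartedSpace (EuclideanSpace ℝ (Fin 2)) M] [IsManifold (𝓡 2) ∞ M]
  {c : Params} {I : Set ℝ} {Xm X : ℝ → M → E3} {n u : ℝ → E3 → E3} {p φ μ : ℝ → E3 → ℝ}

theorem Params.IsSmoothSolution.isMaterialFlow (hI : IsOpen I)
    (h : c.IsSmoothSolution I Xm X n u p φ μ) : IsMaterialFlow I Xm n u where
  isOpen := hI
  param := h.material
  surface t ht := by
    rw [h.same_surface t ht]; exact h.normal.isClosedSurface hI h.observer ht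
  smooth_n t ht x hx := h.normal.smooth t ht x ((h.same_surface t ht).le hx)
  smooth_u t ht x hx := h.smooth_u t ht x ((h.same_surface t ht).le hx)
  velocity t ht y := by rw [h.velocity t ht y]; exact h.material.hasDerivAt hI ht y
  inextensible t ht x hx := h.inextensible t ht x (by rwa [← h.same_surface t ht])

omit [T2Space M] [CompactSpace M] in
/-- The material derivative does not depend on the observer. -/
theorem Params.IsSmoothSolution.deriv_add_fderiv_relVel (hI : IsOpen I)
    (h : c.IsSmoothSolution I Xm X n u p φ μ) {G : Type*} [NormedAddCommGroup G]
    [NormedSpace ℝ G] {F : ℝ → E3 → G} {t : ℝ} (ht : t ∈ I) (y : M) (hF : SmoothAt F t (X t y)) :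
    deriv (fun s => F s (X s y)) t
      + fderiv ℝ (F t) (X t y) (tangProj (n t (X t y)) (relVel X u t y)) = matD u F t (X t y) := by
  -- Equal normal velocities make the relative velocity tangential, so the projection in the
  -- observer's derivative is harmless and ∂ₜX + V = u.
  have h0 : ⟪n t (X t y), relVel X u t y⟫ = 0 := by
    rw [relVel, inner_sub_right, real_inner_comm, ← h.normal_velocity t ht y, real_inner_comm,
      sub_self]
  rw [(hasDerivAt_along (h.observer.hasDerivAt hI ht y) hF).deriv, tangProj_eq_of_orthogonal h0,
    fderiv_eq_uncurry hF, ← map_add, matD, relVel]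
  simp

omit [T2Space M] [CompactSpace M] in
theorem Params.IsSmoothSolution.matDeriv_eq (hI : IsOpen I)
    (h : c.IsSmoothSolution I Xm X n u p φ μ) {t : ℝ} (ht : t ∈ I) (y : M) :
    matDeriv X n u φ t y = matD u φ t (X t y) := by
  rw [matDeriv, inner_gradS]
  exact h.deriv_add_fderiv_relVel hI ht y (h.smooth_φ t ht _ ⟨y, rfl⟩)

omit [T2Space M] [CompactSpace M] in
theorem Params.IsSmoothSolution.matAccel_eq (hI : IsOpen I)
    (h : c.IsSmoothSolution I Xm X n u p φ μ) {t : ℝ} (ht : t ∈ I) (y : M) :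
    matAccel X n u t y = matD u u t (X t y) :=
  h.deriv_add_fderiv_relVel hI ht y (h.smooth_u t ht _ ⟨y, rfl⟩)

end Observer

/-! ### The energy identity -/

theorem contDiff_doubleWell : ContDiff ℝ ∞ doubleWell := by
  unfold doubleWell; fun_prop

namespace Params

variable (c : Params)

/-- Density of the potential energy. -/
def potentialDensity (n : E3 → E3) (φ : E3 → ℝ) (x : E3) : ℝ :=
  1 / 2 * c.κ (φ x) * (meanCurv n x - c.H₀ (φ x)) ^ 2 + c.glDensity n φ x

/-- Density of the total energy. -/
def energyDensity (n u : E3 → E3) (φ : E3 → ℝ) (x : E3) : ℝ :=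
  c.ρ / 2 * ‖u x‖ ^ 2 + c.potentialDensity n φ x

/-- Density of twice the dissipation potential. -/
def dissipationDensity (n u : E3 → E3) (μ : E3 → ℝ) (x : E3) : ℝ :=
  2 * c.η * frobSq (rateOfDef n u x) + c.γ * ‖u x‖ ^ 2 + c.m * ‖gradS n μ x‖ ^ 2

/-- Derivative of the local terms of the energy density with respect to the phase field. -/
def localChemPot (n : E3 → E3) (φ : E3 → ℝ) (x : E3) : ℝ :=
  1 / 2 * deriv c.κ (φ x) * (meanCurv n x - c.H₀ (φ x)) ^ 2
    - c.κ (φ x) * deriv c.H₀ (φ x) * (meanCurv n x - c.H₀ (φ x))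
    + c.σ * (1 / c.ε * deriv doubleWell (φ x))

theorem chemPot_eq (n : E3 → E3) (φ : E3 → ℝ) (x : E3) :
    c.chemPot n φ x = c.localChemPot n φ x - c.σ * c.ε * lapS n φ x := by
  rw [chemPot, localChemPot]; ring

/-- Chain rule for the potential energy density along a curve. -/
theorem hasDerivAt_potentialDensity {n : ℝ → E3 → E3} {φ : ℝ → E3 → ℝ} {x : ℝ → E3} {t a b r : ℝ}
    (ha : HasDerivAt (fun s => φ s (x s)) a t)
    (hb : HasDerivAt (fun s => meanCurv (n s) (x s)) b t)
    (hr : HasDerivAt (fun s => ‖gradS (n s) (φ s) (x s)‖ ^ 2) (2 * r) t) :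
    HasDerivAt (fun s => c.potentialDensity (n s) (φ s) (x s))
      (c.localChemPot (n t) (φ t) (x t) * a + c.bendingMoment (n t) (φ t) (x t) * b
        + c.σ * c.ε * r) t := by
  have hκ : HasDerivAt (fun s => c.κ (φ s (x s))) (deriv c.κ (φ t (x t)) * a) t :=
    ((c.κ_smooth.differentiable (by simp)) _).hasDerivAt.comp t ha
  have hH : HasDerivAt (fun s => c.H₀ (φ s (x s))) (deriv c.H₀ (φ t (x t)) * a) t :=
    ((c.H₀_smooth.differentiable (by simp)) _).hasDerivAt.comp t ha
  have hW : HasDerivAt (fun s => doubleWell (φ s (x s))) (deriv doubleWell (φ t (x t)) * a) t :=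
    ((contDiff_doubleWell.differentiable (by simp)) _).hasDerivAt.comp t ha
  have := ((hκ.const_mul (1 / 2)).mul ((hb.sub hH).pow 2)).add
    (((hr.const_mul (c.ε / 2)).add (hW.const_mul (1 / c.ε))).const_mul c.σ)
  refine this.congr_deriv ?_
  simp only [localChemPot, bendingMoment, Pi.sub_apply, Pi.pow_apply]
  push_cast
  ring

theorem smoothAt_bendingMoment {n : ℝ → E3 → E3} {φ : ℝ → E3 → ℝ} {t : ℝ} {x : E3}
    (hn : SmoothAt n t x) (hφ : SmoothAt φ t x) :
    SmoothAt (fun s => c.bendingMoment (n s) (φ s)) t x :=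
  (hφ.comp_real c.κ_smooth).mul (hn.meanCurv.sub (hφ.comp_real c.H₀_smooth))

theorem smoothAt_potentialDensity {n : ℝ → E3 → E3} {φ : ℝ → E3 → ℝ} {t : ℝ} {x : E3}
    (hn : SmoothAt n t x) (hφ : SmoothAt φ t x) :
    SmoothAt (fun s => c.potentialDensity (n s) (φ s)) t x := by
  have hs : SmoothAt (fun s y => (meanCurv (n s) y - c.H₀ (φ s y)) ^ 2) t x := by
    simp only [pow_two]
    exact (hn.meanCurv.sub (hφ.comp_real c.H₀_smooth)).mul
      (hn.meanCurv.sub (hφ.comp_real c.H₀_smooth))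
  exact (((hφ.comp_real c.κ_smooth).const_mul (1 / 2)).mul hs).add
    ((((hn.gradS hφ).norm_sq.const_mul (c.ε / 2)).add
      ((hφ.comp_real contDiff_doubleWell).const_mul (1 / c.ε))).const_mul c.σ)

theorem smoothAt_energyDensity {n u : ℝ → E3 → E3} {φ : ℝ → E3 → ℝ} {t : ℝ} {x : E3}
    (hn : SmoothAt n t x) (hu : SmoothAt u t x) (hφ : SmoothAt φ t x) :
    SmoothAt (fun s => c.energyDensity (n s) (u s) (φ s)) t x :=
  (hu.norm_sq.const_mul (c.ρ / 2)).add (c.smoothAt_potentialDensity hn hφ)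

variable {c}

/-- The chain rule used in time applies equally to a straight line in space with frozen fields. -/
theorem inner_gradS_potentialDensity {n : E3 → E3} {φ : E3 → ℝ} {x : E3}
    (hn : ContDiffAt ℝ ∞ n x) (hφ : ContDiffAt ℝ ∞ φ x) (w : E3) :
    ⟪gradS n (c.potentialDensity n φ) x, w⟫ = c.localChemPot n φ x * ⟪gradS n φ x, w⟫
      + c.bendingMoment n φ x * ⟪gradS n (meanCurv n) x, w⟫
      + c.σ * c.ε * (1 / 2 * ⟪gradS n (fun y => ‖gradS n φ y‖ ^ 2) x, w⟫) := by
  have hns := hn.smoothAt 0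
  have hφs := hφ.smoothAt 0
  simp only [inner_gradS]
  set v := tangProj (n x) w
  have line : ∀ {F : E3 → ℝ}, DifferentiableAt ℝ F x →
      HasDerivAt (fun s : ℝ => F (x + s • v)) (fderiv ℝ F x v) 0 := fun hF =>
    hF.hasFDerivAt.hasLineDerivAt v
  have h1 := c.hasDerivAt_potentialDensity (n := fun _ => n) (φ := fun _ => φ)
    (x := fun s => x + s • v) (t := 0) (r := 1 / 2 * fderiv ℝ (fun y => ‖gradS n φ y‖ ^ 2) x v)
    (line hφs.differentiableAt) (line hns.meanCurv.differentiableAt)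
    ((line (hns.gradS hφs).norm_sq.differentiableAt).congr_deriv (by ring))
  have h2 := (line (c.smoothAt_potentialDensity hns hφs).differentiableAt).unique h1
  simpa using h2

variable {M : Type*} [TopologicalSpace M] [T2Space M] [CompactSpace M]
  [ChartedSpace (EuclideanSpace ℝ (Fin 2)) M] [IsManifold (𝓡 2) ∞ M]
  {I : Set ℝ} {Xm X : ℝ → M → E3} {n u : ℝ → E3 → E3} {p φ μ : ℝ → E3 → ℝ}

theorem matD_energyDensity (h : IsMaterialFlow I Xm n u) {t : ℝ} (ht : t ∈ I) {x : E3}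
    (hx : x ∈ range (Xm t)) (hφ : SmoothAt φ t x) :
    matD u (fun s => c.energyDensity (n s) (u s) (φ s)) t x
      = c.ρ * ⟪u t x, matD u u t x⟫ + c.localChemPot (n t) (φ t) x * matD u φ t x
        + c.bendingMoment (n t) (φ t) x * matD u (fun s => meanCurv (n s)) t x
        + c.σ * c.ε * (⟪gradS (n t) (matD u φ t) x, gradS (n t) (φ t) x⟫
          - ⟪gradS (n t) (φ t) x, fderiv ℝ (u t) x (gradS (n t) (φ t) x)⟫) := by
  obtain ⟨y, rfl⟩ := hx
  have hv := h.velocity t ht y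
  have hns := h.smooth_n t ht _ ⟨y, rfl⟩
  have hus := h.smooth_u t ht _ ⟨y, rfl⟩
  have h1 := hasDerivAt_matD hv (c.smoothAt_energyDensity hns hus hφ)
  have h2 := ((hasDerivAt_matD hv hus).norm_sq.const_mul (c.ρ / 2)).add
    (c.hasDerivAt_potentialDensity (hasDerivAt_matD hv hφ) (hasDerivAt_matD hv hns.meanCurv)
      (h.hasDerivAt_norm_gradS_sq ht y hφ))
  rw [h1.unique h2]
  ring

namespace IsSmoothSolution

omit [T2Space M] [CompactSpace M] in
-- This is the power balance obtained by testing the momentum equation with u; it replaces the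
-- kinetic part of the energy rate.
theorem inner_momentum (hI : IsOpen I) (h : c.IsSmoothSolution I Xm X n u p φ μ) {t : ℝ}
    (ht : t ∈ I) {x : E3} (hx : x ∈ range (X t)) :
    c.ρ * ⟪u t x, matD u u t x⟫ = -⟪gradS (n t) (p t) x, u t x⟫
      - p t x * (meanCurv (n t) x * ⟪u t x, n t x⟫)
      + 2 * c.η * ⟪u t x, divC (n t) (rateOfDef (n t) (u t)) x⟫ - c.γ * ‖u t x‖ ^ 2
      + μ t x * ⟪gradS (n t) (φ t) x, u t x⟫
      + (-(lapS (n t) (c.bendingMoment (n t) (φ t)) x + c.bendingMoment (n t) (φ t) x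
        * (frobSq (shapeOp (n t) x)
          - 1 / 2 * meanCurv (n t) x * (meanCurv (n t) x - c.H₀ (φ t x))))
      + c.glDensity (n t) (φ t) x * meanCurv (n t) x
      - c.σ * c.ε * ⟪gradS (n t) (φ t) x, shapeOp (n t) x (gradS (n t) (φ t) x)⟫)
        * ⟪u t x, n t x⟫ := by
  obtain ⟨y, rfl⟩ := hx
  have h1 := congrArg (fun v => ⟪u t (X t y), v⟫) (h.momentum t ht y)
  simp only [h.matAccel_eq hI ht y, inner_smul_right, inner_add_right, inner_sub_right,
    inner_neg_right, forceT, forceN, neg_smul, real_inner_self_eq_norm_sq] at h1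
  rw [h1, real_inner_comm (gradS (n t) (p t) (X t y)), real_inner_comm (gradS (n t) (φ t) (X t y)),
    bendingMoment, glDensity]
  ring

/-- Local form of the energy balance. -/
theorem isDivergence_energy (hI : IsOpen I) (h : c.IsSmoothSolution I Xm X n u p φ μ) {t : ℝ}
    (ht : t ∈ I) :
    IsDivergence (range (X t)) (n t) fun x =>
      matD u (fun s => c.energyDensity (n s) (u s) (φ s)) t x
        + c.dissipationDensity (n t) (u t) (μ t) x := by
  have hfl := h.isMaterialFlow hI
  have hΓ := h.same_surface t ht
  have hS : IsClosedSurface (range (X t)) (n t) := hΓ ▸ hfl.surface t ht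
  have hn : ∀ x ∈ range (X t), SmoothAt n t x := fun x hx => h.normal.smooth t ht x hx
  have hu : ∀ x ∈ range (X t), SmoothAt u t x := fun x hx => h.smooth_u t ht x hx
  have hp : ∀ x ∈ range (X t), SmoothAt p t x := fun x hx => h.smooth_p t ht x hx
  have hφ : ∀ x ∈ range (X t), SmoothAt φ t x := fun x hx => h.smooth_φ t ht x hx
  have hμ : ∀ x ∈ range (X t), SmoothAt μ t x := fun x hx => h.smooth_μ t ht x hx
  have hk : ∀ x ∈ range (X t), SmoothAt (fun s => c.bendingMoment (n s) (φ s)) t x :=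
    fun x hx => c.smoothAt_bendingMoment (hn x hx) (hφ x hx)
  have hdφ : ∀ x ∈ range (X t), SmoothAt (matD u φ) t x :=
    fun x hx => SmoothAt.matD (hφ x hx) (hu x hx)
  have hdn : ∀ x ∈ range (X t), SmoothAt (matD u n) t x :=
    fun x hx => SmoothAt.matD (hn x hx) (hu x hx)
  have hq : ∀ x ∈ range (X t), SmoothAt (fun s => gradS (n s) (φ s)) t x :=
    fun x hx => (hn x hx).gradS (hφ x hx)
  have hflux : ∀ {f : ℝ → E3 → ℝ}, (∀ x ∈ range (X t), SmoothAt f t x) →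
      IsDivergence (range (X t)) (n t) fun x =>
        f t x * (meanCurv (n t) x * ⟪u t x, n t x⟫) + ⟪gradS (n t) (f t) x, u t x⟫ := fun {f} hf =>
    ⟨fun y => f t y • u t y, fun x hx => ((hf x hx).smul (hu x hx)).contDiffAt, fun x hx =>
      (divergence_smul_of_divP_eq_zero (hS.norm_eq_one x hx) (hf x hx).differentiableAt
        (hu x hx).differentiableAt (h.inextensible t ht x hx)).symm⟩
  have dP := hflux hp
  have dE := hflux (f := fun s => c.potentialDensity (n s) (φ s))
    fun x hx => c.smoothAt_potentialDensity (hn x hx) (hφ x hx)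
  have dV : IsDivergence (range (X t)) (n t) fun x =>
      ⟪u t x, divC (n t) (rateOfDef (n t) (u t)) x⟫ + frobSq (rateOfDef (n t) (u t) x) :=
    ⟨fun y => rateOfDef (n t) (u t) y (u t y), fun x hx =>
      (((hn x hx).rateOfDef (hu x hx)).clm_apply (hu x hx)).contDiffAt, fun x hx =>
      (hS.divergence_rateOfDef hx (hu x hx).contDiffAt).symm⟩
  have dM := hS.isDivergence_green (fun x hx => (hμ x hx).contDiffAt)
    (fun x hx => (hμ x hx).contDiffAt)
  have dφ := hS.isDivergence_green (fun x hx => (hdφ x hx).contDiffAt)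
    (fun x hx => (hφ x hx).contDiffAt)
  have dK : IsDivergence (range (X t)) (n t) (divergence (n t) fun y =>
      ⟪gradS (n t) (φ t) y, u t y⟫ • gradS (n t) (φ t) y) :=
    ⟨_, fun x hx => (((hq x hx).inner (hu x hx)).smul (hq x hx)).contDiffAt, fun _ _ => rfl⟩
  have dB₁ : IsDivergence (range (X t)) (n t) (divergence (n t) fun y =>
      c.bendingMoment (n t) (φ t) y • matD u n t y) :=
    ⟨_, fun x hx => ((hk x hx).smul (hdn x hx)).contDiffAt, fun _ _ => rfl⟩
  have dB₂ : IsDivergence (range (X t)) (n t) (divergence (n t) fun y =>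
      c.bendingMoment (n t) (φ t) y • gradC (n t) (n t) y (u t y)) :=
    ⟨_, fun x hx => ((hk x hx).smul
      (((hn x hx).gradC (hn x hx)).clm_apply (hu x hx))).contDiffAt, fun _ _ => rfl⟩
  have dB₃ : IsDivergence (range (X t)) (n t) (divergence (n t) fun y =>
      ⟪u t y, n t y⟫ • gradS (n t) (c.bendingMoment (n t) (φ t)) y) :=
    ⟨_, fun x hx => (((hu x hx).inner (hn x hx)).smul
      ((hn x hx).gradS (hk x hx))).contDiffAt, fun _ _ => rfl⟩
  -- The combination collects viscous stress and pressure, diffusion flux and convected potential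
  -- energy, then the gradient-energy and bending fluxes. The weights are the coefficients in the
  -- energy rate.
  obtain ⟨W, hW, hWd⟩ := hS.isDivergence_add
    (hS.isDivergence_add
      (hS.isDivergence_sub (hS.isDivergence_const_mul dV (2 * c.η)) dP)
      (hS.isDivergence_add (hS.isDivergence_const_mul dM c.m) dE))
    (hS.isDivergence_add
      (hS.isDivergence_const_mul (hS.isDivergence_sub dφ dK) (c.σ * c.ε))
      (hS.isDivergence_sub dB₂ (hS.isDivergence_add dB₁ dB₃)))
  refine ⟨W, hW, fun x hx => ?_⟩
  rw [← hWd x hx]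
  have hx' : x ∈ range (Xm t) := hΓ ▸ hx
  have hphase : matD u φ t x = c.m * lapS (n t) (μ t) x := by
    obtain ⟨y, rfl⟩ := hx
    rw [← h.matDeriv_eq hI ht y, h.phase t ht y]
  have hchem := (h.chemical t ht x hx).trans (c.chemPot_eq _ _ _)
  have hbend := hS.bending_variation hx (hu x hx).differentiableAt (hdn x hx).differentiableAt
    (hk x hx).contDiffAt (hfl.inner_matD_normal_self ht hx')
    fun w hw => hfl.inner_matD_normal ht hx' hw
  have hkort := hS.inner_gradS_fderiv hx (hφ x hx).contDiffAt (hu x hx).differentiableAt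
  have hpot := inner_gradS_potentialDensity (c := c) (hn x hx).contDiffAt (hφ x hx).contDiffAt
    (u t x)
  have hdens : c.potentialDensity (n t) (φ t) x = 1 / 2 * c.bendingMoment (n t) (φ t) x
      * (meanCurv (n t) x - c.H₀ (φ t x)) + c.glDensity (n t) (φ t) x := by
    rw [potentialDensity, bendingMoment]; ring
  beta_reduce
  rw [matD_energyDensity hfl ht hx' (hφ x hx), hfl.matD_meanCurv ht hx', hbend,
    h.inner_momentum hI ht hx, dissipationDensity]
  simp only [real_inner_self_eq_norm_sq]
  rw [hpot, hkort, hdens, hphase]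
  -- The chemical potential is used twice: in the power of b_T, with factor ⟨∇φ, u⟩, and in the
  -- phase term, with factor Dφ = mΔμ.
  linear_combination (⟪gradS (n t) (φ t) x, u t x⟫ - c.m * lapS (n t) (μ t) x) * hchem

end IsSmoothSolution

end Params

/-! ### Passage from densities to integrals, and conclusion -/

theorem surfInt_const_mul (Γ : Set E3) (a : ℝ) (f : E3 → ℝ) :
    surfInt Γ (fun x => a * f x) = a * surfInt Γ f :=
  integral_const_mul a f

theorem surfInt_nonneg {Γ : Set E3} {f : E3 → ℝ} (hf : ∀ x, 0 ≤ f x) : 0 ≤ surfInt Γ f :=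
  integral_nonneg hf

theorem frobSq_nonneg (A : E3 →L[ℝ] E3) : 0 ≤ frobSq A :=
  Finset.sum_nonneg fun _ _ => sq_nonneg _

namespace Params

theorem dissipationDensity_nonneg (c : Params) (n u : E3 → E3) (μ : E3 → ℝ) (x : E3) :
    0 ≤ c.dissipationDensity n u μ x := by
  have := c.η_nonneg
  have := c.γ_nonneg
  have := c.m_pos
  have := frobSq_nonneg (rateOfDef n u x)
  rw [dissipationDensity]
  positivity

/-- The total energy as a single surface integral. -/
theorem kinetic_add_potential (c : Params) {Γ : Set E3} {n u : E3 → E3} {φ : E3 → ℝ}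
    (h : IsClosedSurface Γ n) (hu : ∀ x ∈ Γ, ContDiffAt ℝ ∞ u x)
    (hφ : ∀ x ∈ Γ, ContDiffAt ℝ ∞ φ x) :
    c.kinetic Γ u + c.potential Γ n φ = surfInt Γ (c.energyDensity n u φ) := by
  have hn : ∀ x ∈ Γ, SmoothAt (fun _ => n) 0 x := fun x hx => (h.smooth x hx).smoothAt 0
  have cont : ∀ {F : E3 → ℝ}, (∀ x ∈ Γ, SmoothAt (fun _ => F) 0 x) → ContinuousOn F Γ :=
    fun hF x hx => (hF x hx).differentiableAt.continuousAt.continuousWithinAt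
  have hk : ContinuousOn (fun x => c.ρ / 2 * ‖u x‖ ^ 2) Γ :=
    cont fun x hx => ((hu x hx).smoothAt 0).norm_sq.const_mul (c.ρ / 2)
  have hp : ContinuousOn (c.potentialDensity n φ) Γ :=
    cont fun x hx => c.smoothAt_potentialDensity (hn x hx) ((hφ x hx).smoothAt 0)
  have hg : ContinuousOn (c.glDensity n φ) Γ := cont fun x hx =>
    (((((hn x hx).gradS ((hφ x hx).smoothAt 0)).norm_sq.const_mul (c.ε / 2)).add
      ((((hφ x hx).smoothAt 0).comp_real contDiff_doubleWell).const_mul (1 / c.ε))).const_mul c.σ)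
  have hh : ContinuousOn (fun x => 1 / 2 * c.κ (φ x) * (meanCurv n x - c.H₀ (φ x)) ^ 2) Γ :=
    (hp.sub hg).congr fun x _ => by simp [potentialDensity]
  rw [kinetic, potential, helfrich, ginzburgLandau, ← h.surfInt_add hh hg]
  exact (h.surfInt_add hk hp).symm

/-- The dissipation potential as a single surface integral. -/
theorem two_mul_dissipation (c : Params) {Γ : Set E3} {n u : E3 → E3} {μ f : E3 → ℝ}
    (h : IsClosedSurface Γ n) (hu : ∀ x ∈ Γ, ContDiffAt ℝ ∞ u x)
    (hμ : ∀ x ∈ Γ, ContDiffAt ℝ ∞ μ x) (hf : ∀ x ∈ Γ, f x = c.m * lapS n μ x) :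
    2 * c.dissipation Γ n u f = surfInt Γ (c.dissipationDensity n u μ) := by
  have hn : ∀ x ∈ Γ, SmoothAt (fun _ => n) 0 x := fun x hx => (h.smooth x hx).smoothAt 0
  have cont : ∀ {F : E3 → ℝ}, (∀ x ∈ Γ, SmoothAt (fun _ => F) 0 x) → ContinuousOn F Γ :=
    fun hF x hx => (hF x hx).differentiableAt.continuousAt.continuousWithinAt
  have hv : ContinuousOn (fun x => 2 * c.η * frobSq (rateOfDef n u x)) Γ :=
    cont fun x hx => ((hn x hx).rateOfDef ((hu x hx).smoothAt 0)).frobSq.const_mul (2 * c.η)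
  have hγ : ContinuousOn (fun x => c.γ * ‖u x‖ ^ 2) Γ :=
    cont fun x hx => ((hu x hx).smoothAt 0).norm_sq.const_mul c.γ
  have hm : ContinuousOn (fun x => c.m * ‖gradS n μ x‖ ^ 2) Γ :=
    (h.continuousOn_norm_gradS_sq hμ).const_mul c.m
  have hH : hMinusOneSq Γ n f = c.m ^ 2 * surfInt Γ fun x => ‖gradS n μ x‖ ^ 2 := by
    -- The phase equation makes mμ a potential. Its Dirichlet energy m²∫‖∇μ‖², multiplied by 2 ·
    -- 1/(2m), becomes m∫‖∇μ‖².
    rw [h.hMinusOneSq_eq (ψ := fun y => c.m * μ y) (fun x hx => contDiffAt_const.mul (hμ x hx))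
      fun x hx => ?_, ← surfInt_const_mul]
    · refine h.surfInt_congr fun x _ => ?_
      rw [gradS_const_mul, norm_smul, mul_pow, Real.norm_eq_abs, sq_abs]
    · rw [hf x hx, lapS_const_mul (h.norm_eq_one x hx)
        ((hn x hx).gradS ((hμ x hx).smoothAt 0)).differentiableAt]
  have hsum : surfInt Γ (c.dissipationDensity n u μ)
      = surfInt Γ (fun x => 2 * c.η * frobSq (rateOfDef n u x))
        + surfInt Γ (fun x => c.γ * ‖u x‖ ^ 2) + surfInt Γ (fun x => c.m * ‖gradS n μ x‖ ^ 2) := by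
    rw [← h.surfInt_add hv hγ]
    exact h.surfInt_add (hv.add hγ) hm
  have hm0 := c.m_pos.ne'
  rw [hsum, dissipation, dissViscous, dissFriction, dissPhase, hH]
  simp only [surfInt_const_mul]
  field_simp

/-- The energy balance. -/
theorem IsSmoothSolution.hasDerivAt_energy {M : Type*} [TopologicalSpace M] [T2Space M]
    [CompactSpace M] [ChartedSpace (EuclideanSpace ℝ (Fin 2)) M] [IsManifold (𝓡 2) ∞ M]
    {c : Params} {I : Set ℝ} (hI : IsOpen I) {Xm X : ℝ → M → E3} {n u : ℝ → E3 → E3}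
    {p φ μ : ℝ → E3 → ℝ} (h : c.IsSmoothSolution I Xm X n u p φ μ) {t : ℝ} (ht : t ∈ I) :
    HasDerivAt (fun s => c.kinetic (range (X s)) (u s) + c.potential (range (X s)) (n s) (φ s))
      (-surfInt (range (X t)) (c.dissipationDensity (n t) (u t) (μ t))) t := by
  have hfl := h.isMaterialFlow hI
  have hS : ∀ s ∈ I, IsClosedSurface (range (X s)) (n s) := fun s hs =>
    h.normal.isClosedSurface hI h.observer hs
  have hn : ∀ s ∈ I, ∀ x ∈ range (X s), SmoothAt n s x := fun s hs x hx => h.normal.smooth s hs x hx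
  have hu : ∀ s ∈ I, ∀ x ∈ range (X s), SmoothAt u s x := fun s hs x hx => h.smooth_u s hs x hx
  have hφ : ∀ s ∈ I, ∀ x ∈ range (X s), SmoothAt φ s x := fun s hs x hx => h.smooth_φ s hs x hx
  have hμ : ∀ x ∈ range (X t), SmoothAt μ t x := fun x hx => h.smooth_μ t ht x hx
  have he : ∀ s ∈ I, ∀ x ∈ range (X s),
      SmoothAt (fun s => c.energyDensity (n s) (u s) (φ s)) s x := fun s hs x hx =>
    c.smoothAt_energyDensity (hn s hs x hx) (hu s hs x hx) (hφ s hs x hx)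
  have h1 := hfl.hasDerivAt_surfInt
    (fun s hs x hx => he s hs x ((h.same_surface s hs).le hx)) ht
  have hev : (fun s => c.kinetic (range (X s)) (u s) + c.potential (range (X s)) (n s) (φ s))
      =ᶠ[𝓝 t] fun s => surfInt (range (Xm s)) (c.energyDensity (n s) (u s) (φ s)) :=
    eventually_of_mem (hI.mem_nhds ht) fun s hs => by
      show _ = surfInt (range (Xm s)) _
      rw [h.same_surface s hs]
      exact c.kinetic_add_potential (hS s hs) (fun x hx => (hu s hs x hx).contDiffAt)
        fun x hx => (hφ s hs x hx).contDiffAt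
  refine (h1.congr_of_eventuallyEq hev).congr_deriv ?_
  have hcD : ContinuousOn (matD u (fun s => c.energyDensity (n s) (u s) (φ s)) t) (range (X t)) :=
    fun x hx => (SmoothAt.matD (he t ht x hx)
      (hu t ht x hx)).differentiableAt.continuousAt.continuousWithinAt
  have hcd : ContinuousOn (c.dissipationDensity (n t) (u t) (μ t)) (range (X t)) := fun x hx =>
    (((((hn t ht x hx).rateOfDef (hu t ht x hx)).frobSq.const_mul (2 * c.η)).add
      ((hu t ht x hx).norm_sq.const_mul c.γ)).add (((hn t ht x hx).gradS
        (hμ x hx)).norm_sq.const_mul c.m)).differentiableAt.continuousAt.continuousWithinAt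
  -- Integrating the local balance removes the divergence and leaves the energy rate plus
  -- dissipation equal to zero.
  have h2 := (hS t ht).surfInt_eq_zero (h.isDivergence_energy hI ht)
  rw [(hS t ht).surfInt_add hcD hcd] at h2
  rw [h.same_surface t ht]
  linarith

end Params

end TwoPhaseSurface

end

theorem mainTheorem1 {M : Type*} [TopologicalSpace M] [T2Space M] [CompactSpace M]
    [ChartedSpace (EuclideanSpace ℝ (Fin 2)) M] [IsManifold (𝓡 2) ∞ M]
    (c : TwoPhaseSurface.Params) (I : Set ℝ) (hI : IsOpen I)
    (Xm X : ℝ → M → TwoPhaseSurface.E3) (n u : ℝ → TwoPhaseSurface.E3 → TwoPhaseSurface.E3)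
    (p φ μ : ℝ → TwoPhaseSurface.E3 → ℝ) (hsol : c.IsSmoothSolution I Xm X n u p φ μ)
    (φdot : ℝ → TwoPhaseSurface.E3 → ℝ)
    (hφdot : ∀ t ∈ I, ∀ y, φdot t (X t y) = TwoPhaseSurface.matDeriv X n u φ t y)
    (t : ℝ) (ht : t ∈ I) :
    HasDerivAt
        (fun s => c.kinetic (range (X s)) (u s) + c.potential (range (X s)) (n s) (φ s))
        (-2 * c.dissipation (range (X t)) (n t) (u t) (φdot t)) t
      ∧ -2 * c.dissipation (range (X t)) (n t) (u t) (φdot t) ≤ 0 := by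
  have key : 2 * c.dissipation (range (X t)) (n t) (u t) (φdot t)
      = TwoPhaseSurface.surfInt (range (X t)) (c.dissipationDensity (n t) (u t) (μ t)) := by
    refine c.two_mul_dissipation (hsol.normal.isClosedSurface hI hsol.observer ht)
      (fun x hx => TwoPhaseSurface.SmoothAt.contDiffAt (hsol.smooth_u t ht x hx))
      (fun x hx => TwoPhaseSurface.SmoothAt.contDiffAt (hsol.smooth_μ t ht x hx)) ?_
    rintro _ ⟨y, rfl⟩
    rw [hφdot t ht y, hsol.phase t ht y]
  rw [neg_mul, key]
  exact ⟨hsol.hasDerivAt_energy hI ht, neg_nonpos.2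
    (TwoPhaseSurface.surfInt_nonneg (c.dissipationDensity_nonneg (n t) (u t) (μ t)))⟩
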